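/- For $r,u,v\in\mathbb{N}$ with $u,v<2^r$ let $Q_r(u,v)=2^{-r}\big([u,u+1)\times[v,v+1)\big)$, and let $\mathcal{Q}$ be the set of all these dyadic squares of $[0,1)^2$. A martingale is a function $d:\mathcal{Q}\to[0,\infty)$ with $d(Q_r(u,v))=\frac14\sum_{\alpha,\beta\in\{0,1\}}d(Q_{r+1}(2u+\alpha,2v+\beta))$ for all $Q_r(u,v)\in\mathcal{Q}$. Its success set $S^\infty[d]$ is the set of all $(x,y)\in[0,1)^2$ with $\limsup_{r\to\infty}d\big(Q_r(\lfloor 2^rx\rfloor,\lfloor 2^ry\rfloor)\big)=\infty$. A martingale $d$ is double exponential time computable if there is a function $\hat d:\mathcal{Q}\times\mathbb{N}\to\mathbb{Q}$ such that $|d(Q_r(u,v))-\hat d(Q_r(u,v),t)|<2^{-t}$ for all $Q_r(u,v)\in\mathcal{Q}$ and $t\in\mathbb{N}$, and such that $\hat d(Q_r(u,v),t)$ is computable (by a Turing machine) in time $2^{2^{O(r+t)}}$. For $E\subseteq\mathbb{R}^2$ let $\#E=[0,1)^2\cap\bigcup_{i,j\in\mathbb{Z}}\big(E-(i,j)\big)$.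 The set $E$ has double exponential time measure $0$ (ee-measure $0$) if $\#E\subseteq S^\infty[d]$ for some double exponential time computable martingale $d$. Let $(x_k)_{k\in\mathbb{N}}$ be the concatenation, over $\ell=0,1,2,\ldots$, of the finite blocks $$X_\ell=\big((-1)^\ell(i2^{-\ell}-\ell):\ i=0,\ldots,2^\ell(2\ell+1)-1\big),$$ for $a\in[0,1]$ let $b(a)$ be the sum of the convergent series $\sum_{n=1}^\infty(x_{n-1}-x_n)\big(a-2^{-n}\lfloor a2^n\rfloor\big)$, and let $$F=\{(x,ax+b(a)):a\in[0,1],\ x\in\mathbb{R}\}.$$ **Theorem.** There is a set in the plane $\mathbb{R}^2$ that has ee-measure $0$ and contains a full line in every direction. In fact the union of $F$ with its three rotated copies, by the angles $\pi/4$, $\pi/2$ and $3\pi/4$ about the origin, is such a set. -/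

import Mathlib

noncomputable section

namespace EEKakeya

/-! ### Martingales on the dyadic squares of `[0,1)²`

The dyadic square `Q_r(u,v) = 2⁻ʳ([u,u+1) × [v,v+1))`, with `u, v < 2^r`, is represented by the
triple `(r,u,v)`, so a function on the set of dyadic squares of `[0,1)²` is a function
`d : ℕ → ℕ → ℕ → ℝ`, of which only the values `d r u v` with `u, v < 2^r` matter. -/

/-- `d` is nonnegative and satisfies the averaging condition on all dyadic squares of `[0,1)²`. -/
def IsMartingale (d : ℕ → ℕ → ℕ → ℝ) : Prop :=
  ∀ r u v : ℕ, u < 2 ^ r → v < 2 ^ r →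
    0 ≤ d r u v ∧
    d r u v = 1 / 4 * ∑ α ∈ Finset.range 2, ∑ β ∈ Finset.range 2,
      d (r + 1) (2 * u + α) (2 * v + β)

/-- The half-open unit square `[0,1)²`. -/
def unitSquare : Set (ℝ × ℝ) := Set.Ico 0 1 ×ˢ Set.Ico 0 1

/-- The value of `d` on the unique `r`-dyadic square containing the point `p` of `[0,1)²`. -/
def valueAt (d : ℕ → ℕ → ℕ → ℝ) (r : ℕ) (p : ℝ × ℝ) : ℝ :=
  d r ⌊2 ^ r * p.1⌋₊ ⌊2 ^ r * p.2⌋₊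

/-- The success set of `d`: the points of `[0,1)²` at which the limit superior of the values
of `d` is infinite. -/
def successSet (d : ℕ → ℕ → ℕ → ℝ) : Set (ℝ × ℝ) :=
  {p | p ∈ unitSquare ∧
    Filter.limsup (fun r : ℕ => ((valueAt d r p : ℝ) : EReal)) Filter.atTop = ⊤}

/-- `#E`, the union of all integer translates `E - (i,j)`, intersected with `[0,1)²`. -/
def hash (E : Set (ℝ × ℝ)) : Set (ℝ × ℝ) :=
  unitSquare ∩ ⋃ (i : ℤ) (j : ℤ), {p | p + ((i : ℝ), (j : ℝ)) ∈ E}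

/-! ### Double exponential time

Running time is the number of steps of a multi-stack Turing machine (`Turing.FinTM2`) with finite
stack alphabets. Numbers are written in binary, in the alphabet `Computability.Γ'` of bits and
punctuation. -/

open Computability in
/-- The input `(Q_r(u,v), t)`, as the four numbers `r, u, v, t` in binary, separated by commas. -/
def encodeInput (r u v t : ℕ) : List Γ' :=
  encodingNatΓ'.encode r ++ Γ'.comma :: (encodingNatΓ'.encode u ++ Γ'.comma ::
    (encodingNatΓ'.encode v ++ Γ'.comma :: encodingNatΓ'.encode t))

open Computability in
/-- The fraction `p / q`, as the sign bit of `p` followed by the absolute value of `p` and by `q`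
in binary, separated by a comma. -/
def encodeFraction (p : ℤ) (q : ℕ) : List Γ' :=
  Γ'.bit (decide (p < 0)) ::
    (encodingNatΓ'.encode p.natAbs ++ Γ'.comma :: encodingNatΓ'.encode q)

/-- Some Turing machine computes `dhat (Q_r(u,v), t)`, as a fraction (not necessarily in lowest
terms), in time `2 ^ 2 ^ O(r + t)`, for all dyadic squares `Q_r(u,v)` of `[0,1)²` and all `t`. -/
def ComputableInDoubleExpTime (dhat : ℕ → ℕ → ℕ → ℕ → ℚ) : Prop :=
  ∃ M : Turing.TM2ComputableAux Computability.Γ' Computability.Γ',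
    (∀ k, Finite (M.tm.Γ k)) ∧
    ∃ c : ℕ, ∀ r u v t : ℕ, u < 2 ^ r → v < 2 ^ r →
      ∃ (p : ℤ) (q : ℕ), 0 < q ∧ dhat r u v t = (p : ℚ) / (q : ℚ) ∧
        Nonempty (Turing.TM2OutputsInTime M.tm
          ((encodeInput r u v t).map M.inputAlphabet.symm)
          (some ((encodeFraction p q).map M.outputAlphabet.symm))
          (2 ^ 2 ^ (c * (r + t) + c)))

/-- `d` is approximated within `2⁻ᵗ` by a rational-valued function of the square and of `t` that is
computable in time `2 ^ 2 ^ O(r + t)`. -/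
def IsDoubleExpTimeComputable (d : ℕ → ℕ → ℕ → ℝ) : Prop :=
  ∃ dhat : ℕ → ℕ → ℕ → ℕ → ℚ,
    (∀ r u v t : ℕ, u < 2 ^ r → v < 2 ^ r →
      |d r u v - (dhat r u v t : ℝ)| < 2 ^ (-(t : ℤ))) ∧
    ComputableInDoubleExpTime dhat

/-- `E` has double exponential time measure 0. -/
def HasEEMeasureZero (E : Set (ℝ × ℝ)) : Prop :=
  ∃ d : ℕ → ℕ → ℕ → ℝ,
    IsMartingale d ∧ IsDoubleExpTimeComputable d ∧ hash E ⊆ successSet d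

/-! ### The set -/

/-- The block `ℓ` and the position `i` in that block of the `k`-th term of the concatenation of
blocks of lengths `2^ℓ (2ℓ+1)`, for `ℓ = 0, 1, 2, …`. -/
def blockIndex : ℕ → ℕ × ℕ
  | 0 => (0, 0)
  | k + 1 =>
    let p := blockIndex k
    if p.2 + 1 < 2 ^ p.1 * (2 * p.1 + 1) then (p.1, p.2 + 1) else (p.1 + 1, 0)

/-- The sequence `x_k`: the term at position `i` of the block `ℓ` is `(-1)^ℓ (i 2^(-ℓ) - ℓ)`. -/
def xseq (k : ℕ) : ℝ :=
  (-1) ^ (blockIndex k).1 * ((blockIndex k).2 / 2 ^ (blockIndex k).1 - (blockIndex k).1)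

/-- The term with index `n + 1` of the series that defines the intercept. -/
def interceptTerm (a : ℝ) (n : ℕ) : ℝ :=
  (xseq n - xseq (n + 1)) * (a - ⌊a * 2 ^ (n + 1)⌋ / 2 ^ (n + 1))

/-- The intercept `b(a)`, the sum over `n ≥ 1` of `(x_{n-1} - x_n) (a - 2⁻ⁿ ⌊a 2ⁿ⌋)`. -/
def intercept (a : ℝ) : ℝ := ∑' n : ℕ, interceptTerm a n

/-- The union `F` of the lines `y = a x + b(a)` with slope `a ∈ [0,1]`. -/
def lineFamily : Set (ℝ × ℝ) :=
  {p | ∃ a ∈ Set.Icc (0 : ℝ) 1, ∃ x : ℝ, p = (x, a * x + intercept a)}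

/-- The rotation of the plane by the angle `θ` about the origin. -/
def rotation (θ : ℝ) (p : ℝ × ℝ) : ℝ × ℝ :=
  (Real.cos θ * p.1 - Real.sin θ * p.2, Real.sin θ * p.1 + Real.cos θ * p.2)

/-- The set `E` contains a full line in every direction. -/
def ContainsLineInEveryDirection (E : Set (ℝ × ℝ)) : Prop :=
  ∀ θ : ℝ, ∃ p : ℝ × ℝ, ∀ s : ℝ, p + s • (Real.cos θ, Real.sin θ) ∈ E

theorem blockIndex_lt (k : ℕ) :
    (blockIndex k).2 < 2 ^ (blockIndex k).1 * (2 * (blockIndex k).1 + 1) := by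
  cases k with
  | zero => simp [blockIndex]
  | succ k =>
    simp only [blockIndex]
    split_ifs with h
    · exact h
    · positivity

theorem abs_xseq_sub_le (k : ℕ) : |xseq k - xseq (k + 1)| ≤ 1 := by
  have hlt := blockIndex_lt k
  unfold xseq
  simp only [blockIndex]
  generalize blockIndex k = p at hlt ⊢
  obtain ⟨l, i⟩ := p
  simp only at hlt ⊢
  have h2 : (1 : ℝ) ≤ 2 ^ l := one_le_pow₀ (by norm_num)
  have h0 : (0 : ℝ) < 2 ^ l := by positivity
  have key : |(1 : ℝ) / 2 ^ l| ≤ 1 := by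
    rw [abs_of_pos (by positivity), div_le_one h0]; exact h2
  split_ifs with h
  · have e : (-1 : ℝ) ^ l * (i / 2 ^ l - l) - (-1) ^ l * (((i + 1 : ℕ) : ℝ) / 2 ^ l - l)
        = -((-1) ^ l * (1 / 2 ^ l)) := by
      push_cast; ring
    rw [e, abs_neg, abs_mul, abs_pow, abs_neg, abs_one, one_pow, one_mul]
    exact key
  · have hi : i + 1 = 2 ^ l * (2 * l + 1) := by omega
    have hi' : (i : ℝ) = 2 ^ l * (2 * l + 1) - 1 := by
      have : ((i + 1 : ℕ) : ℝ) = ((2 ^ l * (2 * l + 1) : ℕ) : ℝ) := by rw [hi]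
      push_cast at this
      linarith
    have e : (-1 : ℝ) ^ l * (i / 2 ^ l - l) -
        (-1) ^ (l + 1) * (((0 : ℕ) : ℝ) / 2 ^ (l + 1) - ((l + 1 : ℕ) : ℝ))
        = -((-1) ^ l * (1 / 2 ^ l)) := by
      rw [hi']; push_cast; field_simp; ring
    rw [e, abs_neg, abs_mul, abs_pow, abs_neg, abs_one, one_pow, one_mul]
    exact key

/-- The series that defines the intercept converges. -/
theorem summable_interceptTerm (a : ℝ) : Summable (interceptTerm a) := by
  refine Summable.of_norm_bounded (g := fun n : ℕ => (1 / 2 : ℝ) ^ n)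
    (summable_geometric_of_lt_one (by norm_num) (by norm_num)) fun n => ?_
  have h0 : (0 : ℝ) < 2 ^ (n + 1) := by positivity
  have e : a - ⌊a * 2 ^ (n + 1)⌋ / 2 ^ (n + 1) = Int.fract (a * 2 ^ (n + 1)) / 2 ^ (n + 1) := by
    rw [Int.fract]; field_simp
  rw [interceptTerm, Real.norm_eq_abs, abs_mul, e, abs_div, abs_of_pos h0,
    abs_of_nonneg (Int.fract_nonneg (a * 2 ^ (n + 1)))]
  have h1 := (Int.fract_lt_one (a * 2 ^ (n + 1))).le
  calc |xseq n - xseq (n + 1)| * (Int.fract (a * 2 ^ (n + 1)) / 2 ^ (n + 1))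
      ≤ 1 * (1 / 2 ^ (n + 1)) := by
        gcongr
        exact abs_xseq_sub_le n
    _ ≤ (1 / 2) ^ n := by
        rw [one_mul, one_div_pow]
        gcongr <;> norm_num

end EEKakeya

end

/-! Geometry. Truncate a slope `a` to `k / 2 ^ N` with `k = ⌊a 2 ^ N⌋`. The first `N` terms of the
series for `b(a)` telescope, so the line of slope `a` and the line of slope `k / 2 ^ N` with
intercept `gridIntercept N k` differ at `x` by `(a - k / 2 ^ N) (x - x_N)` plus the tail of the
series. The steps of the sequence from block `l` on are at most `2 ^ (-l)`, so for `N` in block `l`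
and `|x - x_N| ≤ 2 ^ (-l)` the difference is at most `2 / (2 ^ l 2 ^ N)` (`abs_line_sub_le`). Above
this interval `F` therefore lies in at most `2 ^ N + 1` strips of width `O(2 ^ (-l))` and height
`O(2 ^ (-l) 2 ^ (-N))`, of total area `O(4 ^ (-l))`. The `2 ^ l (2 l + 1)` terms of an even block
`l` serve all of `[-l, l]`, at a cost in area of `O(l 2 ^ (-l))`; the four rotations and the `O(l ^
2)` relevant integer translates still leave `O(l ^ 3 2 ^ (-l))`.

Martingale. For `l = level n` the strips are replaced by dyadic squares of side `2 ^ (-depth n)`, so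
small that rounding to a corner of a square, and rounding `cos (π / 4)` to a dyadic rational, only
enlarges the strips by a constant factor (`near_of_mem`, `cell_subset_stripUnion`). The area of the
`n`-th cover is at most `2 ^ 18 2 ^ (-n)` (`coverDensity_zero_le`). The sum over `n` of the
densities of the covers in a square is a martingale, finite because densities grow at most by the
factor 4 from a square to its child. A point of `#E` belongs to all covers from some index on, and
each of them eventually contributes 1, so the martingale tends to infinity there (`mem_successSet`).

Computability. The first `2 r + t + 20` covers give the martingale up to `2 ^ (-t)`, and their
squares have sides at least `2 ^ (-2 ^ O(r + t))`. So the approximation is a finite count, for which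
a Turing machine must be exhibited. Expressions built from addition, truncated subtraction and
bounded sums are compiled to programs with unary registers, and these to machines with stacks. Their
running time is polynomial in the variables (`Expr.eval_cost_le`); with `M = 2 ^ 2 ^ O(r + t)`
supplied as a variable, all bounded searches below `M` take double exponential time
(`computableInDoubleExpTime_of_expr`). The predicates `Gen`, `GenP`, `GenZ`, `GenR` collect what
such expressions define, up to the numerator of the approximation (`Gen.numer`).

Directions. The angles of `F` fill `[0, π / 4]`, and four rotations by multiples of `π / 4` exhaust
all angles modulo `π`. -/

noncomputable section

namespace EEKakeya

open Computability Turing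

/-! ### Programs on one data stack and countably many unary registers -/

/-- Structured programs acting on a data stack and on registers that hold natural numbers. -/
inductive Prog
  | nop : Prog
  | inc (k : ℕ) : Prog
  | dec (k : ℕ) : Prog
  | push (c : Γ') : Prog
  | pop : Prog
  | seq (p q : Prog) : Prog
  | loop (k : ℕ) (p : Prog) : Prog
  | loopTop (f : Option Γ' → Bool) (p : Prog) : Prog
  | ite (f : Option Γ' → Bool) (p q : Prog) : Prog

/-- `Run p L v L' v' n`: started on the data stack `L` and the registers `v`, the program `p` stops
within `n` steps with the data stack `L'` and the registers `v'`. -/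
inductive Run : Prog → List Γ' → (ℕ → ℕ) → List Γ' → (ℕ → ℕ) → ℕ → Prop
  | nop {L v} : Run .nop L v L v 1
  | inc {L v} (k) : Run (.inc k) L v L (Function.update v k (v k + 1)) 1
  | dec {L v} (k) : Run (.dec k) L v L (Function.update v k (v k - 1)) 1
  | push {L v} (c) : Run (.push c) L v (c :: L) v 1
  | pop {L v} : Run .pop L v L.tail v 1
  | seq {p q L v L₁ v₁ L₂ v₂ m n} : Run p L v L₁ v₁ m → Run q L₁ v₁ L₂ v₂ n →
      Run (.seq p q) L v L₂ v₂ (m + n)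
  | loop_done {k p L v} : v k = 0 → Run (.loop k p) L v L v 1
  | loop_step {k p L v L₁ v₁ L₂ v₂ m n} : v k ≠ 0 → Run p L v L₁ v₁ m →
      Run (.loop k p) L₁ v₁ L₂ v₂ n → Run (.loop k p) L v L₂ v₂ (1 + m + n)
  | loopTop_done {f p L v} : f L.head? = false → Run (.loopTop f p) L v L v 1
  | loopTop_step {f p L v L₁ v₁ L₂ v₂ m n} : f L.head? = true → Run p L v L₁ v₁ m →
      Run (.loopTop f p) L₁ v₁ L₂ v₂ n → Run (.loopTop f p) L v L₂ v₂ (1 + m + n)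
  | ite_true {f p q L v L₁ v₁ n} : f L.head? = true → Run p L v L₁ v₁ n →
      Run (.ite f p q) L v L₁ v₁ (1 + n)
  | ite_false {f p q L v L₁ v₁ n} : f L.head? = false → Run q L v L₁ v₁ n →
      Run (.ite f p q) L v L₁ v₁ (1 + n)
  | mono {p L v L₁ v₁ m n} : Run p L v L₁ v₁ m → m ≤ n → Run p L v L₁ v₁ n

/-! ### Compilation of programs to multi-stack Turing machines. -/

namespace Prog

/-- A number that exceeds the index of every register that the program uses. -/
def bound : Prog → ℕ
  | nop => 0
  | inc k => k + 1
  | dec k => k + 1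
  | push _ => 0
  | pop => 0
  | seq p q => max p.bound q.bound
  | loop k p => max (k + 1) p.bound
  | loopTop _ p => p.bound
  | ite _ p q => max p.bound q.bound

/-- The labels of the machine that runs the program. -/
def Label : Prog → Type
  | nop => Unit
  | inc _ => Unit
  | dec _ => Unit
  | push _ => Unit
  | pop => Unit
  | seq p q => p.Label ⊕ q.Label
  | loop _ p => Option p.Label
  | loopTop _ p => Option p.Label
  | ite _ p q => Option (p.Label ⊕ q.Label)

/-- The label at which the program starts. -/
def entry : (p : Prog) → p.Label
  | nop => ()
  | inc _ => ()
  | dec _ => ()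
  | push _ => ()
  | pop => ()
  | seq p _ => Sum.inl p.entry
  | loop _ _ => none
  | loopTop _ _ => none
  | ite _ _ _ => none

/-- There are finitely many labels. -/
@[reducible] def fintypeLabel : (p : Prog) → Fintype p.Label
  | nop => inferInstanceAs (Fintype Unit)
  | inc _ => inferInstanceAs (Fintype Unit)
  | dec _ => inferInstanceAs (Fintype Unit)
  | push _ => inferInstanceAs (Fintype Unit)
  | pop => inferInstanceAs (Fintype Unit)
  | seq p q =>
    letI := p.fintypeLabel
    letI := q.fintypeLabel
    inferInstanceAs (Fintype (p.Label ⊕ q.Label))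
  | loop _ p =>
    letI := p.fintypeLabel
    inferInstanceAs (Fintype (Option p.Label))
  | loopTop _ p =>
    letI := p.fintypeLabel
    inferInstanceAs (Fintype (Option p.Label))
  | ite _ p q =>
    letI := p.fintypeLabel
    letI := q.fintypeLabel
    inferInstanceAs (Fintype (Option (p.Label ⊕ q.Label)))

/-- The stack of the register `k`. -/
def reg (B k : ℕ) : Fin (B + 1) := Fin.ofNat (B + 1) (k + 1)

/-- Statements of a machine with `B + 1` stacks. -/
abbrev MStmt (B : ℕ) (Λ : Type) : Type :=
  TM2.Stmt (fun _ : Fin (B + 1) => Γ') Λ (Option Computability.Γ' : Type)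

/-- Looks at the stack `k` and jumps according to its topmost symbol. -/
def test {B : ℕ} {Λ : Type} (k : Fin (B + 1)) (f : Option Γ' → Bool) (l₁ l₂ : Λ) : MStmt B Λ :=
  .peek k (fun _ s => s)
    (.branch f (.load (fun _ => none) (.goto fun _ => l₁)) (.load (fun _ => none) (.goto fun _ => l₂)))

/-- The statements at the labels of the program, if its labels are embedded by `e` among the labels
of a machine and control passes to the label `x` at the end. -/
def code (B : ℕ) {Λ : Type} : (p : Prog) → (x : Λ) → (e : p.Label → Λ) → p.Label → MStmt B Λ
  | nop, x, _, _ => .goto fun _ => x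
  | inc k, x, _, _ => .push (reg B k) (fun _ => Γ'.blank) (.goto fun _ => x)
  | dec k, x, _, _ => .pop (reg B k) (fun v _ => v) (.goto fun _ => x)
  | push c, x, _, _ => .push 0 (fun _ => c) (.goto fun _ => x)
  | pop, x, _, _ => .pop 0 (fun v _ => v) (.goto fun _ => x)
  | seq p q, x, e, l =>
    Sum.casesOn (motive := fun _ => MStmt B Λ) l
      (p.code B (e (Sum.inr q.entry)) fun l => e (Sum.inl l))
      (q.code B x fun l => e (Sum.inr l))
  | loop k p, x, e, l =>
    Option.casesOn (motive := fun _ => MStmt B Λ) l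
      (test (reg B k) Option.isSome (e (some p.entry)) x)
      (p.code B (e none) fun l => e (some l))
  | loopTop f p, x, e, l =>
    Option.casesOn (motive := fun _ => MStmt B Λ) l
      (test 0 f (e (some p.entry)) x)
      (p.code B (e none) fun l => e (some l))
  | ite f p q, x, e, l =>
    Option.casesOn (motive := fun _ => MStmt B Λ) l
      (test 0 f (e (some (Sum.inl p.entry))) (e (some (Sum.inr q.entry))))
      fun l => Sum.casesOn (motive := fun _ => MStmt B Λ) l
        (p.code B x fun l => e (some (Sum.inl l)))
        (q.code B x fun l => e (some (Sum.inr l)))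

/-- The stacks that hold the data `L` and the registers `v`. -/
def stk (B : ℕ) (L : List Γ') (v : ℕ → ℕ) : Fin (B + 1) → List Γ' :=
  Fin.cases L fun j => List.replicate (v j) Γ'.blank

@[simp] theorem stk_zero (B : ℕ) (L : List Γ') (v : ℕ → ℕ) : stk B L v 0 = L := rfl

/-- `reg` reduces modulo `B + 1`; no wrap-around occurs for the registers below `B`, and stack `0`
remains reserved for the data. -/
theorem reg_of_lt {B k : ℕ} (h : k < B) : reg B k = Fin.succ ⟨k, h⟩ := by
  ext
  simp [reg, Fin.ofNat, Nat.mod_eq_of_lt (Nat.succ_lt_succ h)]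

theorem stk_reg {B k : ℕ} (h : k < B) (L : List Γ') (v : ℕ → ℕ) :
    stk B L v (reg B k) = List.replicate (v k) Γ'.blank := by
  rw [reg_of_lt h]; rfl

theorem update_stk_zero (B : ℕ) (L L' : List Γ') (v : ℕ → ℕ) :
    Function.update (stk B L v) 0 L' = stk B L' v := by
  funext j
  refine Fin.cases ?_ (fun j => ?_) j
  · simp
  · rw [Function.update_of_ne (Fin.succ_ne_zero j)]; rfl

theorem update_stk_reg {B k : ℕ} (h : k < B) (L : List Γ') (v : ℕ → ℕ) (n : ℕ) :
    Function.update (stk B L v) (reg B k) (List.replicate n Γ'.blank) =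
      stk B L (Function.update v k n) := by
  rw [reg_of_lt h]
  funext j
  refine Fin.cases ?_ (fun j => ?_) j
  · rw [Function.update_of_ne (Fin.succ_ne_zero _).symm]; rfl
  · by_cases hj : j = ⟨k, h⟩
    · subst hj
      simp [stk]
    · have : (j : ℕ) ≠ k := fun e => hj (Fin.ext e)
      rw [Function.update_of_ne fun e => hj (Fin.succ_injective _ e)]
      simp [stk, Function.update_of_ne this]

end Prog

open Prog in
/-- A machine that contains the code of a program simulates its runs. -/
theorem Run.simulate {p : Prog} {L v L' v' n} (h : Run p L v L' v' n) {B : ℕ} (hB : p.bound ≤ B)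
    {Λ : Type} (m : Λ → MStmt B Λ) (x : Λ) (e : p.Label → Λ) (hm : ∀ l, m (e l) = p.code B x e l) :
    ∃ j ≤ n, (flip bind (TM2.step m))^[j] (some ⟨some (e p.entry), none, stk B L v⟩) =
      some ⟨some x, none, stk B L' v'⟩ := by
  -- Every primitive instruction and every test is the code at a single label, hence one machine
  -- step, with internal state `none` before and after it.
  have one : ∀ {l l' : Λ} {s s' : Fin (B + 1) → List Γ'},
      TM2.stepAux (m l) none s = ⟨some l', none, s'⟩ →
      (flip bind (TM2.step m))^[1] (some ⟨some l, none, s⟩) = some ⟨some l', none, s'⟩ := by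
    intro l l' s s' h
    simp [flip, TM2.step, h]
  have add : ∀ {a b c : Option (TM2.Cfg (fun _ : Fin (B + 1) => Γ') Λ (Option Γ'))} {i j : ℕ},
      (flip bind (TM2.step m))^[i] a = b → (flip bind (TM2.step m))^[j] b = c →
      (flip bind (TM2.step m))^[i + j] a = c := by
    intro a b c i j h₁ h₂
    rw [Nat.add_comm i j, Function.iterate_add_apply, h₁, h₂]
  induction h generalizing x with
  | nop => exact ⟨1, le_rfl, one (by rw [hm]; simp [code])⟩
  | @inc L v k =>
    have hk : k < B := hB
    refine ⟨1, le_rfl, one ?_⟩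
    rw [hm, ← update_stk_reg hk, List.replicate_succ, ← stk_reg hk L v]
    simp [code]
  | @dec L v k =>
    have hk : k < B := hB
    refine ⟨1, le_rfl, one ?_⟩
    rw [hm, ← update_stk_reg hk, ← List.tail_replicate, ← stk_reg hk L v]
    simp [code]
  | @push L v c =>
    refine ⟨1, le_rfl, one ?_⟩
    rw [hm]
    simp [code, update_stk_zero]
  | @pop L v =>
    refine ⟨1, le_rfl, one ?_⟩
    rw [hm]
    simp [code, update_stk_zero]
  | @seq p q L v L₁ v₁ L₂ v₂ a b _ _ ih₁ ih₂ =>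
    obtain ⟨i, hi, h₁⟩ := ih₁ (le_of_max_le_left hB) (e (Sum.inr q.entry)) (fun l => e (Sum.inl l))
      fun l => hm (Sum.inl l)
    obtain ⟨j, hj, h₂⟩ := ih₂ (le_of_max_le_right hB) x (fun l => e (Sum.inr l))
      fun l => hm (Sum.inr l)
    exact ⟨i + j, add_le_add hi hj, add h₁ h₂⟩
  | @loop_done k p L v h0 =>
    have hk : k < B := le_of_max_le_left hB
    refine ⟨1, le_rfl, one ?_⟩
    rw [hm]
    simp [code, entry, test, stk_reg hk, h0]
  | @loop_step k p L v L₁ v₁ L₂ v₂ a b h0 _ _ ih₁ ih₂ =>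
    have hk : k < B := le_of_max_le_left hB
    -- The exit label of the body is the label `e none` of the test, so the remaining rounds are a
    -- run of the same loop.
    obtain ⟨i, hi, h₁⟩ := ih₁ (le_of_max_le_right hB) (e none) (fun l => e (some l))
      fun l => hm (some l)
    obtain ⟨j, hj, h₂⟩ := ih₂ hB x e hm
    refine ⟨1 + i + j, by omega, add (add (one ?_) h₁) h₂⟩
    rw [hm]
    obtain ⟨w, hw⟩ := Nat.exists_eq_succ_of_ne_zero h0
    simp [code, entry, test, stk_reg hk, hw, List.replicate_succ]
  | @loopTop_done f p L v h0 =>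
    refine ⟨1, le_rfl, one ?_⟩
    rw [hm]
    simp [code, entry, test, h0]
  | @loopTop_step f p L v L₁ v₁ L₂ v₂ a b h0 _ _ ih₁ ih₂ =>
    obtain ⟨i, hi, h₁⟩ := ih₁ hB (e none) (fun l => e (some l)) fun l => hm (some l)
    obtain ⟨j, hj, h₂⟩ := ih₂ hB x e hm
    refine ⟨1 + i + j, by omega, add (add (one ?_) h₁) h₂⟩
    rw [hm]
    simp [code, entry, test, h0]
  | @ite_true f p q L v L₁ v₁ a h0 _ ih =>
    obtain ⟨i, hi, h₁⟩ := ih (le_of_max_le_left hB) x (fun l => e (some (Sum.inl l)))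
      fun l => hm (some (Sum.inl l))
    refine ⟨1 + i, by omega, add (one ?_) h₁⟩
    rw [hm]
    simp [code, entry, test, h0]
  | @ite_false f p q L v L₁ v₁ a h0 _ ih =>
    obtain ⟨i, hi, h₁⟩ := ih (le_of_max_le_right hB) x (fun l => e (some (Sum.inr l)))
      fun l => hm (some (Sum.inr l))
    refine ⟨1 + i, by omega, add (one ?_) h₁⟩
    rw [hm]
    simp [code, entry, test, h0]
  | mono _ hle ih =>
    obtain ⟨i, hi, h₁⟩ := ih hB x e hm
    exact ⟨i, hi.trans hle, h₁⟩

/-- The machine that runs the program and then halts. -/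
def Prog.machine (p : Prog) : FinTM2 :=
  letI := p.fintypeLabel
  { K := Fin (p.bound + 1)
    k₀ := 0
    k₁ := 0
    Γ := fun _ => Γ'
    Λ := Option p.Label
    main := some p.entry
    ΛFin := inferInstance
    σ := Option Γ'
    initialState := none
    m := fun l => Option.casesOn l .halt (p.code p.bound none some) }

/-- The machine of a program, with input and output in the alphabet of bits and punctuation. -/
def Prog.computer (p : Prog) : TM2ComputableAux Γ' Γ' where
  tm := p.machine
  inputAlphabet := Equiv.refl Γ'
  outputAlphabet := Equiv.refl Γ'

/-- The registers are empty at both ends because initial and halting configurations have only one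
nonempty stack. The additional step executes the halt statement. -/
theorem Run.outputsInTime {p : Prog} {L L' n} (h : Run p L 0 L' 0 n) :
    Nonempty (TM2OutputsInTime p.computer.tm (L.map p.computer.inputAlphabet.symm)
      (some (L'.map p.computer.outputAlphabet.symm)) (n + 1)) := by
  obtain ⟨j, hj, hrun⟩ := h.simulate (B := p.bound) le_rfl
    (fun l : Option p.Label => Option.casesOn l .halt (p.code p.bound none some))
    none some fun _ => rfl
  have hstk : ∀ l : List Γ', Prog.stk p.bound l 0 =
      fun k : Fin (p.bound + 1) => if k = 0 then l else [] := by
    intro l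
    funext k
    refine Fin.cases ?_ (fun k => ?_) k <;> simp [Prog.stk]
  have hinit : ∀ l : List Γ', initList p.machine l =
      (⟨some (some p.entry), none, Prog.stk p.bound l 0⟩ :
        TM2.Cfg (fun _ : Fin (p.bound + 1) => Γ') (Option p.Label) (Option Γ')) := by
    intro l
    rw [hstk]
    rfl
  have hhalt : ∀ l : List Γ', haltList p.machine l =
      (⟨none, none, Prog.stk p.bound l 0⟩ :
        TM2.Cfg (fun _ : Fin (p.bound + 1) => Γ') (Option p.Label) (Option Γ')) := by
    intro l
    rw [hstk]
    rfl
  refine ⟨⟨⟨j + 1, ?_⟩, Nat.succ_le_succ hj⟩⟩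
  have e₁ : L.map p.computer.inputAlphabet.symm = L := List.map_id L
  have e₂ : L'.map p.computer.outputAlphabet.symm = L' := List.map_id L'
  rw [e₁, e₂]
  change (flip bind (TM2.step _))^[j + 1] (some (initList p.machine L)) =
    some (haltList p.machine L')
  rw [hinit, hhalt, Function.iterate_succ_apply']
  refine (congrArg _ hrun).trans ?_
  rfl

end EEKakeya

end

noncomputable section

namespace EEKakeya

open Computability Turing

/-! ### Arithmetic with registers -/

/-- The loop invariant rule: `L i` and `v i` are the state after `i` rounds and `c i` is the cost of
the next one. -/
theorem Run.loop_iterate {k : ℕ} {p : Prog} (n : ℕ) (L : ℕ → List Γ') (v : ℕ → ℕ → ℕ) (c : ℕ → ℕ)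
    (hpos : ∀ i < n, v i k ≠ 0) (hzero : v n k = 0)
    (hstep : ∀ i < n, Run p (L i) (v i) (L (i + 1)) (v (i + 1)) (c i)) :
    Run (.loop k p) (L 0) (v 0) (L n) (v n) (∑ i ∈ Finset.range n, (1 + c i) + 1) := by
  induction n generalizing L v c with
  | zero => exact (Run.loop_done hzero).mono (by simp)
  | succ n ih =>
    have h := ih (fun i => L (i + 1)) (fun i => v (i + 1)) (fun i => c (i + 1))
      (fun i hi => hpos (i + 1) (by omega)) hzero fun i hi => hstep (i + 1) (by omega)
    refine (Run.loop_step (hpos 0 (by omega)) (hstep 0 (by omega)) h).mono ?_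
    rw [Finset.sum_range_succ' _ n]
    omega

namespace Prog

/-- Adds the register `a` to the register `b` and clears `a`. -/
def move (a b : ℕ) : Prog := loop a (seq (dec a) (inc b))

/-- Adds the register `a` to the register `b`, with the help of the empty register `t`. -/
def copy (a b t : ℕ) : Prog :=
  seq (loop a (seq (dec a) (seq (inc b) (inc t)))) (move t a)

/-- Clears the register `a`. -/
def clear (a : ℕ) : Prog := loop a (dec a)

/-- Doubles the register `a`, with the help of the empty register `t`. -/
def double (a t : ℕ) : Prog :=
  seq (loop a (seq (dec a) (seq (inc t) (inc t)))) (move t a)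

end Prog

open Prog Function

theorem Run.of_eq {p : Prog} {L v L' v' n w m} (h : Run p L v L' v' n) (hw : v' = w) (hm : n ≤ m) :
    Run p L v L' w m := hw ▸ h.mono hm

theorem Run.move {a b : ℕ} (hab : a ≠ b) (L : List Γ') (v : ℕ → ℕ) :
    Run (.move a b) L v L (update (update v a 0) b (v b + v a)) (3 * v a + 1) := by
  have h := Run.loop_iterate (k := a) (p := .seq (.dec a) (.inc b)) (v a) (fun _ => L)
    (fun i => update (update v a (v a - i)) b (v b + i)) (fun _ => 2)
    (fun i hi => by simp [hab]; omega) (by simp [hab]) fun i _ => by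
      refine ((Run.dec a).seq (Run.inc b)).of_eq ?_ le_rfl
      funext k
      simp only [update_apply]
      split_ifs <;> omega
  have e : update (update v a (v a - 0)) b (v b + 0) = v := by simp
  simp only [e] at h
  refine h.of_eq (by simp) (by simp; omega)

theorem Run.clear (a : ℕ) (L : List Γ') (v : ℕ → ℕ) :
    Run (.clear a) L v L (update v a 0) (2 * v a + 1) := by
  have h := Run.loop_iterate (k := a) (p := .dec a) (v a) (fun _ => L)
    (fun i => update v a (v a - i)) (fun _ => 1)
    (fun i hi => by simp; omega) (by simp) fun i _ => by
      refine (Run.dec a).of_eq ?_ le_rfl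
      funext k
      simp only [update_apply]
      split_ifs <;> omega
  have e : update v a (v a - 0) = v := by simp
  simp only [e] at h
  refine h.of_eq (by simp) (by simp; omega)

theorem Run.copy {a b t : ℕ} (hab : a ≠ b) (hat : a ≠ t) (hbt : b ≠ t) (L : List Γ') (v : ℕ → ℕ)
    (ht : v t = 0) :
    Run (.copy a b t) L v L (update v b (v b + v a)) (7 * v a + 2) := by
  have h := Run.loop_iterate (k := a) (p := .seq (.dec a) (.seq (.inc b) (.inc t))) (v a) (fun _ => L)
    (fun i => update (update (update v a (v a - i)) b (v b + i)) t i) (fun _ => 3)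
    (fun i hi => by simp [hab, hat]; omega) (by simp [hab, hat]) fun i _ => by
      refine ((Run.dec a).seq ((Run.inc b).seq (Run.inc t))).of_eq ?_ le_rfl
      funext k
      simp only [update_apply]
      split_ifs <;> omega
  have e : update (update (update v a (v a - 0)) b (v b + 0)) t 0 = v := by
    funext k
    simp only [update_apply]
    split_ifs <;> simp_all
  simp only [e] at h
  refine (h.seq (Run.move hat.symm _ _)).of_eq ?_ ?_
  · funext k
    simp only [update_apply]
    split_ifs <;> simp_all
  · simp; omega

theorem Run.double {a t : ℕ} (hat : a ≠ t) (L : List Γ') (v : ℕ → ℕ) (ht : v t = 0) :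
    Run (.double a t) L v L (update v a (2 * v a)) (10 * v a + 2) := by
  have h := Run.loop_iterate (k := a) (p := .seq (.dec a) (.seq (.inc t) (.inc t))) (v a) (fun _ => L)
    (fun i => update (update v a (v a - i)) t (2 * i)) (fun _ => 3)
    (fun i hi => by simp [hat]; omega) (by simp [hat]) fun i _ => by
      refine ((Run.dec a).seq ((Run.inc t).seq (Run.inc t))).of_eq ?_ le_rfl
      funext k
      simp only [update_apply]
      split_ifs <;> omega
  have e : update (update v a (v a - 0)) t (2 * 0) = v := by
    funext k
    simp only [update_apply]
    split_ifs <;> simp_all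
  simp only [e] at h
  refine (h.seq (Run.move hat.symm _ _)).of_eq ?_ ?_
  · funext k
    simp only [update_apply]
    split_ifs <;> simp_all
  · simp; omega

/-! ### Expressions with bounded sums -/

/-- Arithmetic expressions with truncated subtraction and bounded sums. -/
inductive Expr
  | var (j : ℕ) : Expr
  | one : Expr
  | add (e f : Expr) : Expr
  | sub (e f : Expr) : Expr
  | sum (e f : Expr) : Expr

/-- The sequence `i, v 0, v 1, …`. -/
def cons (i : ℕ) (v : ℕ → ℕ) : ℕ → ℕ
  | 0 => i
  | j + 1 => v j

namespace Expr

/-- The value of an expression; `sum e f` is the sum of the values of `f` over all values of a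
new variable that are less than the value of `e`. -/
def eval : Expr → (ℕ → ℕ) → ℕ
  | var j, v => v j
  | one, _ => 1
  | add e f, v => e.eval v + f.eval v
  | sub e f, v => e.eval v - f.eval v
  | sum e f, v => ∑ i ∈ Finset.range (e.eval v), f.eval (cons i v)

/-- The number of steps that suffice to evaluate an expression. -/
def cost : Expr → (ℕ → ℕ) → ℕ
  | var j, v => 7 * v j + 2
  | one, _ => 1
  | add e f, v => e.cost v + (f.cost v + (3 * f.eval v + 1))
  | sub e f, v => e.cost v + (f.cost v + (3 * f.eval v + 1))
  | sum e f, v => e.cost v +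
      ((∑ i ∈ Finset.range (e.eval v),
        (1 + (f.cost (cons i v) + 3 * f.eval (cons i v) + 3)) + 1) +
      ((2 * e.eval v + 1) + (3 * ∑ i ∈ Finset.range (e.eval v), f.eval (cons i v) + 1)))

/-- The program that writes the value of an expression into the register `d`, if the variables are
in the registers `ρ j < d` and the registers from `d` on are empty. -/
def compile : Expr → (ℕ → ℕ) → ℕ → Prog
  | var j, ρ, d => .copy (ρ j) d (d + 1)
  | one, _, d => .inc d
  | add e f, ρ, d => .seq (e.compile ρ d) (.seq (f.compile ρ (d + 1)) (.move (d + 1) d))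
  | sub e f, ρ, d => .seq (e.compile ρ d) (.seq (f.compile ρ (d + 1))
      (.loop (d + 1) (.seq (.dec (d + 1)) (.dec d))))
  | sum e f, ρ, d => .seq (e.compile ρ d) (.seq
      (.loop d (.seq (.dec d) (.seq (f.compile (cons (d + 1) ρ) (d + 3))
        (.seq (.move (d + 3) (d + 2)) (.inc (d + 1))))))
      (.seq (.clear (d + 1)) (.move (d + 2) d)))

/-- Only the register `d` changes in the end, so a second subexpression can be evaluated in `d + 1`
with its variables intact and its scratch space clean. -/
theorem run (e : Expr) (ρ : ℕ → ℕ) (d : ℕ) (L : List Γ') (v : ℕ → ℕ) (hρ : ∀ j, ρ j < d)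
    (hv : ∀ k, d ≤ k → v k = 0) :
    Run (e.compile ρ d) L v L (update v d (e.eval fun j => v (ρ j))) (e.cost fun j => v (ρ j)) := by
  induction e generalizing ρ d v with
  | var j =>
    have := hρ j
    refine (Run.copy (by omega) (by omega) (by omega) L v (hv _ (by omega))).of_eq ?_ le_rfl
    rw [hv d le_rfl, zero_add]
    rfl
  | one =>
    refine (Run.inc d).of_eq ?_ le_rfl
    rw [hv d le_rfl]
    rfl
  | add e f ihe ihf =>
    have he := ihe ρ d v hρ hv
    have hf := ihf ρ (d + 1) (update v d (e.eval fun j => v (ρ j)))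
      (fun j => (hρ j).trans (Nat.lt_succ_self d)) fun k hk => by
        rw [update_of_ne (by omega), hv k (by omega)]
    have hcongr : (fun j => update v d (e.eval fun j => v (ρ j)) (ρ j)) = fun j => v (ρ j) := by
      funext j; rw [update_of_ne (hρ j).ne]
    rw [hcongr] at hf
    refine (he.seq (hf.seq (Run.move (Nat.succ_ne_self d) _ _))).of_eq ?_ ?_
    · funext k
      have := hv k
      simp only [update_apply, eval]
      split_ifs <;> omega
    · simp [cost]
  | sub e f ihe ihf =>
    have he := ihe ρ d v hρ hv
    have hf := ihf ρ (d + 1) (update v d (e.eval fun j => v (ρ j)))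
      (fun j => (hρ j).trans (Nat.lt_succ_self d)) fun k hk => by
        rw [update_of_ne (by omega), hv k (by omega)]
    have hcongr : (fun j => update v d (e.eval fun j => v (ρ j)) (ρ j)) = fun j => v (ρ j) := by
      funext j; rw [update_of_ne (hρ j).ne]
    rw [hcongr] at hf
    set x := e.eval fun j => v (ρ j)
    set y := f.eval fun j => v (ρ j)
    have h := Run.loop_iterate (k := d + 1) (p := .seq (.dec (d + 1)) (.dec d)) y (fun _ => L)
      (fun i => update (update v d (x - i)) (d + 1) (y - i)) (fun _ => 2)
      (fun i hi => by simp; omega) (by simp) fun i _ => by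
        refine ((Run.dec (d + 1)).seq (Run.dec d)).of_eq ?_ le_rfl
        funext k
        simp only [update_apply]
        split_ifs <;> omega
    refine (he.seq (hf.seq h)).of_eq ?_ ?_
    · funext k
      have := hv k
      simp only [update_apply, eval]
      split_ifs <;> omega
    · simp [cost, y]; omega
  | sum e f ihe ihf =>
    have he := ihe ρ d v hρ hv
    set w : ℕ → ℕ := fun j => v (ρ j) with hw
    set n := e.eval w with hn
    -- Register `d` holds the number of rounds left, `d + 1` the bound variable, `d + 2` the partial
    -- sum, and the summand is evaluated in `d + 3`.
    have hloop := Run.loop_iterate (k := d) (p := .seq (.dec d) (.seq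
        (f.compile (cons (d + 1) ρ) (d + 3)) (.seq (.move (d + 3) (d + 2)) (.inc (d + 1))))) n
      (fun _ => L)
      (fun i => update (update (update v d (n - i)) (d + 1) i) (d + 2)
        (∑ j ∈ Finset.range i, f.eval (cons j w)))
      (fun i => f.cost (cons i w) + 3 * f.eval (cons i w) + 3)
      (fun i hi => by simp; omega) (by simp) fun i hi => by
        set V : ℕ → ℕ := update (update (update v d (n - (i + 1))) (d + 1) i) (d + 2)
          (∑ j ∈ Finset.range i, f.eval (cons j w)) with hV
        have hf := ihf (cons (d + 1) ρ) (d + 3) V (by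
            rintro (_ | j)
            · simp [cons]
            · have := hρ j
              simp only [cons]
              omega) fun k hk => by
          simp only [hV, update_apply]
          rw [if_neg (by omega), if_neg (by omega), if_neg (by omega), hv k (by omega)]
        have hcongr : (fun j => V (cons (d + 1) ρ j)) = cons i w := by
          funext j
          rcases j with _ | j
          · simp [cons, hV]
          · have := hρ j
            simp only [cons, hV, update_apply]
            rw [if_neg (by omega), if_neg (by omega), if_neg (by omega)]
        rw [hcongr] at hf
        have hdec : Run (.dec d) L (update (update (update v d (n - i)) (d + 1) i) (d + 2)
            (∑ j ∈ Finset.range i, f.eval (cons j w))) L V 1 := by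
          refine (Run.dec d).of_eq ?_ le_rfl
          funext k
          simp only [hV, update_apply]
          split_ifs <;> omega
        refine (hdec.seq (hf.seq ((Run.move (by omega) _ _).seq (Run.inc _)))).of_eq ?_ ?_
        · funext k
          have := hv k
          rw [Finset.sum_range_succ]
          simp only [hV, update_apply]
          split_ifs <;> omega
        · simp; omega
    have e0 : update (update (update v d (n - 0)) (d + 1) 0) (d + 2)
        (∑ j ∈ Finset.range 0, f.eval (cons j w)) = update v d n := by
      funext k
      have := hv k
      simp only [update_apply, Finset.range_zero, Finset.sum_empty]
      split_ifs <;> omega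
    simp only [e0] at hloop
    refine (he.seq (hloop.seq ((Run.clear _ _ _).seq (Run.move (by omega) _ _)))).of_eq ?_ ?_
    · funext k
      have := hv k
      simp only [update_apply, eval, ← hn]
      split_ifs <;> omega
    · simp [cost, ← hn]

/-- Values and costs of a fixed expression are bounded by a power of the variables. -/
theorem eval_cost_le (e : Expr) : ∃ C : ℕ, ∀ (B : ℕ) (v : ℕ → ℕ), (∀ j, v j ≤ B) →
    e.eval v ≤ (B + 2) ^ C ∧ e.cost v ≤ (B + 2) ^ C := by
  have key : ∀ B : ℕ, ∀ {x m n : ℕ}, x ≤ (B + 2) ^ m → m ≤ n → x ≤ (B + 2) ^ n :=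
    fun B x m n h hmn => h.trans (Nat.pow_le_pow_right (by omega) hmn)
  have two : ∀ B m : ℕ, 2 ^ m ≤ (B + 2) ^ m := fun B m => Nat.pow_le_pow_left (by omega) m
  induction e with
  | var j =>
    refine ⟨4, fun B v hv => ?_⟩
    have := hv j
    simp only [eval, cost]
    constructor <;> nlinarith [Nat.zero_le (B * B), Nat.zero_le (B * B * B),
      Nat.zero_le (B * B * B * B)]
  | one => exact ⟨0, fun B v _ => by simp [eval, cost]⟩
  | add e f ihe ihf =>
    obtain ⟨a, ha⟩ := ihe
    obtain ⟨b, hb⟩ := ihf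
    refine ⟨max a b + 3, fun B v hv => ?_⟩
    have h₁ := key B (ha B v hv).1 (le_max_left a b)
    have h₂ := key B (ha B v hv).2 (le_max_left a b)
    have h₃ := key B (hb B v hv).1 (le_max_right a b)
    have h₄ := key B (hb B v hv).2 (le_max_right a b)
    have h₅ : 1 ≤ (B + 2) ^ max a b := Nat.one_le_pow _ _ (by omega)
    have h₆ := Nat.mul_le_mul_left ((B + 2) ^ max a b) (two B 3)
    rw [pow_add]
    simp only [eval, cost]
    omega
  | sub e f ihe ihf =>
    obtain ⟨a, ha⟩ := ihe
    obtain ⟨b, hb⟩ := ihf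
    refine ⟨max a b + 3, fun B v hv => ?_⟩
    have h₁ := key B (ha B v hv).1 (le_max_left a b)
    have h₂ := key B (ha B v hv).2 (le_max_left a b)
    have h₃ := key B (hb B v hv).1 (le_max_right a b)
    have h₄ := key B (hb B v hv).2 (le_max_right a b)
    have h₅ : 1 ≤ (B + 2) ^ max a b := Nat.one_le_pow _ _ (by omega)
    have h₆ := Nat.mul_le_mul_left ((B + 2) ^ max a b) (two B 3)
    rw [pow_add]
    simp only [eval, cost]
    omega
  | sum e f ihe ihf =>
    obtain ⟨a, ha⟩ := ihe
    obtain ⟨b, hb⟩ := ihf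
    -- There are at most `(B + 2) ^ a` rounds. In each, all variables including the bound one are at
    -- most `(B + 2) ^ (a + 1)`, so the summand is bounded by `((B + 2) ^ (a + 1) + 2) ^ b ≤ (B + 2)
    -- ^ ((a + 2) * b)`. The last five powers give a factor at least 32 for the constants.
    refine ⟨a + (a + 2) * b + 5, fun B v hv => ?_⟩
    have h₁ := (ha B v hv).1
    have h₂ := (ha B v hv).2
    have hB : B + 2 ≤ (B + 2) ^ (a + 1) := by
      simpa using Nat.pow_le_pow_right (n := B + 2) (by omega) (show 1 ≤ a + 1 by omega)
    have hstep : ∀ i ∈ Finset.range (e.eval v),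
        f.eval (cons i v) ≤ (B + 2) ^ ((a + 2) * b) ∧
        f.cost (cons i v) ≤ (B + 2) ^ ((a + 2) * b) := by
      intro i hi
      have hi := Finset.mem_range.1 hi
      have hle : (B + 2) ^ (a + 1) + 2 ≤ (B + 2) ^ (a + 2) := by
        have h3 : (B + 2) ^ (a + 2) = (B + 2) ^ (a + 1) * (B + 2) := pow_succ _ _
        nlinarith
      have hpow : ((B + 2) ^ (a + 1) + 2) ^ b ≤ (B + 2) ^ ((a + 2) * b) := by
        rw [pow_mul]
        exact Nat.pow_le_pow_left hle b
      have hc := hb ((B + 2) ^ (a + 1)) (cons i v) (by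
        rintro (_ | j)
        · exact hi.le.trans (key B h₁ (by omega))
        · have := hv j
          simp only [cons]
          omega)
      exact ⟨hc.1.trans hpow, hc.2.trans hpow⟩
    set D := (B + 2) ^ ((a + 2) * b)
    set A := (B + 2) ^ a
    have hD : 1 ≤ D := Nat.one_le_pow _ _ (by omega)
    have hA : 1 ≤ A := Nat.one_le_pow _ _ (by omega)
    have hS : ∑ i ∈ Finset.range (e.eval v), f.eval (cons i v) ≤ A * D := by
      refine (Finset.sum_le_card_nsmul _ _ D fun i hi => (hstep i hi).1).trans ?_
      rw [Finset.card_range, smul_eq_mul]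
      exact Nat.mul_le_mul_right _ h₁
    have hT : ∑ i ∈ Finset.range (e.eval v),
        (1 + (f.cost (cons i v) + 3 * f.eval (cons i v) + 3)) ≤ A * (8 * D) := by
      refine (Finset.sum_le_card_nsmul _ _ (8 * D) fun i hi => ?_).trans ?_
      · have := hstep i hi
        omega
      rw [Finset.card_range, smul_eq_mul]
      exact Nat.mul_le_mul_right _ h₁
    have hAD : A ≤ A * D := Nat.le_mul_of_pos_right _ hD
    have hpow : (B + 2) ^ (a + (a + 2) * b + 5) = A * D * (B + 2) ^ 5 := by
      rw [pow_add, pow_add]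
    have h32 := Nat.mul_le_mul_left (A * D) (two B 5)
    have h8 : A * (8 * D) = 8 * (A * D) := by ring
    rw [h8] at hT
    rw [hpow]
    simp only [eval, cost]
    constructor <;> omega

end Expr

end EEKakeya

end

noncomputable section

namespace EEKakeya

open Computability Turing Function

/-! ### Binary input and output -/

theorem Run.loopTop_iterate {f : Option Γ' → Bool} {p : Prog} (n : ℕ) (L : ℕ → List Γ')
    (v : ℕ → ℕ → ℕ) (c : ℕ → ℕ) (hpos : ∀ i < n, f (L i).head? = true)
    (hzero : f (L n).head? = false)
    (hstep : ∀ i < n, Run p (L i) (v i) (L (i + 1)) (v (i + 1)) (c i)) :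
    Run (.loopTop f p) (L 0) (v 0) (L n) (v n) (∑ i ∈ Finset.range n, (1 + c i) + 1) := by
  induction n generalizing L v c with
  | zero => exact (Run.loopTop_done hzero).mono (by simp)
  | succ n ih =>
    have h := ih (fun i => L (i + 1)) (fun i => v (i + 1)) (fun i => c (i + 1))
      (fun i hi => hpos (i + 1) (by omega)) hzero fun i hi => hstep (i + 1) (by omega)
    refine (Run.loopTop_step (hpos 0 (by omega)) (hstep 0 (by omega)) h).mono ?_
    rw [Finset.sum_range_succ' _ n]
    omega

/-- The number with the given binary digits, the least significant one first. -/
def bitsVal : List Bool → ℕ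
  | [] => 0
  | b :: l => b.toNat + 2 * bitsVal l

/-- The binary digits of the successor. -/
def bitsSucc : List Bool → List Bool
  | [] => [true]
  | false :: l => true :: l
  | true :: l => false :: bitsSucc l

/-- The weight of a digit is kept in unary while reading, so the reading time is proportional to `2
^ length`; the second part makes it linear in the number. -/
theorem bitsVal_encodePosNum (n : PosNum) :
    bitsVal (encodePosNum n) = n ∧ 2 ^ (encodePosNum n).length ≤ 2 * (n : ℕ) := by
  induction n with
  | one => simp [encodePosNum, bitsVal]
  | bit0 m ih =>
    simp only [encodePosNum, bitsVal, List.length_cons, PosNum.cast_bit0, pow_succ]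
    simp only [Bool.toNat_false]
    omega
  | bit1 m ih =>
    simp only [encodePosNum, bitsVal, List.length_cons, PosNum.cast_bit1, pow_succ]
    simp only [Bool.toNat_true]
    omega

theorem bitsVal_encodeNat (n : ℕ) :
    bitsVal (encodeNat n) = n ∧ 2 ^ (encodeNat n).length ≤ 2 * n + 1 := by
  have h : bitsVal (encodeNum (n : Num)) = ((n : Num) : ℕ) ∧
      2 ^ (encodeNum (n : Num)).length ≤ 2 * ((n : Num) : ℕ) + 1 := by
    generalize (n : Num) = m
    cases m with
    | zero => exact ⟨rfl, le_rfl⟩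
    | pos m =>
      have := bitsVal_encodePosNum m
      exact ⟨this.1, this.2.trans (Nat.le_succ _)⟩
  rwa [Num.to_of_nat] at h

theorem length_encodeNat_le (n : ℕ) : (encodeNat n).length ≤ 2 * n := by
  have h := (bitsVal_encodeNat n).2
  have := Nat.lt_two_pow_self (n := (encodeNat n).length)
  omega

theorem encodePosNum_succ (n : PosNum) : encodePosNum n.succ = bitsSucc (encodePosNum n) := by
  induction n with
  | one => rfl
  | bit0 m _ => rfl
  | bit1 m ih => simp [PosNum.succ, encodePosNum, bitsSucc, ih]

theorem encodeNat_succ (n : ℕ) : encodeNat (n + 1) = bitsSucc (encodeNat n) := by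
  unfold encodeNat
  have : ((n + 1 : ℕ) : Num) = (n : Num).succ := by
    rw [Nat.cast_succ, Num.add_one]
  rw [this]
  generalize (n : Num) = m
  cases m with
  | zero => rfl
  | pos m => exact encodePosNum_succ m

/-- The carry: the initial run of ones turns into zeros and the digit after it becomes one.
`incBinary` works in this way, with the length of the run in a register. -/
theorem exists_eq_replicate_append (l : List Bool) : ∃ (m : ℕ) (l' : List Bool),
    l = List.replicate m true ++ l' ∧ l'.head? ≠ some true ∧
      bitsSucc l = List.replicate m false ++ true :: l'.tail := by
  induction l with
  | nil => exact ⟨0, [], by simp [bitsSucc]⟩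
  | cons b l ih =>
    cases b with
    | false => exact ⟨0, false :: l, by simp [bitsSucc]⟩
    | true =>
      obtain ⟨m, l', h₁, h₂, h₃⟩ := ih
      exact ⟨m + 1, l', by rw [h₁, List.replicate_succ, List.cons_append], h₂,
        by rw [bitsSucc, h₃, List.replicate_succ, List.cons_append]⟩

/-- Whether the topmost symbol is a bit. -/
def topIsBit : Option Γ' → Bool
  | some (Γ'.bit _) => true
  | _ => false

namespace Prog

/-- Reads one binary digit, whose weight is in the register `w`, and adds it to the register `k`. -/
def readBit (k w t : ℕ) : Prog :=
  seq (ite (fun s => decide (s = some (Γ'.bit true))) (copy w k t) nop) (seq pop (double w t))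

/-- Reads a binary number and the punctuation that follows it into the empty register `k`. -/
def readNat (k w t : ℕ) : Prog :=
  seq (inc w) (seq (loopTop topIsBit (readBit k w t)) (seq (clear w) pop))

/-- Adds one to the binary number on the data stack. -/
def incBinary (t : ℕ) : Prog :=
  seq (loopTop (fun s => decide (s = some (Γ'.bit true))) (seq pop (inc t)))
    (seq (ite (fun s => decide (s = some (Γ'.bit false))) pop nop)
      (seq (push (Γ'.bit true)) (loop t (seq (dec t) (push (Γ'.bit false))))))

/-- Writes the register `k` in binary and clears it. -/
def writeNat (k t : ℕ) : Prog := loop k (seq (dec k) (incBinary t))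

/-- Puts the power of two whose exponent is in the register `a` into the empty register `b` and
clears `a`. -/
def powTwo (a b t : ℕ) : Prog := seq (inc b) (loop a (seq (dec a) (double b t)))

end Prog

/-- A digit of weight `w ≥ 1` costs at most `24 w` steps, the test of the loop included. The weights
double, so the costs form a geometric series. -/
theorem Run.readBits {k w t : ℕ} (hkw : k ≠ w) (hkt : k ≠ t) (hwt : w ≠ t) (l : List Bool)
    (rest : List Γ') (hrest : topIsBit rest.head? = false) (v : ℕ → ℕ) (ht : v t = 0)
    (hw : 1 ≤ v w) :
    Run (.loopTop topIsBit (.readBit k w t)) (l.map Γ'.bit ++ rest) v rest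
      (update (update v k (v k + v w * bitsVal l)) w (v w * 2 ^ l.length))
      (24 * (v w * (2 ^ l.length - 1)) + 1) := by
  induction l generalizing v with
  | nil =>
    refine (Run.loopTop_done (by simpa using hrest)).of_eq ?_ (by omega)
    simp [bitsVal]
  | cons b l ih =>
    set v₁ := update v k (v k + v w * b.toNat) with hv₁
    set v₂ := update v₁ w (2 * v₁ w) with hv₂
    have e1 : v₁ w = v w := by simp [hv₁, hkw.symm]
    have e2 : v₂ w = 2 * v w := by simp [hv₂, e1]
    have e3 : v₂ t = 0 := by simp [hv₂, hv₁, hwt.symm, hkt.symm, ht]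
    have e4 : v₂ k = v k + v w * b.toNat := by simp [hv₂, hkw, hv₁]
    have e5 : v₁ t = 0 := by simp [hv₁, hkt.symm, ht]
    have hadd : Run (.ite (fun s => decide (s = some (Γ'.bit true))) (.copy w k t) .nop)
        ((b :: l).map Γ'.bit ++ rest) v ((b :: l).map Γ'.bit ++ rest) v₁ (7 * v w + 3) := by
      cases b with
      | true =>
        refine (Run.ite_true (by simp) (Run.copy hkw.symm hwt hkt _ v ht)).of_eq ?_ (by omega)
        simp [hv₁]
      | false =>
        refine (Run.ite_false (by simp) Run.nop).of_eq ?_ (by omega)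
        simp [hv₁]
    have hbody : Run (.readBit k w t) ((b :: l).map Γ'.bit ++ rest) v (l.map Γ'.bit ++ rest) v₂
        (17 * v w + 6) := by
      refine (hadd.seq (Run.pop.seq (Run.double hwt _ _ e5))).of_eq rfl ?_
      rw [e1]
      omega
    refine (Run.loopTop_step (by simp [topIsBit]) hbody (ih v₂ e3 (by omega))).of_eq ?_ ?_
    · rw [e2, e4, hv₂, hv₁]
      funext j
      simp only [update_apply, bitsVal, List.length_cons, pow_succ]
      split_ifs <;> first | omega | ring_nf
    · rw [e2, List.length_cons, pow_succ]
      obtain ⟨x, hx⟩ := Nat.exists_eq_add_of_le (Nat.one_le_two_pow (n := l.length))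
      rw [hx, show (1 + x) * 2 - 1 = 2 * x + 1 by omega, show 1 + x - 1 = x by omega]
      nlinarith

theorem Run.readNat {k w t : ℕ} (hkw : k ≠ w) (hkt : k ≠ t) (hwt : w ≠ t) (n : ℕ)
    (rest : List Γ') (hrest : topIsBit rest.head? = false) (v : ℕ → ℕ) (hk : v k = 0)
    (hw : v w = 0) (ht : v t = 0) :
    Run (.readNat k w t) (encodingNatΓ'.encode n ++ rest) v rest.tail (update v k n)
      (54 * n + 31) := by
  obtain ⟨h₁, h₂⟩ := bitsVal_encodeNat n
  have hinc : Run (.inc w) (encodingNatΓ'.encode n ++ rest) v (encodingNatΓ'.encode n ++ rest)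
      (update v w 1) 1 := by
    refine (Run.inc w).of_eq ?_ le_rfl
    rw [hw]
  have hbits := Run.readBits hkw hkt hwt (encodeNat n) rest hrest (update v w 1)
    (by simp [hwt.symm, ht]) (by simp)
  refine (hinc.seq (hbits.seq ((Run.clear w _ _).seq Run.pop))).of_eq ?_ ?_
  · funext j
    simp only [update_apply, h₁]
    split_ifs <;> first | omega | simp_all
  · simp only [update_self]
    omega

theorem Run.incBinary (t : ℕ) (l : List Bool) (rest : List Γ') (hrest : topIsBit rest.head? = false)
    (v : ℕ → ℕ) (ht : v t = 0) :
    Run (.incBinary t) (l.map Γ'.bit ++ rest) v ((bitsSucc l).map Γ'.bit ++ rest) v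
      (6 * l.length + 6) := by
  obtain ⟨m, l', h₁, h₂, h₃⟩ := exists_eq_replicate_append l
  have hlen : m ≤ l.length := by rw [h₁]; simp
  have htop : ∀ b, rest.head? ≠ some (Γ'.bit b) := by
    intro b hb
    rw [hb] at hrest
    simp [topIsBit] at hrest
  have hA := Run.loopTop_iterate (f := fun s => decide (s = some (Γ'.bit true)))
    (p := .seq .pop (.inc t)) m
    (fun i => (List.replicate (m - i) true ++ l').map Γ'.bit ++ rest) (fun i => update v t i)
    (fun _ => 2)
    (fun i hi => by
      obtain ⟨j, hj⟩ := Nat.exists_eq_succ_of_ne_zero (show m - i ≠ 0 by omega)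
      rw [hj]
      simp [List.replicate_succ])
    (by
      rcases l' with _ | ⟨b, l'⟩
      · simpa using htop true
      · simpa using h₂)
    (fun i hi => by
      have hj : m - i = (m - (i + 1)) + 1 := by omega
      rw [hj, List.replicate_succ]
      refine (Run.pop.seq (Run.inc t)).of_eq ?_ le_rfl
      simp)
  have hB : Run (.ite (fun s => decide (s = some (Γ'.bit false))) .pop .nop)
      (l'.map Γ'.bit ++ rest) (update v t m) (l'.tail.map Γ'.bit ++ rest) (update v t m) 2 := by
    rcases l' with _ | ⟨b, l'⟩
    · exact Run.ite_false (by simpa using htop false) Run.nop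
    · have hb : b = false := by simpa using h₂
      subst hb
      exact Run.ite_true (by simp) Run.pop
  have hC := Run.loop_iterate (k := t) (p := .seq (.dec t) (.push (Γ'.bit false))) m
    (fun i => (List.replicate i false ++ true :: l'.tail).map Γ'.bit ++ rest)
    (fun i => update v t (m - i)) (fun _ => 2) (fun i hi => by simp; omega) (by simp)
    (fun i hi => by
      rw [List.replicate_succ]
      refine ((Run.dec t).seq (Run.push (Γ'.bit false))).of_eq ?_ le_rfl
      funext j
      simp only [update_apply]
      split_ifs <;> omega)
  have e0 : update v t 0 = v := by rw [← ht, update_eq_self]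
  simp only [Nat.sub_zero, Nat.sub_self, List.replicate_zero, List.nil_append, e0] at hA hC
  rw [← h₁] at hA
  rw [← h₃] at hC
  refine (hA.seq (hB.seq ((Run.push (Γ'.bit true)).seq hC))).mono ?_
  simp
  omega

/-- The register is counted down while a binary counter on the data stack is incremented, starting
from the empty digit string of `0`. -/
theorem Run.writeNat {k t : ℕ} (hkt : k ≠ t) (rest : List Γ') (hrest : topIsBit rest.head? = false)
    (v : ℕ → ℕ) (ht : v t = 0) :
    Run (.writeNat k t) rest v (encodingNatΓ'.encode (v k) ++ rest) (update v k 0)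
      (v k * (12 * v k + 8) + 1) := by
  have h := Run.loop_iterate (k := k) (p := .seq (.dec k) (.incBinary t)) (v k)
    (fun i => (encodeNat i).map Γ'.bit ++ rest) (fun i => update v k (v k - i))
    (fun i => 1 + (6 * (encodeNat i).length + 6))
    (fun i hi => by simp; omega) (by simp) (fun i hi => by
      have hdec : Run (.dec k) ((encodeNat i).map Γ'.bit ++ rest) (update v k (v k - i))
          ((encodeNat i).map Γ'.bit ++ rest) (update v k (v k - (i + 1))) 1 := by
        refine (Run.dec k).of_eq ?_ le_rfl
        funext j
        simp only [update_apply]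
        split_ifs <;> omega
      rw [encodeNat_succ]
      exact hdec.seq (Run.incBinary t _ rest hrest _ (by simp [hkt.symm, ht])))
  simp only [Nat.sub_zero, update_eq_self, Nat.sub_self] at h
  refine h.mono ?_
  gcongr
  refine (Finset.sum_le_card_nsmul _ _ (12 * v k + 8) fun i hi => ?_).trans ?_
  · have := Finset.mem_range.1 hi
    have := length_encodeNat_le i
    omega
  · simp

theorem Run.powTwo {a b t : ℕ} (hab : a ≠ b) (hat : a ≠ t) (hbt : b ≠ t) (L : List Γ') (v : ℕ → ℕ)
    (hb : v b = 0) (ht : v t = 0) :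
    Run (.powTwo a b t) L v L (update (update v a 0) b (2 ^ v a)) (14 * 2 ^ v a + 2) := by
  have hinc : Run (.inc b) L v L (update v b 1) 1 := (Run.inc b).of_eq (by rw [hb]) le_rfl
  have h := Run.loop_iterate (k := a) (p := .seq (.dec a) (.double b t)) (v a) (fun _ => L)
    (fun i => update (update v a (v a - i)) b (2 ^ i)) (fun i => 1 + (10 * 2 ^ i + 2))
    (fun i hi => by simp [hab]; omega) (by simp [hab]) fun i _ => by
      refine ((Run.dec a).seq (Run.double hbt _ _ ?_)).of_eq ?_ ?_
      · simp [hat.symm, hbt.symm, ht]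
      · funext k
        simp only [update_apply, pow_succ]
        split_ifs <;> omega
      · simp [hab.symm]
  simp only [Nat.sub_zero, update_eq_self, pow_zero, Nat.sub_self] at h
  refine (hinc.seq h).mono ?_
  have hsum : ∀ n : ℕ, ∑ i ∈ Finset.range n, (1 + (1 + (10 * 2 ^ i + 2))) + 14 ≤ 14 * 2 ^ n := by
    intro n
    induction n with
    | zero => simp
    | succ n ih =>
      rw [Finset.sum_range_succ, pow_succ]
      have : 1 ≤ 2 ^ n := Nat.one_le_two_pow
      omega
  have := hsum (v a)
  omega

end EEKakeya

end

noncomputable section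

namespace EEKakeya

open Computability Turing Function

/-! ### Double exponential time from expressions -/

/-- The sequence `r, u, v, t, M, M, …`. -/
def inputSeq (r u v t M : ℕ) (j : ℕ) : ℕ :=
  match j with
  | 0 => r
  | 1 => u
  | 2 => v
  | 3 => t
  | _ => M

/-- The registers with the first seven values given and the others empty. -/
def registers (r u v t M a b : ℕ) (j : ℕ) : ℕ :=
  match j with
  | 0 => r
  | 1 => u
  | 2 => v
  | 3 => t
  | 4 => M
  | 5 => a
  | 6 => b
  | _ => 0

theorem registers_eq_zero (r u v t M a b : ℕ) {k : ℕ} (hk : 7 ≤ k) :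
    registers r u v t M a b k = 0 := by
  obtain ⟨k, rfl⟩ := Nat.exists_eq_add_of_le' hk
  rfl

/-- Compilation needs every variable in a register below the scratch space. Reading the variable `j`
from `min j 4` achieves this, and makes all variables from 4 on equal to `M`. -/
theorem registers_min (r u v t M a b : ℕ) :
    (fun j => registers r u v t M a b (min j 4)) = inputSeq r u v t M := by
  funext j
  match j with
  | 0 => rfl
  | 1 => rfl
  | 2 => rfl
  | 3 => rfl
  | j + 4 => rw [show min (j + 4) 4 = 4 by omega]; rfl

theorem eq_registers {w : ℕ → ℕ} {r u v t M a b : ℕ} (h0 : w 0 = r) (h1 : w 1 = u) (h2 : w 2 = v)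
    (h3 : w 3 = t) (h4 : w 4 = M) (h5 : w 5 = a) (h6 : w 6 = b) (h7 : ∀ k, 7 ≤ k → w k = 0) :
    w = registers r u v t M a b := by
  funext k
  match k with
  | 0 => exact h0
  | 1 => exact h1
  | 2 => exact h2
  | 3 => exact h3
  | 4 => exact h4
  | 5 => exact h5
  | 6 => exact h6
  | k + 7 => exact h7 (k + 7) (by omega)

/-- Reads `r, u, v, t`, computes `M = 2 ^ 2 ^ A` and writes the fraction `P / Q`, where `A`, `P`, `Q`
are the values of the given expressions at `r, u, v, t, M`. -/
def mainProg (eA eP eQ : Expr) : Prog :=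
  .seq (.readNat 0 5 6) <| .seq (.readNat 1 5 6) <| .seq (.readNat 2 5 6) <|
  .seq (.readNat 3 5 6) <| .seq (eA.compile (min · 4) 5) <| .seq (.powTwo 5 6 7) <|
  .seq (.powTwo 6 4 7) <| .seq (eP.compile (min · 4) 5) <| .seq (eQ.compile (min · 4) 6) <|
  .seq (.clear 0) <| .seq (.clear 1) <| .seq (.clear 2) <| .seq (.clear 3) <| .seq (.clear 4) <|
  .seq (.writeNat 6 7) <| .seq (.push Γ'.comma) <| .seq (.writeNat 5 7) (.push (Γ'.bit false))

/-- `eA` is evaluated while the register of `M` is still empty, hence the `0` in its input. The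
output is stacked back to front: denominator, comma, numerator, and finally the sign bit of a
nonnegative number. -/
theorem run_mainProg (eA eP eQ : Expr) {r u v t A P Q M : ℕ} (hA : eA.eval (inputSeq r u v t 0) = A)
    (hM : M = 2 ^ 2 ^ A) (hP : eP.eval (inputSeq r u v t M) = P)
    (hQ : eQ.eval (inputSeq r u v t M) = Q) :
    Run (mainProg eA eP eQ) (encodeInput r u v t) 0 (encodeFraction P Q) 0
      ((54 * r + 31) + ((54 * u + 31) + ((54 * v + 31) + ((54 * t + 31) +
        (eA.cost (inputSeq r u v t 0) + ((14 * 2 ^ A + 2) + ((14 * M + 2) +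
        (eP.cost (inputSeq r u v t M) + (eQ.cost (inputSeq r u v t M) +
        ((2 * r + 1) + ((2 * u + 1) + ((2 * v + 1) + ((2 * t + 1) + ((2 * M + 1) +
        ((Q * (12 * Q + 8) + 1) + (1 + ((P * (12 * P + 8) + 1) + 1))))))))))))))))) := by
  have tail : ∀ {w : ℕ → ℕ} {a x : ℕ}, a < 7 → (∀ k, 7 ≤ k → w k = 0) →
      ∀ k, 7 ≤ k → update w a x k = 0 := by
    intro w a x ha hw k hk
    rw [update_of_ne (by omega), hw k hk]
  have hreg : ∀ {r u v t M a b : ℕ}, ∀ k, 7 ≤ k → registers r u v t M a b k = 0 :=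
    fun k hk => registers_eq_zero _ _ _ _ _ _ _ hk
  have hfree : ∀ {r u v t M a : ℕ} {k : ℕ}, 6 ≤ k → registers r u v t M a 0 k = 0 := by
    intro r u v t M a k hk
    rcases Nat.lt_or_ge k 7 with h | h
    · interval_cases k; rfl
    · exact registers_eq_zero _ _ _ _ _ _ _ h
  have hfree' : ∀ {r u v t M : ℕ} {k : ℕ}, 5 ≤ k → registers r u v t M 0 0 k = 0 := by
    intro r u v t M k hk
    rcases Nat.lt_or_ge k 6 with h | h
    · interval_cases k; rfl
    · exact hfree h
  have s0 : registers 0 0 0 0 0 0 0 = 0 :=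
    (eq_registers rfl rfl rfl rfl rfl rfl rfl fun _ _ => rfl).symm
  have i1 : Run (.readNat 0 5 6) (encodeInput r u v t) (registers 0 0 0 0 0 0 0) _
      (registers r 0 0 0 0 0 0) _ :=
    (Run.readNat (by omega) (by omega) (by omega) r (Γ'.comma :: _) rfl _ rfl rfl rfl).of_eq
      (eq_registers rfl rfl rfl rfl rfl rfl rfl (tail (by omega) hreg)) le_rfl
  have i2 : Run (.readNat 1 5 6) (encodingNatΓ'.encode u ++ Γ'.comma :: (encodingNatΓ'.encode v ++
      Γ'.comma :: encodingNatΓ'.encode t)) (registers r 0 0 0 0 0 0) _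
      (registers r u 0 0 0 0 0) _ :=
    (Run.readNat (by omega) (by omega) (by omega) u (Γ'.comma :: _) rfl _ rfl rfl rfl).of_eq
      (eq_registers rfl rfl rfl rfl rfl rfl rfl (tail (by omega) hreg)) le_rfl
  have i3 : Run (.readNat 2 5 6) (encodingNatΓ'.encode v ++ Γ'.comma :: encodingNatΓ'.encode t)
      (registers r u 0 0 0 0 0) _ (registers r u v 0 0 0 0) _ :=
    (Run.readNat (by omega) (by omega) (by omega) v (Γ'.comma :: _) rfl _ rfl rfl rfl).of_eq
      (eq_registers rfl rfl rfl rfl rfl rfl rfl (tail (by omega) hreg)) le_rfl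
  -- No punctuation follows the last number; removing the top of the empty stack does nothing.
  have i4 : Run (.readNat 3 5 6) (encodingNatΓ'.encode t ++ []) (registers r u v 0 0 0 0) []
      (registers r u v t 0 0 0) _ :=
    (Run.readNat (by omega) (by omega) (by omega) t [] rfl _ rfl rfl rfl).of_eq
      (eq_registers rfl rfl rfl rfl rfl rfl rfl (tail (by omega) hreg)) le_rfl
  rw [List.append_nil] at i4
  have c1 := eA.run (min · 4) 5 [] (registers r u v t 0 0 0) (by intro j; omega) fun k => hfree'
  rw [registers_min, hA] at c1
  have c1' := c1.of_eq (w := registers r u v t 0 A 0)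
    (eq_registers rfl rfl rfl rfl rfl rfl rfl (tail (by omega) hreg)) le_rfl
  have c2 : Run (.powTwo 5 6 7) [] (registers r u v t 0 A 0) [] (registers r u v t 0 0 (2 ^ A)) _ :=
    (Run.powTwo (by omega) (by omega) (by omega) [] _ rfl rfl).of_eq
      (eq_registers rfl rfl rfl rfl rfl rfl rfl (tail (by omega) (tail (by omega) hreg))) le_rfl
  have c3 : Run (.powTwo 6 4 7) [] (registers r u v t 0 0 (2 ^ A)) [] (registers r u v t M 0 0)
      (14 * M + 2) :=
    (Run.powTwo (by omega) (by omega) (by omega) [] _ rfl rfl).of_eq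
      (eq_registers rfl rfl rfl rfl hM.symm rfl rfl (tail (by omega) (tail (by omega) hreg)))
      (by rw [hM]; rfl)
  have c4 := eP.run (min · 4) 5 [] (registers r u v t M 0 0) (by intro j; omega) fun k => hfree'
  rw [registers_min, hP] at c4
  have c4' := c4.of_eq (w := registers r u v t M P 0)
    (eq_registers rfl rfl rfl rfl rfl rfl rfl (tail (by omega) hreg)) le_rfl
  have c5 := eQ.run (min · 4) 6 [] (registers r u v t M P 0) (by intro j; omega) fun k => hfree
  rw [registers_min, hQ] at c5
  have c5' := c5.of_eq (w := registers r u v t M P Q)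
    (eq_registers rfl rfl rfl rfl rfl rfl rfl (tail (by omega) hreg)) le_rfl
  have d0 : Run (.clear 0) [] (registers r u v t M P Q) [] (registers 0 u v t M P Q) _ :=
    (Run.clear 0 [] _).of_eq
      (eq_registers rfl rfl rfl rfl rfl rfl rfl (tail (by omega) hreg)) le_rfl
  have d1 : Run (.clear 1) [] (registers 0 u v t M P Q) [] (registers 0 0 v t M P Q) _ :=
    (Run.clear 1 [] _).of_eq
      (eq_registers rfl rfl rfl rfl rfl rfl rfl (tail (by omega) hreg)) le_rfl
  have d2 : Run (.clear 2) [] (registers 0 0 v t M P Q) [] (registers 0 0 0 t M P Q) _ :=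
    (Run.clear 2 [] _).of_eq
      (eq_registers rfl rfl rfl rfl rfl rfl rfl (tail (by omega) hreg)) le_rfl
  have d3 : Run (.clear 3) [] (registers 0 0 0 t M P Q) [] (registers 0 0 0 0 M P Q) _ :=
    (Run.clear 3 [] _).of_eq
      (eq_registers rfl rfl rfl rfl rfl rfl rfl (tail (by omega) hreg)) le_rfl
  have d4 : Run (.clear 4) [] (registers 0 0 0 0 M P Q) [] (registers 0 0 0 0 0 P Q) _ :=
    (Run.clear 4 [] _).of_eq
      (eq_registers rfl rfl rfl rfl rfl rfl rfl (tail (by omega) hreg)) le_rfl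
  have o1 : Run (.writeNat 6 7) [] (registers 0 0 0 0 0 P Q) (encodingNatΓ'.encode Q ++ [])
      (registers 0 0 0 0 0 P 0) _ :=
    (Run.writeNat (by omega) [] rfl _ rfl).of_eq
      (eq_registers rfl rfl rfl rfl rfl rfl rfl (tail (by omega) hreg)) le_rfl
  have o2 : Run (.writeNat 5 7) (Γ'.comma :: (encodingNatΓ'.encode Q ++ []))
      (registers 0 0 0 0 0 P 0) (encodingNatΓ'.encode P ++ Γ'.comma ::
      (encodingNatΓ'.encode Q ++ [])) (registers 0 0 0 0 0 0 0) _ :=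
    (Run.writeNat (by omega) _ rfl _ rfl).of_eq
      (eq_registers rfl rfl rfl rfl rfl rfl rfl (tail (by omega) hreg)) le_rfl
  have hout : encodeFraction P Q = Γ'.bit false ::
      (encodingNatΓ'.encode P ++ Γ'.comma :: (encodingNatΓ'.encode Q ++ [])) := by
    simp [encodeFraction]
  rw [hout, ← s0]
  exact i1.seq <| i2.seq <| i3.seq <| i4.seq <| c1'.seq <| c2.seq <| c3.seq <| c4'.seq <|
    c5'.seq <| d0.seq <| d1.seq <| d2.seq <| d3.seq <| d4.seq <| o1.seq <| (Run.push _).seq <|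
    o2.seq <| Run.push _

/-- All quantities are at most `X = (M + 2) ^ C` and writing is quadratic, so the total is below
`1024 X ^ 2 ≤ (M + 2) ^ (2 C + 10)`. Since `M + 2 ≤ M ^ 2`, this power of `M` only adds `2 (2 C +
10)` to the upper exponent `A`. -/
theorem time_le (a r t A M C r' u v t' cA cP cQ P Q X : ℕ) (hA : A = a * (r + t) + a)
    (hM : M = 2 ^ 2 ^ A) (hX : X = (M + 2) ^ C) (hMA : 2 ^ A ≤ X) (hMX : M ≤ X) (hr : r' ≤ X)
    (hu : u ≤ X) (hv : v ≤ X) (ht : t' ≤ X) (hcA : cA ≤ X) (hcP : cP ≤ X) (hcQ : cQ ≤ X)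
    (hP : P ≤ X) (hQ : Q ≤ X) :
    ((54 * r' + 31) + ((54 * u + 31) + ((54 * v + 31) + ((54 * t' + 31) +
        (cA + ((14 * 2 ^ A + 2) + ((14 * M + 2) + (cP + (cQ +
        ((2 * r' + 1) + ((2 * u + 1) + ((2 * v + 1) + ((2 * t' + 1) + ((2 * M + 1) +
        ((Q * (12 * Q + 8) + 1) + (1 + ((P * (12 * P + 8) + 1) + 1))))))))))))))))) <
      2 ^ 2 ^ ((a + 2 * (2 * C + 10)) * (r + t) + (a + 2 * (2 * C + 10))) := by
  have hX1 : 1 ≤ X := by rw [hX]; exact Nat.one_le_pow _ _ (by omega)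
  have b7 : P * (12 * P + 8) ≤ X * (20 * X) := Nat.mul_le_mul hP (by omega)
  have b8 : Q * (12 * Q + 8) ≤ X * (20 * X) := Nat.mul_le_mul hQ (by omega)
  have b9 : X ≤ X * X := Nat.le_mul_of_pos_left _ hX1
  have b10 : X * (20 * X) = 20 * (X * X) := by ring
  have hpow : 1024 * (X * X) ≤ (M + 2) ^ (2 * C + 10) := by
    rw [pow_add, two_mul, pow_add, ← hX, mul_comm]
    exact Nat.mul_le_mul_left _ (by
      calc 1024 = 2 ^ 10 := by norm_num
        _ ≤ (M + 2) ^ 10 := Nat.pow_le_pow_left (by omega) _)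
  have htime : (M + 2) ^ (2 * C + 10) ≤ 2 ^ 2 ^ ((a + 2 * (2 * C + 10)) * (r + t) +
      (a + 2 * (2 * C + 10))) := by
    have hM2 : M + 2 ≤ M ^ 2 := by
      have : 2 ≤ M := by
        rw [hM]
        calc 2 = 2 ^ 1 := by norm_num
          _ ≤ 2 ^ 2 ^ A := Nat.pow_le_pow_right (by omega) Nat.one_le_two_pow
      nlinarith
    calc (M + 2) ^ (2 * C + 10) ≤ (M ^ 2) ^ (2 * C + 10) := Nat.pow_le_pow_left hM2 _
      _ = 2 ^ (2 ^ A * (2 * (2 * C + 10))) := by rw [hM, ← pow_mul, ← pow_mul]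
      _ ≤ 2 ^ (2 ^ A * 2 ^ (2 * (2 * C + 10))) :=
        Nat.pow_le_pow_right (by omega) (Nat.mul_le_mul_left _ Nat.lt_two_pow_self.le)
      _ = 2 ^ 2 ^ (A + 2 * (2 * C + 10)) := by rw [pow_add 2 A]
      _ ≤ _ := by
        refine Nat.pow_le_pow_right (by omega) (Nat.pow_le_pow_right (by omega) ?_)
        rw [hA, add_mul]
        omega
  refine lt_of_lt_of_le ?_ (hpow.trans htime)
  clear hpow htime hX hM hA
  generalize X * X = Y at *
  generalize 2 ^ A = Z at *
  generalize P * (12 * P + 8) = P' at *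
  generalize Q * (12 * Q + 8) = Q' at *
  omega

/-- If numerator and denominator are given by expressions in `r, u, v, t` and a number that is
double exponential in `r + t`, then the fraction is computable in double exponential time. -/
theorem computableInDoubleExpTime_of_expr {dhat : ℕ → ℕ → ℕ → ℕ → ℚ} (a : ℕ) (eA eP eQ : Expr)
    (ha : 1 ≤ a) (hA : ∀ r u v t, eA.eval (inputSeq r u v t 0) = a * (r + t) + a)
    (hPQ : ∀ r u v t, u < 2 ^ r → v < 2 ^ r →
      0 < eQ.eval (inputSeq r u v t (2 ^ 2 ^ (a * (r + t) + a))) ∧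
      dhat r u v t = (eP.eval (inputSeq r u v t (2 ^ 2 ^ (a * (r + t) + a))) : ℚ) /
        (eQ.eval (inputSeq r u v t (2 ^ 2 ^ (a * (r + t) + a))) : ℚ)) :
    ComputableInDoubleExpTime dhat := by
  obtain ⟨cA, hcA⟩ := eA.eval_cost_le
  obtain ⟨cP, hcP⟩ := eP.eval_cost_le
  obtain ⟨cQ, hcQ⟩ := eQ.eval_cost_le
  refine ⟨(mainProg eA eP eQ).computer, fun k => inferInstanceAs (Finite Γ'), ?_⟩
  set C := cA + cP + cQ + 1 with hC
  refine ⟨a + 2 * (2 * C + 10), fun r u v t hu hv => ?_⟩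
  set A := a * (r + t) + a with hAdef
  set M := 2 ^ 2 ^ A with hM
  have hrt : r + t < A := by nlinarith
  have h2A : A < 2 ^ A := Nat.lt_two_pow_self
  have hMA : 2 ^ A < M := Nat.lt_two_pow_self
  have hrM : 2 ^ r ≤ M := Nat.pow_le_pow_right (by omega) (by omega)
  have hbound : ∀ j, inputSeq r u v t M j ≤ M := by
    intro j
    match j with
    | 0 => simp only [inputSeq]; omega
    | 1 => simp only [inputSeq]; omega
    | 2 => simp only [inputSeq]; omega
    | 3 => simp only [inputSeq]; omega
    | j + 4 => exact le_rfl
  have hbound0 : ∀ j, inputSeq r u v t 0 j ≤ M := by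
    intro j
    match j with
    | 0 => simp only [inputSeq]; omega
    | 1 => simp only [inputSeq]; omega
    | 2 => simp only [inputSeq]; omega
    | 3 => simp only [inputSeq]; omega
    | j + 4 => exact Nat.zero_le _
  obtain ⟨hQpos, hd⟩ := hPQ r u v t hu hv
  set P := eP.eval (inputSeq r u v t M) with hP
  set Q := eQ.eval (inputSeq r u v t M) with hQ
  refine ⟨P, Q, hQpos, by rw [hd]; simp, ?_⟩
  have hrun := run_mainProg eA eP eQ (hA r u v t) hM hP.symm hQ.symm
  have key : ∀ {x m : ℕ}, x ≤ (M + 2) ^ m → m ≤ C → x ≤ (M + 2) ^ C :=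
    fun h hm => h.trans (Nat.pow_le_pow_right (by omega) hm)
  have hMX : M + 2 ≤ (M + 2) ^ C := key (m := 1) (by simp) (by omega)
  have hin : ∀ {x}, x ≤ M → x ≤ (M + 2) ^ C := fun h => by omega
  have htime := time_le a r t A M C r u v t _ _ _ P Q _ hAdef hM rfl (hin hMA.le) (hin le_rfl)
    (hin (hbound 0)) (hin (hbound 1)) (hin (hbound 2)) (hin (hbound 3))
    (key (hcA M _ hbound0).2 (by omega)) (key (hcP M _ hbound).2 (by omega))
    (key (hcQ M _ hbound).2 (by omega)) (key (hcP M _ hbound).1 (by omega))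
    (key (hcQ M _ hbound).1 (by omega))
  -- The strict inequality leaves room for the halting step.
  have hfin := (hrun.mono (Nat.le_sub_one_of_lt htime)).outputsInTime
  rwa [Nat.sub_add_cancel Nat.one_le_two_pow] at hfin

end EEKakeya

end

noncomputable section

namespace EEKakeya

/-! ### Functions given by expressions -/

namespace Expr

/-- Extends a renaming of variables under a binder. -/
def lift (ρ : ℕ → ℕ) : ℕ → ℕ
  | 0 => 0
  | j + 1 => ρ j + 1

/-- Renames the variables of an expression. -/
def rename : Expr → (ℕ → ℕ) → Expr
  | var j, ρ => var (ρ j)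
  | one, _ => one
  | add e f, ρ => add (e.rename ρ) (f.rename ρ)
  | sub e f, ρ => sub (e.rename ρ) (f.rename ρ)
  | sum e f, ρ => sum (e.rename ρ) (f.rename (lift ρ))

theorem eval_rename (e : Expr) (ρ v : ℕ → ℕ) :
    (e.rename ρ).eval v = e.eval fun j => v (ρ j) := by
  induction e generalizing ρ v with
  | var j => rfl
  | one => rfl
  | add e f ihe ihf => simp [rename, eval, ihe, ihf]
  | sub e f ihe ihf => simp [rename, eval, ihe, ihf]
  | sum e f ihe ihf =>
    simp only [rename, eval, ihe, ihf]
    refine Finset.sum_congr rfl fun i _ => ?_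
    congr 1
    funext j
    cases j <;> rfl

end Expr

/-- `f` is given by an expression in the variables `X`. -/
def Gen {α : Type} (X : α → ℕ → ℕ) (f : α → ℕ) : Prop :=
  ∃ e : Expr, ∀ a, e.eval (X a) = f a

/-- The variables `X` and a new variable, whose values are less than `n`. -/
def ext {α : Type} (X : α → ℕ → ℕ) (n : α → ℕ) (p : (a : α) × Fin (n a)) : ℕ → ℕ :=
  cons p.2 (X p.1)

open Classical in
/-- The truth value of `P` is given by an expression in the variables `X`. -/
def GenP {α : Type} (X : α → ℕ → ℕ) (P : α → Prop) : Prop :=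
  Gen X fun a => if P a then 1 else 0

/-- The integer `f` is given by a difference of expressions in the variables `X`. -/
def GenZ {α : Type} (X : α → ℕ → ℕ) (f : α → ℤ) : Prop :=
  ∃ p q : α → ℕ, Gen X p ∧ Gen X q ∧ ∀ a, f a = p a - q a

/-- The number `f` is given by a fraction of expressions in the variables `X`. -/
def GenR {α : Type} (X : α → ℕ → ℕ) (f : α → ℝ) : Prop :=
  ∃ (z : α → ℤ) (d : α → ℕ), GenZ X z ∧ Gen X d ∧ ∀ a, 0 < d a ∧ f a = z a / d a

section

variable {α : Type} {X : α → ℕ → ℕ}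

namespace Gen

variable {f g n : α → ℕ}

theorem of_eq (hf : Gen X f) (h : ∀ a, f a = g a) : Gen X g := by
  obtain ⟨e, he⟩ := hf
  exact ⟨e, fun a => (he a).trans (h a)⟩

theorem var (j : ℕ) : Gen X fun a => X a j := ⟨.var j, fun _ => rfl⟩

theorem add (hf : Gen X f) (hg : Gen X g) : Gen X fun a => f a + g a := by
  obtain ⟨e, he⟩ := hf
  obtain ⟨e', he'⟩ := hg
  exact ⟨.add e e', fun a => by simp [Expr.eval, he, he']⟩

theorem sub (hf : Gen X f) (hg : Gen X g) : Gen X fun a => f a - g a := by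
  obtain ⟨e, he⟩ := hf
  obtain ⟨e', he'⟩ := hg
  exact ⟨.sub e e', fun a => by simp [Expr.eval, he, he']⟩

theorem const (c : ℕ) : Gen X fun _ => c := by
  induction c with
  | zero => exact ⟨.sub .one .one, fun _ => rfl⟩
  | succ c ih => exact ih.add ⟨.one, fun _ => rfl⟩

/-- The summand has to be given only for indices below the bound, since the index is adjoined as an
element of `Fin (n a)`. Side conditions such as `2 ^ f ≤ M` can thus use that bound. -/
theorem sum {F : α → ℕ → ℕ} (hn : Gen X n)
    (hF : Gen (ext X n) fun p : (a : α) × Fin (n a) => F p.1 p.2) :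
    Gen X fun a => ∑ i ∈ Finset.range (n a), F a i := by
  obtain ⟨e, he⟩ := hn
  obtain ⟨e', he'⟩ := hF
  refine ⟨.sum e e', fun a => ?_⟩
  simp only [Expr.eval, he]
  exact Finset.sum_congr rfl fun i hi => he' ⟨a, ⟨i, Finset.mem_range.1 hi⟩⟩

theorem weaken (hf : Gen X f) (n : α → ℕ) :
    Gen (ext X n) fun p : (a : α) × Fin (n a) => f p.1 := by
  obtain ⟨e, he⟩ := hf
  refine ⟨e.rename Nat.succ, fun p => ?_⟩
  rw [Expr.eval_rename]
  exact he p.1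

theorem bound (n : α → ℕ) : Gen (ext X n) fun p : (a : α) × Fin (n a) => (p.2 : ℕ) :=
  ⟨.var 0, fun _ => rfl⟩

theorem mul (hf : Gen X f) (hg : Gen X g) : Gen X fun a => f a * g a :=
  (hf.sum (F := fun a _ => g a) (hg.weaken f)).of_eq fun a => by simp

theorem toP {P : α → Prop} (hf : Gen X f) (h₁ : ∀ a, P a → f a = 1) (h₀ : ∀ a, ¬ P a → f a = 0) :
    GenP X P := by
  refine hf.of_eq fun a => ?_
  by_cases h : P a
  · rw [if_pos h, h₁ a h]
  · rw [if_neg h, h₀ a h]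

theorem le (hf : Gen X f) (hg : Gen X g) : GenP X fun a => f a ≤ g a :=
  ((const 1).sub (hf.sub hg)).toP (fun a h => by omega) fun a h => by omega

end Gen

namespace GenP

variable {P Q : α → Prop}

theorem of_iff (hP : GenP X P) (h : ∀ a, P a ↔ Q a) : GenP X Q :=
  Gen.toP hP (fun a ha => if_pos ((h a).2 ha)) fun a ha => if_neg fun h' => ha ((h a).1 h')

theorem not (hP : GenP X P) : GenP X fun a => ¬ P a :=
  ((Gen.const 1).sub hP).toP (fun a h => by simp [h]) fun a h => by simp [not_not.1 h]

theorem and (hP : GenP X P) (hQ : GenP X Q) : GenP X fun a => P a ∧ Q a :=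
  (Gen.mul hP hQ).toP (fun a h => by simp [h.1, h.2]) fun a h => by
    by_cases h' : P a
    · have : ¬ Q a := fun hq => h ⟨h', hq⟩
      simp [this]
    · simp [h']

theorem or (hP : GenP X P) (hQ : GenP X Q) : GenP X fun a => P a ∨ Q a :=
  (hP.not.and hQ.not).not.of_iff fun a => by tauto

theorem exists_lt {n : α → ℕ} {P : α → ℕ → Prop} (hn : Gen X n)
    (hP : GenP (ext X n) fun p : (a : α) × Fin (n a) => P p.1 p.2) :
    GenP X fun a => ∃ i < n a, P a i := by
  classical
  have h : Gen X fun a => ∑ i ∈ Finset.range (n a), if P a i then 1 else 0 :=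
    hn.sum (F := fun a i => if P a i then 1 else 0) (hP.of_eq fun p => by congr)
  refine ((Gen.const 1).le h).of_iff fun a => ?_
  rw [Nat.one_le_iff_ne_zero, Ne, Finset.sum_eq_zero_iff]
  push Not
  simp

theorem count {n : α → ℕ} {P : α → ℕ → Prop} [∀ a i, Decidable (P a i)] (hn : Gen X n)
    (hP : GenP (ext X n) fun p : (a : α) × Fin (n a) => P p.1 p.2) :
    Gen X fun a => ∑ i ∈ Finset.range (n a), if P a i then 1 else 0 :=
  hn.sum (F := fun a i => if P a i then 1 else 0) (hP.of_eq fun p => by congr)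

end GenP

theorem sum_ite_lt {x y : ℕ} (h : y ≤ x) :
    (∑ i ∈ Finset.range x, if i < y then 1 else 0) = y := by
  have e : (Finset.range x).filter (· < y) = Finset.range y := by
    ext i
    simp only [Finset.mem_filter, Finset.mem_range]
    omega
  rw [Finset.sum_boole, e]
  simp

/-- Powers of two are the positive numbers without an odd divisor greater than 1. This needs only
products and bounded quantifiers, and it is the way to exponentiation. -/
theorem eq_two_pow_iff (z : ℕ) : (∃ k, z = 2 ^ k) ↔ 1 ≤ z ∧ ¬ ∃ i < z, ∃ j < z, z = (2 * i + 3) * j := by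
  constructor
  · rintro ⟨k, rfl⟩
    refine ⟨Nat.one_le_two_pow, ?_⟩
    rintro ⟨i, -, j, -, h⟩
    have hdvd : 2 * i + 3 ∣ 2 ^ k := ⟨j, h⟩
    obtain ⟨m, -, hm⟩ := (Nat.dvd_prime_pow Nat.prime_two).1 hdvd
    cases m with
    | zero => omega
    | succ m => rw [pow_succ] at hm; omega
  · rintro ⟨h1, h⟩
    rcases Nat.eq_two_pow_or_exists_odd_prime_and_dvd z with ⟨k, hk⟩ | ⟨p, hp, ⟨j, hj⟩, i, hi⟩
    · exact ⟨k, hk⟩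
    · exfalso
      have hp2 := hp.two_le
      have hj0 : 0 < j := Nat.pos_of_ne_zero fun h0 => by subst h0; omega
      refine h ⟨i - 1, ?_, j, ?_, ?_⟩
      · have : p * 1 ≤ p * j := Nat.mul_le_mul_left p hj0
        omega
      · nlinarith
      · rw [hj, hi]
        congr 1
        omega

theorem sum_ite_two_pow (i : ℕ) [∀ y : ℕ, Decidable (∃ k, y + 1 = 2 ^ k)] :
    (∑ y ∈ Finset.range i, if ∃ k, y + 1 = 2 ^ k then 1 else 0) = Nat.size i := by
  rw [Finset.sum_boole, Nat.cast_id, ← Finset.card_range (Nat.size i)]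
  refine (Finset.card_bij (fun k _ => 2 ^ k - 1) ?_ ?_ ?_).symm
  · intro k hk
    have h1 : 1 ≤ 2 ^ k := Nat.one_le_two_pow
    have h2 := Nat.lt_size.1 (Finset.mem_range.1 hk)
    rw [Finset.mem_filter, Finset.mem_range]
    exact ⟨by omega, k, by omega⟩
  · intro k _ l _ h
    have h1 : 1 ≤ 2 ^ k := Nat.one_le_two_pow
    have h2 : 1 ≤ 2 ^ l := Nat.one_le_two_pow
    exact Nat.pow_right_injective le_rfl (show 2 ^ k = 2 ^ l by omega)
  · intro y hy
    rw [Finset.mem_filter, Finset.mem_range] at hy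
    obtain ⟨hy, k, hk⟩ := hy
    exact ⟨k, Finset.mem_range.2 (Nat.lt_size.2 (by omega)), by omega⟩

/-! ### Division, binary size and powers of two by counting. -/

namespace Gen

variable {f g n : α → ℕ}

theorem lt (hf : Gen X f) (hg : Gen X g) : GenP X fun a => f a < g a :=
  (hg.le hf).not.of_iff fun _ => not_le

theorem eq (hf : Gen X f) (hg : Gen X g) : GenP X fun a => f a = g a :=
  ((hf.le hg).and (hg.le hf)).of_iff fun _ => le_antisymm_iff.symm

/-- The quotient is the number of positive multiples of `g` that do not exceed `f`. -/
theorem div (hf : Gen X f) (hg : Gen X g) (hpos : ∀ a, 0 < g a) : Gen X fun a => f a / g a := by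
  have h := GenP.count (P := fun a i => (i + 1) * g a ≤ f a) hf
    ((((Gen.bound f).add (const 1)).mul (hg.weaken f)).le (hf.weaken f))
  refine h.of_eq fun a => ?_
  rw [← sum_ite_lt (Nat.div_le_self (f a) (g a))]
  refine Finset.sum_congr rfl fun i _ => ?_
  simp only [← Nat.le_div_iff_mul_le (hpos a), Nat.succ_le_iff]

theorem mod (hf : Gen X f) (hg : Gen X g) (hpos : ∀ a, 0 < g a) : Gen X fun a => f a % g a :=
  (hf.sub (hg.mul (hf.div hg hpos))).of_eq fun a => by
    have := Nat.div_add_mod (f a) (g a)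
    omega

/-- The size of a number, that is the number of its binary digits. -/
theorem size (hf : Gen X f) : Gen X fun a => Nat.size (f a) := by
  classical
  have h := GenP.count (P := fun _ i => ∃ k, i + 1 = 2 ^ k) hf (GenP.of_iff
    (P := fun p : (a : α) × Fin (f a) => 1 ≤ (p.2 : ℕ) + 1 ∧
      ¬ ∃ i < (p.2 : ℕ) + 1, ∃ j < (p.2 : ℕ) + 1, (p.2 : ℕ) + 1 = (2 * i + 3) * j) ?_
    fun p => (eq_two_pow_iff _).symm)
  · exact h.of_eq fun a => sum_ite_two_pow _
  · have hb : Gen (ext X f) fun p : (a : α) × Fin (f a) => (p.2 : ℕ) + 1 :=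
      (Gen.bound f).add (const 1)
    refine ((const 1).le hb).and (GenP.not (GenP.exists_lt hb ?_))
    refine GenP.exists_lt (hb.weaken _) (((hb.weaken _).weaken _).eq ?_)
    exact (((const 2).mul ((Gen.bound _).weaken _)).add (const 3)).mul (Gen.bound _)

/-- Powers of two that do not exceed another function. -/
theorem two_pow {M : α → ℕ} (hf : Gen X f) (hM : Gen X M) (h : ∀ a, 2 ^ f a ≤ M a) :
    Gen X fun a => 2 ^ f a := by
  -- The numbers of size at most `f` are those below `2 ^ f`, and all of them occur in the range of
  -- length `M`.
  have h' := GenP.count (P := fun a i => Nat.size i ≤ f a) hM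
    ((Gen.bound M).size.le (hf.weaken M))
  refine h'.of_eq fun a => ?_
  simp only [Nat.size_le]
  exact sum_ite_lt (h a)

theorem toZ (hf : Gen X f) : GenZ X fun a => (f a : ℤ) :=
  ⟨f, fun _ => 0, hf, const 0, fun a => by simp⟩

end Gen

namespace GenZ

variable {f g : α → ℤ}

theorem add (hf : GenZ X f) (hg : GenZ X g) : GenZ X fun a => f a + g a := by
  obtain ⟨p, q, hp, hq, hf⟩ := hf
  obtain ⟨p', q', hp', hq', hg⟩ := hg
  exact ⟨_, _, hp.add hp', hq.add hq', fun a => by simp only [hf, hg]; push_cast; ring⟩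

theorem sub (hf : GenZ X f) (hg : GenZ X g) : GenZ X fun a => f a - g a := by
  obtain ⟨p, q, hp, hq, hf⟩ := hf
  obtain ⟨p', q', hp', hq', hg⟩ := hg
  exact ⟨_, _, hp.add hq', hq.add hp', fun a => by simp only [hf, hg]; push_cast; ring⟩

theorem mul (hf : GenZ X f) (hg : GenZ X g) : GenZ X fun a => f a * g a := by
  obtain ⟨p, q, hp, hq, hf⟩ := hf
  obtain ⟨p', q', hp', hq', hg⟩ := hg
  exact ⟨_, _, (hp.mul hp').add (hq.mul hq'), (hp.mul hq').add (hq.mul hp'),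
    fun a => by simp only [hf, hg]; push_cast; ring⟩

theorem sum {n : α → ℕ} {F : α → ℕ → ℤ} (hn : Gen X n)
    (hF : GenZ (ext X n) fun p : (a : α) × Fin (n a) => F p.1 p.2) :
    GenZ X fun a => ∑ i ∈ Finset.range (n a), F a i := by
  obtain ⟨p, q, ⟨e, he⟩, ⟨e', he'⟩, hF⟩ := hF
  obtain ⟨e₀, he₀⟩ := hn
  refine ⟨_, _, ⟨.sum e₀ e, fun a => rfl⟩, ⟨.sum e₀ e', fun a => rfl⟩, fun a => ?_⟩
  simp only [Expr.eval, he₀]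
  push_cast
  rw [← Finset.sum_sub_distrib]
  refine Finset.sum_congr rfl fun i hi => ?_
  have h := hF ⟨a, ⟨i, Finset.mem_range.1 hi⟩⟩
  rw [← he, ← he'] at h
  exact h

theorem nonneg (hf : GenZ X f) : GenP X fun a => 0 ≤ f a := by
  obtain ⟨p, q, hp, hq, hf⟩ := hf
  exact (hq.le hp).of_iff fun a => by rw [hf]; omega

/-- The quotient by a positive function. -/
theorem div {d : α → ℕ} (hf : GenZ X f) (hd : Gen X d) (hpos : ∀ a, 0 < d a) :
    GenR X fun a => (f a : ℝ) / (d a : ℝ) := ⟨f, d, hf, hd, fun a => ⟨hpos a, rfl⟩⟩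

end GenZ

theorem Gen.toR {f : α → ℕ} (hf : Gen X f) : GenR X fun a => (f a : ℝ) :=
  ⟨fun a => f a, fun _ => 1, hf.toZ, Gen.const 1, fun a => ⟨one_pos, by simp⟩⟩

namespace GenR

variable {f g : α → ℝ}

theorem of_eq (hf : GenR X f) (h : ∀ a, f a = g a) : GenR X g := by
  obtain ⟨z, d, hz, hd, hf⟩ := hf
  exact ⟨z, d, hz, hd, fun a => ⟨(hf a).1, (h a).symm.trans (hf a).2⟩⟩

theorem add (hf : GenR X f) (hg : GenR X g) : GenR X fun a => f a + g a := by
  obtain ⟨z, d, hz, hd, hf⟩ := hf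
  obtain ⟨z', d', hz', hd', hg⟩ := hg
  refine ⟨_, _, (hz.mul hd'.toZ).add (hz'.mul hd.toZ), hd.mul hd',
    fun a => ⟨Nat.mul_pos (hf a).1 (hg a).1, ?_⟩⟩
  have h₁ : (d a : ℝ) ≠ 0 := Nat.cast_ne_zero.2 (hf a).1.ne'
  have h₂ : (d' a : ℝ) ≠ 0 := Nat.cast_ne_zero.2 (hg a).1.ne'
  simp only [(hf a).2, (hg a).2]
  push_cast
  field_simp

theorem sub (hf : GenR X f) (hg : GenR X g) : GenR X fun a => f a - g a := by
  obtain ⟨z, d, hz, hd, hf⟩ := hf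
  obtain ⟨z', d', hz', hd', hg⟩ := hg
  refine ⟨_, _, (hz.mul hd'.toZ).sub (hz'.mul hd.toZ), hd.mul hd',
    fun a => ⟨Nat.mul_pos (hf a).1 (hg a).1, ?_⟩⟩
  have h₁ : (d a : ℝ) ≠ 0 := Nat.cast_ne_zero.2 (hf a).1.ne'
  have h₂ : (d' a : ℝ) ≠ 0 := Nat.cast_ne_zero.2 (hg a).1.ne'
  simp only [(hf a).2, (hg a).2]
  push_cast
  field_simp

theorem mul (hf : GenR X f) (hg : GenR X g) : GenR X fun a => f a * g a := by
  obtain ⟨z, d, hz, hd, hf⟩ := hf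
  obtain ⟨z', d', hz', hd', hg⟩ := hg
  refine ⟨_, _, hz.mul hz', hd.mul hd', fun a => ⟨Nat.mul_pos (hf a).1 (hg a).1, ?_⟩⟩
  simp only [(hf a).2, (hg a).2]
  push_cast
  rw [div_mul_div_comm]

theorem neg (hf : GenR X f) : GenR X fun a => - f a :=
  (((Gen.const 0).toR).sub hf).of_eq fun a => by simp

/-- The quotient by a positive function. -/
theorem div_nat {d : α → ℕ} (hf : GenR X f) (hd : Gen X d) (hpos : ∀ a, 0 < d a) :
    GenR X fun a => f a / (d a : ℝ) :=
  (hf.mul ((Gen.const 1).toZ.div hd hpos)).of_eq fun a => by push_cast; ring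

theorem le (hf : GenR X f) (hg : GenR X g) : GenP X fun a => f a ≤ g a := by
  obtain ⟨z, d, hz, hd, hfg⟩ := hg.sub hf
  refine hz.nonneg.of_iff fun a => ?_
  have h₁ : (0 : ℝ) < d a := Nat.cast_pos.2 (hfg a).1
  have h₂ : g a - f a = z a / d a := (hfg a).2
  rw [← sub_nonneg (a := g a), h₂, le_div_iff₀ h₁, zero_mul]
  exact Int.cast_nonneg_iff.symm

theorem abs_le (hf : GenR X f) (hg : GenR X g) : GenP X fun a => |f a| ≤ g a :=
  ((hg.neg.le hf).and (hf.le hg)).of_iff fun _ => _root_.abs_le.symm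

end GenR

end

end EEKakeya

end

noncomputable section

namespace EEKakeya

/-! ### The blocks of the sequence -/

/-- The index at which the block `l` starts. -/
def blockStart (l : ℕ) : ℕ := ∑ m ∈ Finset.range l, 2 ^ m * (2 * m + 1)

theorem blockStart_succ (l : ℕ) : blockStart (l + 1) = blockStart l + 2 ^ l * (2 * l + 1) :=
  Finset.sum_range_succ _ _

theorem blockStart_mono : Monotone blockStart :=
  monotone_nat_of_le_succ fun l => by rw [blockStart_succ]; exact Nat.le_add_right _ _

theorem le_blockStart (l : ℕ) : l ≤ blockStart l := by
  induction l with
  | zero => exact Nat.zero_le _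
  | succ l ih =>
    rw [blockStart_succ]
    have : 1 ≤ 2 ^ l * (2 * l + 1) := Nat.mul_pos Nat.one_le_two_pow (by omega)
    omega

theorem blockStart_le (l : ℕ) : blockStart l ≤ 2 ^ l * (2 * l) := by
  induction l with
  | zero => simp [blockStart]
  | succ l ih =>
    rw [blockStart_succ, pow_succ]
    nlinarith [Nat.one_le_two_pow (n := l)]

/-- The strips of block `l` have heights of order `2 ^ (-l - N)` with `N < blockStart (l + 1)`;
squares of side `2 ^ (-2 ^ (5 l))` are finer than that, with room for the rounding errors. -/
theorem blockStart_add_lt (l : ℕ) (hl : 4 ≤ l) : blockStart (l + 1) + 2 * l + 10 ≤ 2 ^ (5 * l) := by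
  have h := blockStart_le (l + 1)
  have h₁ : l < 2 ^ l := Nat.lt_two_pow_self
  have h₂ : 16 ≤ 2 ^ l := by
    calc 16 = 2 ^ 4 := by norm_num
      _ ≤ 2 ^ l := Nat.pow_le_pow_right (by omega) hl
  rw [mul_comm 5 l, pow_mul]
  rw [pow_succ] at h
  generalize 2 ^ l = x at *
  have h₃ : x * 2 * (2 * (l + 1)) ≤ 4 * (x * x) := by nlinarith
  have h₄ : 16 * x ≤ x * x := Nat.mul_le_mul_right x h₂
  have h₅ : 4096 * (x * x) ≤ x ^ 5 := by
    have : 16 ^ 3 ≤ x ^ 3 := Nat.pow_le_pow_left h₂ 3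
    calc 4096 * (x * x) ≤ x ^ 3 * (x * x) := Nat.mul_le_mul_right _ (by omega)
      _ = x ^ 5 := by ring
  omega

theorem blockStart_add_blockIndex (m : ℕ) :
    blockStart (blockIndex m).1 + (blockIndex m).2 = m := by
  induction m with
  | zero => simp [blockIndex, blockStart]
  | succ m ih =>
    have hlt := blockIndex_lt m
    simp only [blockIndex]
    split_ifs with h
    · simp only
      omega
    · simp only [blockStart_succ]
      omega

theorem succ_le_blockIndex_iff (m j : ℕ) : blockStart (j + 1) ≤ m ↔ j < (blockIndex m).1 := by
  have h := blockStart_add_blockIndex m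
  constructor
  · intro hj
    by_contra hlt
    have h₁ := blockStart_mono (show (blockIndex m).1 + 1 ≤ j + 1 by omega)
    rw [blockStart_succ] at h₁
    have := blockIndex_lt m
    omega
  · intro hj
    have := blockStart_mono hj
    simp only [Nat.succ_eq_add_one] at this
    omega

theorem blockIndex_blockStart_add {l i : ℕ} (hi : i < 2 ^ l * (2 * l + 1)) :
    blockIndex (blockStart l + i) = (l, i) := by
  have h := blockStart_add_blockIndex (blockStart l + i)
  have h₁ : (blockIndex (blockStart l + i)).1 ≤ l := by
    by_contra hlt
    have := (succ_le_blockIndex_iff (blockStart l + i) l).2 (by omega)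
    rw [blockStart_succ] at this
    omega
  have h₂ : l ≤ (blockIndex (blockStart l + i)).1 := by
    rcases l with _ | l
    · exact Nat.zero_le _
    · exact (succ_le_blockIndex_iff _ l).1 (Nat.le_add_right _ _)
  have h₃ := le_antisymm h₁ h₂
  rw [h₃] at h
  exact Prod.ext h₃ (by simp only; omega)

theorem blockIndex_fst_le (m : ℕ) : (blockIndex m).1 ≤ m := by
  have := blockStart_add_blockIndex m
  have := le_blockStart (blockIndex m).1
  omega

/-- Turns the recursively defined block index into a bounded count, which an expression can
evaluate. -/
theorem blockIndex_fst_eq_sum (m : ℕ) :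
    (∑ j ∈ Finset.range m, if blockStart (j + 1) ≤ m then 1 else 0) = (blockIndex m).1 := by
  simp only [succ_le_blockIndex_iff]
  exact sum_ite_lt (blockIndex_fst_le m)

/-- This includes the passage between blocks: block `l` ends at `(-1) ^ l (l + 1 - 2 ^ (-l))` and
the next one starts at `(-1) ^ l (l + 1)`. The alternating sign serves this purpose. -/
theorem xseq_sub_succ (m : ℕ) :
    xseq m - xseq (m + 1) = -(-1) ^ (blockIndex m).1 / 2 ^ (blockIndex m).1 := by
  have hlt := blockIndex_lt m
  unfold xseq
  simp only [blockIndex]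
  generalize blockIndex m = p at hlt ⊢
  obtain ⟨l, i⟩ := p
  simp only at hlt ⊢
  split_ifs with h
  · push_cast
    ring
  · have hi : i + 1 = 2 ^ l * (2 * l + 1) := by omega
    have hi' : (i : ℝ) = 2 ^ l * (2 * l + 1) - 1 := by
      have : ((i + 1 : ℕ) : ℝ) = ((2 ^ l * (2 * l + 1) : ℕ) : ℝ) := by rw [hi]
      push_cast at this
      linarith
    rw [hi']
    push_cast
    field_simp
    ring

theorem abs_xseq_sub_succ_le {l m : ℕ} (h : blockStart l ≤ m) :
    |xseq m - xseq (m + 1)| ≤ 1 / 2 ^ l := by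
  have hl : l ≤ (blockIndex m).1 := by
    rcases l with _ | l
    · exact Nat.zero_le _
    · exact (succ_le_blockIndex_iff m l).1 h
  rw [xseq_sub_succ, abs_div, abs_neg, abs_pow, abs_neg, abs_one, one_pow,
    abs_of_pos (by positivity)]
  gcongr
  norm_num

/-- The intercept of the line with slope `k / 2 ^ N`. -/
def gridIntercept (N k : ℕ) : ℝ :=
  ∑ m ∈ Finset.range N, (xseq m - xseq (m + 1)) * (((k % 2 ^ (N - 1 - m) : ℕ) : ℝ) / 2 ^ N)

/-- Only blocks up to `l` occur, so `2 ^ l * 2 ^ N` is a common denominator; the sign `-(-1) ^ b` is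
written as `2 (b % 2) - 1`. -/
theorem gridIntercept_eq_div {l N : ℕ} (hN : N ≤ blockStart (l + 1)) (k : ℕ) :
    gridIntercept N k = ((∑ m ∈ Finset.range N, (2 * ((blockIndex m).1 % 2 : ℕ) - 1) *
      ((2 ^ (l - (blockIndex m).1) : ℕ) : ℤ) * ((k % 2 ^ (N - 1 - m) : ℕ) : ℤ) : ℤ) : ℝ) /
      ((2 ^ l * 2 ^ N : ℕ) : ℝ) := by
  rw [gridIntercept]
  push_cast
  rw [Finset.sum_div]
  refine Finset.sum_congr rfl fun m hm => ?_
  have hm := Finset.mem_range.1 hm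
  have hl : (blockIndex m).1 ≤ l := by
    by_contra h
    have := (succ_le_blockIndex_iff m l).2 (by omega)
    omega
  rw [xseq_sub_succ]
  generalize (blockIndex m).1 = b at hl ⊢
  obtain ⟨j, rfl⟩ := Nat.exists_eq_add_of_le hl
  have hsign : (-(-1) ^ b : ℝ) = 2 * ((b : ℤ) % 2 : ℤ) - 1 := by
    rcases Nat.even_or_odd b with hb | hb
    · rw [hb.neg_one_pow, Int.emod_eq_zero_of_dvd (by exact_mod_cast hb.two_dvd)]
      norm_num
    · have : ((b : ℤ) % 2) = 1 := by exact_mod_cast Nat.odd_iff.1 hb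
      rw [hb.neg_one_pow, this]
      norm_num
  have hmod : (((k : ℤ) % 2 ^ (N - 1 - m) : ℤ) : ℝ) = ((k % 2 ^ (N - 1 - m) : ℕ) : ℝ) := by
    norm_cast
  rw [hsign, Nat.add_sub_cancel_left, pow_add, hmod]
  field_simp

/-! ### The covering squares -/

/-- The point `p`, in coordinates with the first axis in the direction `(c, s)`, lies in a strip
about the line with slope `k / 2 ^ N`, at a first coordinate close to `i / 2 ^ l - l`. -/
def Strip (N l i k : ℕ) (η ε c s : ℝ) (p : ℝ × ℝ) : Prop :=
  |c * p.1 + s * p.2 - (i / 2 ^ l - l)| ≤ η ∧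
    |(c * p.2 - s * p.1) - k / 2 ^ N * (c * p.1 + s * p.2) - gridIntercept N k| ≤ ε

/-- The index of the block that is used for the `n`-th cover. -/
def level (n : ℕ) : ℕ := 4 * n + 4

/-- The squares of the `n`-th cover have sides of length `2 ^ (-depth n)`. -/
def depth (n : ℕ) : ℕ := 2 ^ (5 * level n)

/-- The point `2 ^ (-depth n) (U, V)`, translated by an integer vector that is given by `i', j'` and
rotated by a multiple of `π / 4`, lies in the strip with the indices `i, k`; here `2 ^ (-depth n) c`
approximates `cos (π / 4)`. -/
def NearAt (n U V i k i' j' c : ℕ) : Prop :=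
  (2 * (c * c) ≤ 2 ^ depth n * 2 ^ depth n ∧ 2 ^ depth n * 2 ^ depth n < 2 * ((c + 1) * (c + 1))) ∧
    ∃ a : ℝ × ℝ, (a = (1, 0) ∨ a = ((c : ℝ) / (2 ^ depth n : ℕ), (c : ℝ) / (2 ^ depth n : ℕ)) ∨
      a = (0, 1) ∨ a = (-((c : ℝ) / (2 ^ depth n : ℕ)), (c : ℝ) / (2 ^ depth n : ℕ))) ∧
    Strip (blockStart (level n) + i) (level n) i k ((2 : ℕ) / (2 ^ level n : ℕ))
      ((3 : ℕ) / (2 ^ level n * 2 ^ (blockStart (level n) + i) : ℕ)) a.1 a.2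
      ((U : ℝ) / (2 ^ depth n : ℕ) + i' - (2 * level n + 4 : ℕ),
        (V : ℝ) / (2 ^ depth n : ℕ) + j' - (2 * level n + 4 : ℕ))

/-- The square with the lower left corner `2 ^ (-depth n) (U, V)` belongs to the `n`-th cover. -/
def Near (n U V : ℕ) : Prop :=
  ∃ i < 2 ^ level n * (2 * level n + 1), ∃ k < 2 ^ (blockStart (level n) + i) + 1,
    ∃ i' < 4 * level n + 9, ∃ j' < 4 * level n + 9, ∃ c < 2 ^ depth n + 1,
      NearAt n U V i k i' j' c

section

variable {α : Type} {X : α → ℕ → ℕ}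

theorem Gen.blockStart {l M : α → ℕ} (hl : Gen X l) (hM : Gen X M) (h : ∀ a, 2 ^ l a ≤ M a) :
    Gen X fun a => blockStart (l a) :=
  hl.sum (F := fun _ m => 2 ^ m * (2 * m + 1))
    (((Gen.bound l).two_pow (hM.weaken l) fun p =>
      (Nat.pow_le_pow_right (by omega) p.2.isLt.le).trans (h p.1)).mul
      (((Gen.const 2).mul (Gen.bound l)).add (Gen.const 1)))

theorem Gen.blockIndex_fst {m M : α → ℕ} (hm : Gen X m) (hM : Gen X M) (h : ∀ a, 2 ^ m a ≤ M a) :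
    Gen X fun a => (blockIndex (m a)).1 := by
  have h' := GenP.count (P := fun a j => EEKakeya.blockStart (j + 1) ≤ m a) hm
    ((((Gen.bound m).add (Gen.const 1)).blockStart (hM.weaken m) fun p =>
      (Nat.pow_le_pow_right (by omega) p.2.isLt).trans (h p.1)).le (hm.weaken m))
  exact h'.of_eq fun a => blockIndex_fst_eq_sum _

theorem GenR.gridIntercept {l N k M : α → ℕ} (hl : Gen X l) (hN : Gen X N) (hk : Gen X k)
    (hM : Gen X M) (hNl : ∀ a, N a ≤ EEKakeya.blockStart (l a + 1)) (h₁ : ∀ a, 2 ^ l a ≤ M a)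
    (h₂ : ∀ a, 2 ^ N a ≤ M a) : GenR X fun a => gridIntercept (N a) (k a) := by
  have hb : Gen (ext X N) fun p : (a : α) × Fin (N a) => (blockIndex p.2).1 :=
    (Gen.bound N).blockIndex_fst (hM.weaken N) fun p =>
      (Nat.pow_le_pow_right (by omega) p.2.isLt.le).trans (h₂ p.1)
  have hsum := GenZ.sum (F := fun a m => (2 * ((blockIndex m).1 % 2 : ℕ) - 1) *
      ((2 ^ (l a - (blockIndex m).1) : ℕ) : ℤ) * ((k a % 2 ^ (N a - 1 - m) : ℕ) : ℤ)) hN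
    (((((Gen.const 2).toZ.mul (hb.mod (Gen.const 2) fun _ => two_pos).toZ).sub
      (Gen.const 1).toZ).mul (((hl.weaken N).sub hb).two_pow (hM.weaken N) fun p =>
        (Nat.pow_le_pow_right (by omega) (Nat.sub_le _ _)).trans (h₁ p.1)).toZ).mul
      ((hk.weaken N).mod ((((hN.weaken N).sub (Gen.const 1)).sub (Gen.bound N)).two_pow
        (hM.weaken N) fun p => (Nat.pow_le_pow_right (by omega) (by omega)).trans (h₂ p.1))
        fun _ => Nat.two_pow_pos _).toZ)
  exact (hsum.div ((hl.two_pow hM h₁).mul (hN.two_pow hM h₂)) fun a =>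
    Nat.mul_pos (Nat.two_pow_pos _) (Nat.two_pow_pos _)).of_eq fun a =>
      (gridIntercept_eq_div (hNl a) (k a)).symm

theorem GenP.strip {l N i k M : α → ℕ} {c s x y η ε : α → ℝ} (hl : Gen X l) (hN : Gen X N)
    (hi : Gen X i) (hk : Gen X k) (hM : Gen X M) (hc : GenR X c) (hs : GenR X s) (hx : GenR X x)
    (hy : GenR X y) (hη : GenR X η) (hε : GenR X ε)
    (hNl : ∀ a, N a ≤ EEKakeya.blockStart (l a + 1)) (h₁ : ∀ a, 2 ^ l a ≤ M a)
    (h₂ : ∀ a, 2 ^ N a ≤ M a) :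
    GenP X fun a => Strip (N a) (l a) (i a) (k a) (η a) (ε a) (c a) (s a) (x a, y a) := by
  have hu := (hc.mul hx).add (hs.mul hy)
  have hgrid := GenR.gridIntercept hl hN hk hM hNl h₁ h₂
  refine GenP.of_iff (P := fun a =>
    |c a * x a + s a * y a - ((i a : ℝ) / (2 ^ l a : ℕ) - l a)| ≤ η a ∧
    |(c a * y a - s a * x a) - (k a : ℝ) / (2 ^ N a : ℕ) * (c a * x a + s a * y a) -
      EEKakeya.gridIntercept (N a) (k a)| ≤ ε a) ?_ fun a => ?_
  · refine ((hu.sub ((hi.toR.div_nat (hl.two_pow hM h₁) fun _ => Nat.two_pow_pos _).sub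
      hl.toR)).abs_le hη).and ?_
    exact ((((hc.mul hy).sub (hs.mul hx)).sub ((hk.toR.div_nat (hN.two_pow hM h₂)
      fun _ => Nat.two_pow_pos _).mul hu)).sub hgrid).abs_le hε
  · simp [Strip]

theorem GenP.nearAt {n U V i k i' j' c M : α → ℕ} (hn : Gen X n) (hU : Gen X U) (hV : Gen X V)
    (hi : Gen X i) (hk : Gen X k) (hi' : Gen X i') (hj' : Gen X j') (hc : Gen X c) (hM : Gen X M)
    (h : ∀ a, 2 ^ depth (n a) ≤ M a) (hil : ∀ a, i a < 2 ^ level (n a) * (2 * level (n a) + 1)) :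
    GenP X fun a => NearAt (n a) (U a) (V a) (i a) (k a) (i' a) (j' a) (c a) := by
  -- All powers of two that occur have exponents at most `depth (n a)`, so the one bound `M`
  -- suffices for all of them.
  have hexp : ∀ {a : α} {e : ℕ}, e ≤ depth (n a) → 2 ^ e ≤ M a := fun he =>
    (Nat.pow_le_pow_right (by omega) he).trans (h _)
  have hdepth : ∀ a, EEKakeya.blockStart (level (n a) + 1) + 2 * level (n a) + 10 ≤ depth (n a) :=
    fun a => blockStart_add_lt _ (by simp [level])
  have hl : Gen X fun a => level (n a) := ((Gen.const 4).mul hn).add (Gen.const 4)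
  have hl2 : ∀ a, 2 ^ level (n a) ≤ M a := fun a => hexp (by have := hdepth a; omega)
  have hW : Gen X fun a => 2 ^ depth (n a) :=
    (((Gen.const 5).mul hl).two_pow hM fun a => Nat.lt_two_pow_self.le.trans (h a)).two_pow hM h
  have hpos : ∀ {e : α → ℕ}, ∀ a, 0 < 2 ^ e a := fun _ => Nat.two_pow_pos _
  have hN := (hl.blockStart hM hl2).add hi
  have hNl : ∀ a, EEKakeya.blockStart (level (n a)) + i a ≤
      EEKakeya.blockStart (level (n a) + 1) := fun a => by
    rw [blockStart_succ]
    exact Nat.add_le_add_left (hil a).le _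
  have hN2 : ∀ a, 2 ^ (EEKakeya.blockStart (level (n a)) + i a) ≤ M a := fun a => hexp (by
    have := hdepth a
    have := hNl a
    omega)
  have hshift := (((Gen.const 2).mul hl).add (Gen.const 4)).toR
  have hstrip : ∀ {x y : α → ℝ}, GenR X x → GenR X y → GenP X fun a =>
      Strip (EEKakeya.blockStart (level (n a)) + i a) (level (n a)) (i a) (k a)
      ((2 : ℕ) / (2 ^ level (n a) : ℕ))
      ((3 : ℕ) / (2 ^ level (n a) * 2 ^ (EEKakeya.blockStart (level (n a)) + i a) : ℕ)) (x a) (y a)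
      ((U a : ℝ) / (2 ^ depth (n a) : ℕ) + i' a - (2 * level (n a) + 4 : ℕ),
        (V a : ℝ) / (2 ^ depth (n a) : ℕ) + j' a - (2 * level (n a) + 4 : ℕ)) := fun hx hy =>
    GenP.strip hl hN hi hk hM hx hy (((hU.toR.div_nat hW hpos).add hi'.toR).sub hshift)
      (((hV.toR.div_nat hW hpos).add hj'.toR).sub hshift)
      ((Gen.const 2).toR.div_nat (hl.two_pow hM hl2) hpos)
      ((Gen.const 3).toR.div_nat ((hl.two_pow hM hl2).mul (hN.two_pow hM hN2))
        fun a => Nat.mul_pos (Nat.two_pow_pos _) (Nat.two_pow_pos _)) hNl hl2 hN2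
  have hκ := hc.toR.div_nat hW hpos
  have h0 : GenR X fun _ => (0 : ℝ) := (Gen.const 0).toR.of_eq fun _ => Nat.cast_zero
  have h1 : GenR X fun _ => (1 : ℝ) := (Gen.const 1).toR.of_eq fun _ => Nat.cast_one
  have hc1 := hc.add (Gen.const 1)
  refine (((((Gen.const 2).mul (hc.mul hc)).le (hW.mul hW)).and
    ((hW.mul hW).lt ((Gen.const 2).mul (hc1.mul hc1)))).and
    ((hstrip h1 h0).or ((hstrip hκ hκ).or ((hstrip h0 h1).or (hstrip hκ.neg hκ))))).of_iff
    fun a => ?_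
  simp only [NearAt, or_and_right, exists_or, exists_eq_left]

theorem GenP.near {n U V M : α → ℕ} (hn : Gen X n) (hU : Gen X U) (hV : Gen X V) (hM : Gen X M)
    (h : ∀ a, 2 ^ depth (n a) ≤ M a) : GenP X fun a => Near (n a) (U a) (V a) := by
  have hexp : ∀ {a : α} {e : ℕ}, e ≤ depth (n a) → 2 ^ e ≤ M a := fun he =>
    (Nat.pow_le_pow_right (by omega) he).trans (h _)
  have hdepth : ∀ a, EEKakeya.blockStart (level (n a) + 1) + 2 * level (n a) + 10 ≤ depth (n a) :=
    fun a => blockStart_add_lt _ (by simp [level])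
  have hl : Gen X fun a => level (n a) := ((Gen.const 4).mul hn).add (Gen.const 4)
  have hl2 : ∀ a, 2 ^ level (n a) ≤ M a := fun a => hexp (by have := hdepth a; omega)
  have hW : Gen X fun a => 2 ^ depth (n a) :=
    (((Gen.const 5).mul hl).two_pow hM fun a => Nat.lt_two_pow_self.le.trans (h a)).two_pow hM h
  have hbound : Gen X fun a => 4 * level (n a) + 9 := ((Gen.const 4).mul hl).add (Gen.const 9)
  refine GenP.exists_lt ((hl.two_pow hM hl2).mul (((Gen.const 2).mul hl).add (Gen.const 1))) ?_
  refine GenP.exists_lt ((Gen.two_pow (((hl.blockStart hM hl2).weaken _).add (Gen.bound _))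
    (hM.weaken _) fun p => hexp ?_).add (Gen.const 1)) ?_
  · have h₁ := hdepth p.1
    have h₂ := p.2.isLt
    rw [blockStart_succ] at h₁
    omega
  refine GenP.exists_lt ((hbound.weaken _).weaken _) ?_
  refine GenP.exists_lt (((hbound.weaken _).weaken _).weaken _) ?_
  refine GenP.exists_lt (((((hW.add (Gen.const 1)).weaken _).weaken _).weaken _).weaken _) ?_
  exact GenP.nearAt (((((hn.weaken _).weaken _).weaken _).weaken _).weaken _)
    (((((hU.weaken _).weaken _).weaken _).weaken _).weaken _)
    (((((hV.weaken _).weaken _).weaken _).weaken _).weaken _)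
    (((((Gen.bound _).weaken _).weaken _).weaken _).weaken _)
    ((((Gen.bound _).weaken _).weaken _).weaken _)
    (((Gen.bound _).weaken _).weaken _) ((Gen.bound _).weaken _) (Gen.bound _)
    (((((hM.weaken _).weaken _).weaken _).weaken _).weaken _) (fun p => h _)
    fun p => p.1.1.1.1.2.isLt

end

end EEKakeya

end

noncomputable section

namespace EEKakeya

/-! ### The martingale -/

theorem sum_range_two_mul (f : ℕ → ℝ) (m : ℕ) :
    ∑ i ∈ Finset.range (2 * m), f i = ∑ i ∈ Finset.range m, (f (2 * i) + f (2 * i + 1)) := by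
  induction m with
  | zero => simp
  | succ m ih =>
    rw [Finset.sum_range_succ, ← ih, Nat.mul_succ, Finset.sum_range_succ, Finset.sum_range_succ,
      add_assoc]

/-- The two children together run through an interval of length `2 m`, in which neighbours `2 i` and
`2 i + 1` have the same quotient by `2 ^ (r + 1)`, namely that of `i` in the parent. -/
theorem sum_children (H : ℕ → ℝ) (m r u : ℕ) :
    ∑ a ∈ Finset.range 2, ∑ α ∈ Finset.range m, H ((m * (2 * u + a) + α) / 2 ^ (r + 1)) =
      2 * ∑ α ∈ Finset.range m, H ((m * u + α) / 2 ^ r) := by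
  have h := sum_range_two_mul (fun i => H ((m * (2 * u) + i) / 2 ^ (r + 1))) m
  rw [two_mul m, Finset.sum_range_add] at h
  have h₁ : ∀ i, (m * (2 * u) + 2 * i) / 2 ^ (r + 1) = (m * u + i) / 2 ^ r := fun i => by
    rw [pow_succ', ← Nat.div_div_eq_div_mul]
    congr 1
    rw [show m * (2 * u) + 2 * i = 2 * (m * u + i) by ring]
    omega
  have h₂ : ∀ i, (m * (2 * u) + (2 * i + 1)) / 2 ^ (r + 1) = (m * u + i) / 2 ^ r := fun i => by
    rw [pow_succ', ← Nat.div_div_eq_div_mul]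
    congr 1
    rw [show m * (2 * u) + (2 * i + 1) = 2 * (m * u + i) + 1 by ring]
    omega
  simp only [h₁, h₂] at h
  rw [Finset.sum_range_succ, Finset.sum_range_one, Finset.mul_sum]
  simp only [add_zero]
  have e : ∀ α, m * (2 * u + 1) + α = m * (2 * u) + (m + α) := fun α => by ring
  simp only [e]
  rw [h]
  exact Finset.sum_congr rfl fun i _ => by ring

/-- The average of the function `G` of the squares of side `2⁻ˢ` over the square `Q_r(u,v)`. -/
def average (G : ℕ → ℕ → ℝ) (s r u v : ℕ) : ℝ :=
  (∑ α ∈ Finset.range (2 ^ s), ∑ β ∈ Finset.range (2 ^ s),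
    G ((2 ^ s * u + α) / 2 ^ r) ((2 ^ s * v + β) / 2 ^ r)) / 4 ^ s

/-- `average` samples `G` at a `2 ^ s × 2 ^ s` grid of points of the square, which is right for
squares both larger and smaller than the mesh. So `sum_children` in each coordinate gives the
identity without cases. -/
theorem average_eq (G : ℕ → ℕ → ℝ) (s r u v : ℕ) :
    average G s r u v = 1 / 4 * ∑ a ∈ Finset.range 2, ∑ b ∈ Finset.range 2,
      average G s (r + 1) (2 * u + a) (2 * v + b) := by
  have h : ∀ a, ∑ b ∈ Finset.range 2, ∑ α ∈ Finset.range (2 ^ s), ∑ β ∈ Finset.range (2 ^ s),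
      G ((2 ^ s * (2 * u + a) + α) / 2 ^ (r + 1)) ((2 ^ s * (2 * v + b) + β) / 2 ^ (r + 1)) =
      ∑ α ∈ Finset.range (2 ^ s), 2 * ∑ β ∈ Finset.range (2 ^ s),
        G ((2 ^ s * (2 * u + a) + α) / 2 ^ (r + 1)) ((2 ^ s * v + β) / 2 ^ r) := fun a => by
    rw [Finset.sum_comm]
    exact Finset.sum_congr rfl fun α _ => sum_children (G _) _ _ _
  simp only [average, ← Finset.sum_div, h]
  rw [sum_children (fun x => 2 * ∑ β ∈ Finset.range (2 ^ s), G x ((2 ^ s * v + β) / 2 ^ r)),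
    ← Finset.mul_sum]
  ring

theorem average_nonneg {G : ℕ → ℕ → ℝ} (hG : ∀ U V, 0 ≤ G U V) (s r u v : ℕ) :
    0 ≤ average G s r u v :=
  div_nonneg (Finset.sum_nonneg fun _ _ => Finset.sum_nonneg fun _ _ => hG _ _) (by positivity)

/-- A nonnegative martingale grows at most by the factor 4 from a square to a child. -/
theorem average_le {G : ℕ → ℕ → ℝ} (hG : ∀ U V, 0 ≤ G U V) (s r u v : ℕ) (hu : u < 2 ^ r)
    (hv : v < 2 ^ r) : average G s r u v ≤ 4 ^ r * average G s 0 0 0 := by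
  induction r generalizing u v with
  | zero =>
    have hu : u = 0 := by simpa using hu
    have hv : v = 0 := by simpa using hv
    simp [hu, hv]
  | succ r ih =>
    rw [pow_succ] at hu hv
    have h := ih (u / 2) (v / 2) (by omega) (by omega)
    have hchild : average G s (r + 1) u v ≤ ∑ a ∈ Finset.range 2, ∑ b ∈ Finset.range 2,
        average G s (r + 1) (2 * (u / 2) + a) (2 * (v / 2) + b) := by
      have h₁ := Finset.single_le_sum (f := fun a => ∑ b ∈ Finset.range 2,
        average G s (r + 1) (2 * (u / 2) + a) (2 * (v / 2) + b))
        (fun _ _ => Finset.sum_nonneg fun _ _ => average_nonneg hG _ _ _ _)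
        (Finset.mem_range.2 (Nat.mod_lt u two_pos))
      have h₂ := Finset.single_le_sum (f := fun b =>
        average G s (r + 1) (2 * (u / 2) + u % 2) (2 * (v / 2) + b))
        (fun _ _ => average_nonneg hG _ _ _ _) (Finset.mem_range.2 (Nat.mod_lt v two_pos))
      simp only [Nat.div_add_mod] at h₁ h₂
      exact h₂.trans h₁
    rw [average_eq G s r (u / 2) (v / 2)] at h
    rw [pow_succ]
    linarith

theorem average_of_le (G : ℕ → ℕ → ℝ) {s r : ℕ} (h : s ≤ r) (u v : ℕ) :
    average G s r u v = G (u / 2 ^ (r - s)) (v / 2 ^ (r - s)) := by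
  have key : ∀ w, ∀ α ∈ Finset.range (2 ^ s), (2 ^ s * w + α) / 2 ^ r = w / 2 ^ (r - s) := by
    intro w α hα
    conv_lhs => rw [← Nat.add_sub_cancel' h, pow_add, ← Nat.div_div_eq_div_mul]
    rw [Nat.mul_add_div (Nat.two_pow_pos s), Nat.div_eq_of_lt (Finset.mem_range.1 hα), add_zero]
  rw [average, Finset.sum_congr rfl fun α hα => Finset.sum_congr rfl fun β hβ => by
    rw [key u α hα, key v β hβ]]
  simp only [Finset.sum_const, Finset.card_range, nsmul_eq_mul]
  push_cast
  rw [← mul_assoc, ← mul_pow]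
  norm_num

open Classical in
/-- The indicator function of the `n`-th cover. -/
def nearInd (n U V : ℕ) : ℕ := if Near n U V then 1 else 0

/-- The density of the `n`-th cover. -/
def coverDensity (n r u v : ℕ) : ℝ := average (fun U V => nearInd n U V) (depth n) r u v

/-- The sum of the densities of all covers. -/
def totalDensity (r u v : ℕ) : ℝ := ∑' n, coverDensity n r u v

theorem coverDensity_nonneg (n r u v : ℕ) : 0 ≤ coverDensity n r u v :=
  average_nonneg (fun _ _ => Nat.cast_nonneg _) _ _ _ _

/-- The number of covers that are used for the approximation of the martingale. -/
def cutoff (r t : ℕ) : ℕ := 2 * r + t + 20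

end EEKakeya

end

noncomputable section

namespace EEKakeya

/-! ### The covers contain the lines -/

attribute [local irreducible] depth level

/-- The covers use only even blocks, whose sign is positive. -/
theorem xseq_blockStart_add {n i : ℕ} (hi : i < 2 ^ level n * (2 * level n + 1)) :
    xseq (blockStart (level n) + i) = i / 2 ^ level n - level n := by
  have heven : Even (level n) := ⟨2 * n + 2, by rw [level]; ring⟩
  rw [xseq, blockIndex_blockStart_add hi, heven.neg_one_pow, one_mul]

/-- With `k = ⌊a 2 ^ N⌋` and `j = N - 1 - m`, the coarser floor `⌊a 2 ^ (m + 1)⌋` is the quotient of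
`k` by `2 ^ j`; what truncation to `m + 1` digits removes from `k / 2 ^ N` is the remainder. -/
theorem sub_floor_div_eq {a : ℝ} (ha : 0 ≤ a) {m N : ℕ} (hm : m < N) :
    a - ⌊a * 2 ^ (m + 1)⌋ / 2 ^ (m + 1) =
      (a - ⌊a * 2 ^ N⌋₊ / 2 ^ N) + ((⌊a * 2 ^ N⌋₊ % 2 ^ (N - 1 - m) : ℕ) : ℝ) / 2 ^ N := by
  obtain ⟨j, rfl⟩ := Nat.exists_eq_add_of_lt hm
  have e : m + j + 1 - 1 - m = j := by omega
  have hfl : (⌊a * 2 ^ (m + 1)⌋ : ℝ) = ((⌊a * 2 ^ (m + j + 1)⌋₊ / 2 ^ j : ℕ) : ℝ) := by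
    have h₁ : a * 2 ^ (m + 1) = a * 2 ^ (m + j + 1) / ((2 ^ j : ℕ) : ℝ) := by
      push_cast
      rw [show m + j + 1 = m + 1 + j by ring, pow_add _ (m + 1) j]
      field_simp
    rw [← natCast_floor_eq_intCast_floor (by positivity), h₁, Nat.floor_div_natCast]
  have hdm : (⌊a * 2 ^ (m + j + 1)⌋₊ : ℝ) = 2 ^ j * ((⌊a * 2 ^ (m + j + 1)⌋₊ / 2 ^ j : ℕ) : ℝ) +
      ((⌊a * 2 ^ (m + j + 1)⌋₊ % 2 ^ j : ℕ) : ℝ) := by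
    exact_mod_cast (Nat.div_add_mod _ _).symm
  rw [hfl, e]
  conv_rhs => rw [hdm]
  rw [show m + j + 1 = m + 1 + j by ring, pow_add _ (m + 1) j]
  field_simp
  ring

/-- The heart of the construction: a line and its truncation nearly meet at `x_N`. Since `x_0 = 0`,
the first `N` terms of the intercept sum to `-(a - k / 2 ^ N) x_N` plus `gridIntercept N k`. The
difference of the lines is thus `(a - k / 2 ^ N) (x - x_N)` plus a tail with steps at most `2 ^
(-l)`, and each part is at most `1 / (2 ^ l 2 ^ N)`. -/
theorem abs_line_sub_le {a x : ℝ} (ha : 0 ≤ a) {N l : ℕ} (hN : blockStart l ≤ N)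
    (hx : |x - xseq N| ≤ 1 / 2 ^ l) :
    |(a * x + intercept a) - (⌊a * 2 ^ N⌋₊ / 2 ^ N * x + gridIntercept N ⌊a * 2 ^ N⌋₊)| ≤
      2 / (2 ^ l * 2 ^ N) := by
  set k := ⌊a * 2 ^ N⌋₊ with hk
  have hfrac : |a - k / 2 ^ N| ≤ 1 / 2 ^ N := by
    have h₁ := Nat.floor_le (show 0 ≤ a * 2 ^ N by positivity)
    have h₂ := Nat.lt_floor_add_one (a * 2 ^ N)
    rw [← hk] at h₁ h₂
    have e : a - k / 2 ^ N = (a * 2 ^ N - k) / 2 ^ N := by field_simp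
    rw [e, abs_of_nonneg (div_nonneg (by linarith) (by positivity))]
    gcongr
    linarith
  have hhead : ∑ m ∈ Finset.range N, interceptTerm a m =
      (a - k / 2 ^ N) * (0 - xseq N) + gridIntercept N k := by
    have h0 : xseq 0 = 0 := by simp [xseq, blockIndex]
    rw [← h0, ← Finset.sum_range_sub' xseq N, Finset.mul_sum, gridIntercept,
      ← Finset.sum_add_distrib]
    refine Finset.sum_congr rfl fun m hm => ?_
    rw [interceptTerm, sub_floor_div_eq ha (Finset.mem_range.1 hm)]
    ring
  have htail : |∑' m, interceptTerm a (m + N)| ≤ 1 / (2 ^ l * 2 ^ N) := by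
    have hg : HasSum (fun m : ℕ => 1 / (2 ^ l * 2 ^ N) * (1 / 2 / 2 ^ m : ℝ))
        (1 / (2 ^ l * 2 ^ N) * 1) := (hasSum_geometric_two' 1).mul_left _
    rw [mul_one] at hg
    rw [← Real.norm_eq_abs]
    refine tsum_of_norm_bounded hg fun m => ?_
    have h0 : (0 : ℝ) < 2 ^ (m + N + 1) := by positivity
    have e : a - ⌊a * 2 ^ (m + N + 1)⌋ / 2 ^ (m + N + 1) =
        Int.fract (a * 2 ^ (m + N + 1)) / 2 ^ (m + N + 1) := by
      rw [Int.fract]; field_simp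
    rw [interceptTerm, Real.norm_eq_abs, abs_mul, e, abs_div, abs_of_pos h0,
      abs_of_nonneg (Int.fract_nonneg (a * 2 ^ (m + N + 1)))]
    calc |xseq (m + N) - xseq (m + N + 1)| * (Int.fract (a * 2 ^ (m + N + 1)) / 2 ^ (m + N + 1))
        ≤ 1 / 2 ^ l * (1 / 2 ^ (m + N + 1)) :=
          mul_le_mul (abs_xseq_sub_succ_le (by omega))
            (by gcongr; exact (Int.fract_lt_one _).le)
            (div_nonneg (Int.fract_nonneg _) h0.le) (by positivity)
      _ = 1 / (2 ^ l * 2 ^ N) * (1 / 2 / 2 ^ m) := by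
          rw [pow_add, pow_add]
          field_simp
  have hsplit : intercept a = ∑ m ∈ Finset.range N, interceptTerm a m +
      ∑' m, interceptTerm a (m + N) := ((summable_interceptTerm a).sum_add_tsum_nat_add N).symm
  have e : (a * x + intercept a) - (k / 2 ^ N * x + gridIntercept N k) =
      (a - k / 2 ^ N) * (x - xseq N) + ∑' m, interceptTerm a (m + N) := by
    rw [hsplit, hhead]
    ring
  rw [e]
  calc _ ≤ |(a - k / 2 ^ N) * (x - xseq N)| + |∑' m, interceptTerm a (m + N)| := abs_add_le _ _
    _ ≤ 1 / 2 ^ N * (1 / 2 ^ l) + 1 / (2 ^ l * 2 ^ N) := by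
        rw [abs_mul]
        gcongr
    _ = 2 / (2 ^ l * 2 ^ N) := by field_simp; ring

/-- The case `N = l = 0` at `x = x_0 = 0`, where the truncated line has height 0. -/
theorem abs_intercept_le {a : ℝ} (ha : 0 ≤ a) : |intercept a| ≤ 2 := by
  have h := abs_line_sub_le (x := 0) ha (N := 0) (l := 0) (by simp [blockStart])
    (by simp [xseq, blockIndex])
  simpa [gridIntercept] using h

/-- The slope of a strip is at most 1, so errors `e` in both rotated coordinates change the height
above the line by at most `2 e`. This is used both from a point to the corner of its square and
back. -/
theorem Strip.perturb {N l i k : ℕ} {η ε c s c' s' e : ℝ} {p p' : ℝ × ℝ}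
    (h : Strip N l i k η ε c s p) (hk : k ≤ 2 ^ N)
    (h₁ : |c' * p'.1 + s' * p'.2 - (c * p.1 + s * p.2)| ≤ e)
    (h₂ : |c' * p'.2 - s' * p'.1 - (c * p.2 - s * p.1)| ≤ e) :
    Strip N l i k (η + e) (ε + 2 * e) c' s' p' := by
  obtain ⟨hη, hε⟩ := h
  have hk0 : (0 : ℝ) ≤ k / 2 ^ N := by positivity
  have hk1 : (k : ℝ) / 2 ^ N ≤ 1 := by
    rw [div_le_one (by positivity)]
    exact_mod_cast hk
  constructor
  · calc _ = |(c * p.1 + s * p.2 - (i / 2 ^ l - l)) +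
          (c' * p'.1 + s' * p'.2 - (c * p.1 + s * p.2))| := by congr 1; ring
      _ ≤ _ := (abs_add_le _ _).trans (add_le_add hη h₁)
  · calc _ = |((c * p.2 - s * p.1) - k / 2 ^ N * (c * p.1 + s * p.2) - gridIntercept N k) +
          ((c' * p'.2 - s' * p'.1 - (c * p.2 - s * p.1)) -
            k / 2 ^ N * (c' * p'.1 + s' * p'.2 - (c * p.1 + s * p.2)))| := by congr 1; ring
      _ ≤ ε + (e + 1 * e) := by
        refine (abs_add_le _ _).trans (add_le_add hε ((abs_sub _ _).trans (add_le_add h₂ ?_)))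
        rw [abs_mul, abs_of_nonneg hk0]
        exact mul_le_mul hk1 h₁ (abs_nonneg _) zero_le_one
      _ = _ := by ring

theorem abs_mul_sub_mul_le {c c' x x' δ B : ℝ} (hc : |c' - c| ≤ δ) (hc1 : |c| ≤ 1)
    (hx : |x' - x| ≤ δ) (hB : |x'| ≤ B) : |c' * x' - c * x| ≤ (B + 1) * δ := by
  have hδ : 0 ≤ δ := (abs_nonneg _).trans hc
  calc |c' * x' - c * x| = |(c' - c) * x' + c * (x' - x)| := by congr 1; ring
    _ ≤ |c' - c| * |x'| + |c| * |x' - x| := by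
      rw [← abs_mul, ← abs_mul]; exact abs_add_le _ _
    _ ≤ δ * B + 1 * δ := by gcongr
    _ = (B + 1) * δ := by ring

theorem abs_rotate_sub_le {c c' s s' δ B : ℝ} {p p' : ℝ × ℝ} (hc : |c' - c| ≤ δ) (hs : |s' - s| ≤ δ)
    (hc1 : |c| ≤ 1) (hs1 : |s| ≤ 1) (hx : |p'.1 - p.1| ≤ δ) (hy : |p'.2 - p.2| ≤ δ)
    (hxB : |p'.1| ≤ B) (hyB : |p'.2| ≤ B) :
    |c' * p'.1 + s' * p'.2 - (c * p.1 + s * p.2)| ≤ 2 * ((B + 1) * δ) ∧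
      |c' * p'.2 - s' * p'.1 - (c * p.2 - s * p.1)| ≤ 2 * ((B + 1) * δ) := by
  constructor
  · rw [add_sub_add_comm, two_mul]
    exact (abs_add_le _ _).trans
      (add_le_add (abs_mul_sub_mul_le hc hc1 hx hxB) (abs_mul_sub_mul_le hs hs1 hy hyB))
  · rw [sub_sub_sub_comm, two_mul]
    exact (abs_sub _ _).trans
      (add_le_add (abs_mul_sub_mul_le hc hc1 hy hyB) (abs_mul_sub_mul_le hs hs1 hx hxB))

/-! ### The four directions and their rational approximations. -/

/-- The direction at the angle `q π / 4`, if `κ = cos (π / 4)`. -/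
def direction (κ : ℝ) : Fin 4 → ℝ × ℝ := ![(1, 0), (κ, κ), (0, 1), (-κ, κ)]

theorem abs_direction_sub_le {κ κ' δ : ℝ} (h : |κ' - κ| ≤ δ) (q : Fin 4) :
    |(direction κ' q).1 - (direction κ q).1| ≤ δ ∧ |(direction κ' q).2 - (direction κ q).2| ≤ δ := by
  have hδ : 0 ≤ δ := (abs_nonneg _).trans h
  have h' : |κ - κ'| ≤ δ := by rwa [abs_sub_comm]
  fin_cases q <;> simp [direction, h, hδ]
  rwa [show -κ' + κ = κ - κ' by ring]

theorem sqrt_two_div_two_le_one : |√2 / 2| ≤ 1 := by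
  rw [abs_of_nonneg (by positivity)]
  nlinarith [Real.sq_sqrt (show (0 : ℝ) ≤ 2 by norm_num), Real.sqrt_nonneg 2]

theorem abs_direction_le (q : Fin 4) :
    |(direction (√2 / 2) q).1| ≤ 1 ∧ |(direction (√2 / 2) q).2| ≤ 1 := by
  have h := sqrt_two_div_two_le_one
  fin_cases q <;> simp [direction] <;> simpa using h

/-- The hypotheses say that `c = ⌊W / √2⌋`. -/
theorem abs_div_sub_sqrt_le {c W : ℕ} (h₁ : 2 * (c * c) ≤ W * W)
    (h₂ : W * W < 2 * ((c + 1) * (c + 1))) (hW : 0 < W) :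
    |(c : ℝ) / W - √2 / 2| ≤ 1 / W := by
  have hW' : (0 : ℝ) < W := Nat.cast_pos.2 hW
  have h₁' : 2 * ((c : ℝ) * c) ≤ W * W := by exact_mod_cast h₁
  have h₂' : (W : ℝ) * W < 2 * ((c + 1) * (c + 1)) := by exact_mod_cast h₂
  have hs : √2 * √2 = 2 := Real.mul_self_sqrt (by norm_num)
  have hs0 : 0 < √2 := Real.sqrt_pos.2 (by norm_num)
  have hc : (0 : ℝ) ≤ c := Nat.cast_nonneg c
  have e : (c : ℝ) / W - √2 / 2 = (c - W * (√2 / 2)) / W := by field_simp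
  have e₂ : (W * (√2 / 2)) * (W * (√2 / 2)) = W * W / 2 := by
    calc _ = W * W * (√2 * √2) / 4 := by ring
      _ = _ := by rw [hs]; ring
  have hpos : 0 ≤ W * (√2 / 2) := by positivity
  rw [e, abs_div, abs_of_pos hW']
  gcongr
  rw [abs_le]
  constructor
  · nlinarith
  · nlinarith

/-- The left side is twice the error from rounding a direction and a point, with coordinates up to
`2 l + 6`, to precision `2 ^ (-depth n)`. So rounding adds at most one unit `1 / (2 ^ l 2 ^ N)` to
the height of a strip. -/
theorem two_mul_error_le {n i : ℕ} (hi : i < 2 ^ level n * (2 * level n + 1)) :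
    2 * (2 * ((2 * (level n : ℝ) + 6 + 1) * (1 / (2 ^ depth n : ℕ)))) ≤
      1 / (2 ^ level n * 2 ^ (blockStart (level n) + i)) := by
  have h₁ := blockStart_add_lt (level n) (by rw [level]; omega)
  rw [blockStart_succ, ← depth] at h₁
  have hl : level n + 1 ≤ 2 ^ level n := Nat.lt_two_pow_self
  have h₂ : (8 * level n + 28) * (2 ^ level n * 2 ^ (blockStart (level n) + i)) ≤ 2 ^ depth n := by
    calc _ ≤ 2 ^ (level n + 5) * (2 ^ level n * 2 ^ (blockStart (level n) + i)) := by
          refine Nat.mul_le_mul_right _ ?_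
          rw [pow_add]
          omega
      _ = 2 ^ (level n + 5 + (level n + (blockStart (level n) + i))) := by
          rw [← pow_add, ← pow_add]
      _ ≤ 2 ^ depth n := Nat.pow_le_pow_right (by omega) (by omega)
  have h₃ : (8 * (level n : ℝ) + 28) * (2 ^ level n * 2 ^ (blockStart (level n) + i)) ≤
      (2 ^ depth n : ℕ) := by exact_mod_cast h₂
  have hW : (0 : ℝ) < (2 ^ depth n : ℕ) := Nat.cast_pos.2 (Nat.two_pow_pos _)
  rw [le_div_iff₀ (by positivity)]
  calc _ = (8 * (level n : ℝ) + 28) * (2 ^ level n * 2 ^ (blockStart (level n) + i)) /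
        (2 ^ depth n : ℕ) := by ring
    _ ≤ 1 := by rwa [div_le_one hW]

theorem nearAt_iff (n U V i k i' j' c : ℕ) : NearAt n U V i k i' j' c ↔
    (2 * (c * c) ≤ 2 ^ depth n * 2 ^ depth n ∧
      2 ^ depth n * 2 ^ depth n < 2 * ((c + 1) * (c + 1))) ∧
    ∃ q : Fin 4, Strip (blockStart (level n) + i) (level n) i k (2 / 2 ^ level n)
      (3 / (2 ^ level n * 2 ^ (blockStart (level n) + i)))
      (direction ((c : ℝ) / (2 ^ depth n : ℕ)) q).1 (direction ((c : ℝ) / (2 ^ depth n : ℕ)) q).2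
      ((U : ℝ) / (2 ^ depth n : ℕ) + i' - (2 * level n + 4 : ℕ),
        (V : ℝ) / (2 ^ depth n : ℕ) + j' - (2 * level n + 4 : ℕ)) := by
  rw [NearAt]
  refine and_congr_right fun _ => ?_
  push_cast
  constructor
  · rintro ⟨a, rfl | rfl | rfl | rfl, h⟩
    exacts [⟨0, h⟩, ⟨1, h⟩, ⟨2, h⟩, ⟨3, h⟩]
  · rintro ⟨q, h⟩
    refine ⟨_, ?_, h⟩
    fin_cases q <;> simp [direction]

/-- The index `i` is chosen so that `x_N` is within `2 ^ (-l)` of `x`, and `k = ⌊a 2 ^ N⌋`. By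
`abs_line_sub_le` the exact point lies in a strip with the tolerances `1 / 2 ^ l` and `2 / (2 ^ l 2
^ N)`; rounding adds at most one unit to each. -/
theorem near_of_mem {n : ℕ} {p : ℝ × ℝ} (hp : p ∈ unitSquare) {q : Fin 4} {i₀ j₀ : ℤ} {a x : ℝ}
    (ha : a ∈ Set.Icc (0 : ℝ) 1) (hx : |x| ≤ level n)
    (h₁ : p.1 + i₀ = (direction (√2 / 2) q).1 * x - (direction (√2 / 2) q).2 * (a * x + intercept a))
    (h₂ : p.2 + j₀ = (direction (√2 / 2) q).2 * x + (direction (√2 / 2) q).1 * (a * x + intercept a))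
    (hq : (direction (√2 / 2) q).1 ^ 2 + (direction (√2 / 2) q).2 ^ 2 = 1) :
    Near n ⌊2 ^ depth n * p.1⌋₊ ⌊2 ^ depth n * p.2⌋₊ := by
  obtain ⟨⟨hp1, hp1'⟩, hp2, hp2'⟩ := hp
  obtain ⟨hc1, hs1⟩ := abs_direction_le q
  set y := a * x + intercept a with hy
  set c₀ := (direction (√2 / 2) q).1 with hc₀
  set s₀ := (direction (√2 / 2) q).2 with hs₀
  set l := level n with hl
  set W : ℕ := 2 ^ depth n with hW
  have hWpos : 0 < W := Nat.two_pow_pos _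
  have hWR : (0 : ℝ) < W := Nat.cast_pos.2 hWpos
  have hylt : |y| ≤ l + 2 := by
    refine (abs_add_le _ _).trans (add_le_add ?_ (abs_intercept_le ha.1))
    rw [abs_mul, abs_of_nonneg ha.1]
    exact (mul_le_of_le_one_left (abs_nonneg _) ha.2).trans hx
  have hb : ∀ {u w : ℝ}, |u| ≤ 1 → |w| ≤ 1 → |u * x| + |w * y| ≤ 2 * l + 2 := by
    intro u w hu hw
    have hux := mul_le_mul hu hx (abs_nonneg x) zero_le_one
    have hwy := mul_le_mul hw hylt (abs_nonneg y) zero_le_one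
    rw [abs_mul, abs_mul]
    linarith
  have hX : |p.1 + i₀| ≤ 2 * l + 2 := by
    rw [h₁]; exact (abs_sub _ _).trans (hb hc1 hs1)
  have hY : |p.2 + j₀| ≤ 2 * l + 2 := by
    rw [h₂]; exact (abs_add_le _ _).trans (hb hs1 hc1)
  -- A translation that matters is between `-(2 l + 3)` and `2 l + 2`; adding `2 l + 4` turns it
  -- into a natural number below `4 l + 9`.
  have hshift : ∀ {z : ℝ} {m : ℤ}, 0 ≤ z → z < 1 → |z + m| ≤ 2 * l + 2 →
      ∃ m' < 4 * l + 9, (m : ℝ) = (m' : ℕ) - ((2 * l + 4 : ℕ) : ℝ) := by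
    intro z m hz hz' hm
    rw [abs_le] at hm
    have m1 : (-(2 * l + 3) : ℤ) ≤ m := by
      have : (-(2 * l + 3) : ℝ) ≤ m := by linarith [hm.1]
      exact_mod_cast this
    have m2 : m ≤ (2 * l + 2 : ℤ) := by
      have : (m : ℝ) ≤ 2 * l + 2 := by linarith [hm.2]
      exact_mod_cast this
    refine ⟨(m + (2 * l + 4)).toNat, by omega, ?_⟩
    have : (((m + (2 * l + 4)).toNat : ℤ) : ℝ) = ((m + (2 * l + 4) : ℤ) : ℝ) := by
      rw [Int.toNat_of_nonneg (by omega)]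
    push_cast at this ⊢
    linarith
  obtain ⟨i', hi', ei'⟩ := hshift hp1 hp1' hX
  obtain ⟨j', hj', ej'⟩ := hshift hp2 hp2' hY
  have hxl := abs_le.1 hx
  set i := ⌊(x + l) * 2 ^ l⌋₊ with hi
  have hipos : 0 ≤ (x + l) * 2 ^ l := mul_nonneg (by linarith [hxl.1]) (by positivity)
  have hi1 := Nat.floor_le hipos
  have hi2 := Nat.lt_floor_add_one ((x + l) * 2 ^ l)
  rw [← hi] at hi1 hi2
  have hilt : i < 2 ^ l * (2 * l + 1) := by
    have h2l : (0 : ℝ) < 2 ^ l := by positivity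
    have : (i : ℝ) < 2 ^ l * (2 * l + 1) := by nlinarith [hxl.2]
    exact_mod_cast this
  set N := blockStart l + i with hN
  set k := ⌊a * 2 ^ N⌋₊ with hk
  have hkle : k ≤ 2 ^ N := by
    refine Nat.floor_le_of_le ?_
    push_cast
    exact mul_le_of_le_one_left (by positivity) ha.2
  have hxN : |x - (i / 2 ^ l - l)| ≤ 1 / 2 ^ l := by
    have e : x - (i / 2 ^ l - l) = ((x + l) * 2 ^ l - i) / 2 ^ l := by field_simp; ring
    rw [e, abs_of_nonneg (div_nonneg (by linarith) (by positivity))]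
    gcongr
    linarith
  have hline := abs_line_sub_le (l := l) (N := N) (x := x) ha.1 (Nat.le_add_right _ _)
    (by rw [xseq_blockStart_add hilt]; exact hxN)
  rw [← hk, ← hy] at hline
  have hstrip : Strip N l i k (1 / 2 ^ l) (2 / (2 ^ l * 2 ^ N)) c₀ s₀ (p.1 + i₀, p.2 + j₀) := by
    have ex : c₀ * (p.1 + i₀) + s₀ * (p.2 + j₀) = x := by
      rw [h₁, h₂]
      linear_combination x * hq
    have ey : c₀ * (p.2 + j₀) - s₀ * (p.1 + i₀) = y := by
      rw [h₁, h₂]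
      linear_combination y * hq
    refine ⟨by simp only [ex]; exact hxN, ?_⟩
    simp only [ex, ey]
    rwa [sub_sub]
  refine ⟨i, hilt, k, Nat.lt_succ_of_le hkle, i', hi', j', hj', Nat.sqrt (W * W / 2), ?_, ?_⟩
  · refine Nat.lt_succ_of_le ?_
    calc Nat.sqrt (W * W / 2) ≤ Nat.sqrt (W * W) := Nat.sqrt_le_sqrt (Nat.div_le_self _ _)
      _ = W := Nat.sqrt_eq W
  have hsq1 : 2 * (Nat.sqrt (W * W / 2) * Nat.sqrt (W * W / 2)) ≤ W * W := by
    have := Nat.sqrt_le (W * W / 2)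
    omega
  have hsq2 : W * W < 2 * ((Nat.sqrt (W * W / 2) + 1) * (Nat.sqrt (W * W / 2) + 1)) := by
    have := Nat.lt_succ_sqrt (W * W / 2)
    simp only [Nat.succ_eq_add_one] at this
    omega
  rw [nearAt_iff]
  refine ⟨⟨hsq1, hsq2⟩, q, ?_⟩
  have hκ := abs_direction_sub_le (abs_div_sub_sqrt_le hsq1 hsq2 hWpos) q
  have hcorner : ∀ {z : ℝ} {m : ℤ} {m' : ℕ}, 0 ≤ z → z < 1 → |z + m| ≤ 2 * l + 2 →
      (m : ℝ) = m' - ((2 * l + 4 : ℕ) : ℝ) →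
      |((⌊2 ^ depth n * z⌋₊ : ℝ) / W + m' - (2 * l + 4 : ℕ)) - (z + m)| ≤ 1 / W ∧
      |(⌊2 ^ depth n * z⌋₊ : ℝ) / W + m' - (2 * l + 4 : ℕ)| ≤ 2 * l + 6 := by
    intro z m m' hz hz' hzm hm
    have f1 := Nat.floor_le (show 0 ≤ 2 ^ depth n * z by positivity)
    have f2 := Nat.lt_floor_add_one (2 ^ depth n * z)
    have eW : (2 ^ depth n : ℝ) = W := by rw [hW]; push_cast; rfl
    rw [eW] at f1 f2 ⊢
    have e : ((⌊(W : ℝ) * z⌋₊ : ℝ) / W + m' - (2 * l + 4 : ℕ)) - (z + m) =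
        -((W * z - ⌊(W : ℝ) * z⌋₊) / W) := by
      rw [hm]
      field_simp
      ring
    have h1 : |((⌊(W : ℝ) * z⌋₊ : ℝ) / W + m' - (2 * l + 4 : ℕ)) - (z + m)| ≤ 1 / W := by
      rw [e, abs_neg, abs_of_nonneg (div_nonneg (by linarith) hWR.le)]
      gcongr
      linarith
    refine ⟨h1, ?_⟩
    have hW1 : (1 : ℝ) / W ≤ 1 := by
      rw [div_le_one hWR]
      exact_mod_cast hWpos
    rw [abs_le] at h1 hzm ⊢
    constructor <;> linarith [h1.1, h1.2, hzm.1, hzm.2]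
  obtain ⟨x1, x2⟩ := hcorner hp1 hp1' hX ei'
  obtain ⟨y1, y2⟩ := hcorner hp2 hp2' hY ej'
  have herr := two_mul_error_le hilt
  have hrot := abs_rotate_sub_le (p := (p.1 + i₀, p.2 + j₀))
    (p' := ((⌊2 ^ depth n * p.1⌋₊ : ℝ) / W + i' - (2 * l + 4 : ℕ),
      (⌊2 ^ depth n * p.2⌋₊ : ℝ) / W + j' - (2 * l + 4 : ℕ))) hκ.1 hκ.2 hc1 hs1 x1 y1 x2 y2
  have hfin := hstrip.perturb hkle hrot.1 hrot.2
  have hpos : 0 ≤ 2 * ((2 * (l : ℝ) + 6 + 1) * (1 / W)) := by positivity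
  have hle1 : (1 : ℝ) / (2 ^ l * 2 ^ N) ≤ 1 / 2 ^ l := by
    gcongr
    exact le_mul_of_one_le_right (by positivity) (one_le_pow₀ (by norm_num))
  refine ⟨hfin.1.trans ?_, hfin.2.trans ?_⟩
  · rw [show (2 : ℝ) / 2 ^ l = 1 / 2 ^ l + 1 / 2 ^ l by ring]
    linarith
  · rw [show (3 : ℝ) / (2 ^ l * 2 ^ N) = 2 / (2 ^ l * 2 ^ N) + 1 / (2 ^ l * 2 ^ N) by ring]
    linarith

end EEKakeya

end

noncomputable section

namespace EEKakeya

/-! ### The area of the covers -/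

open MeasureTheory

attribute [local irreducible] depth level

/-- The linear map that takes the strips to rectangles. -/
def shear (c s m : ℝ) : ℝ × ℝ →ₗ[ℝ] ℝ × ℝ :=
  Matrix.toLin (Module.Basis.finTwoProd ℝ) (Module.Basis.finTwoProd ℝ)
    !![c, s; -s - m * c, c - m * s]

theorem shear_apply (c s m : ℝ) (p : ℝ × ℝ) :
    shear c s m p = (c * p.1 + s * p.2, (c * p.2 - s * p.1) - m * (c * p.1 + s * p.2)) := by
  rw [shear, Matrix.toLin_finTwoProd_apply]
  ext
  · simp
  · simp
    ring

theorem det_shear {c s : ℝ} (h : c ^ 2 + s ^ 2 = 1) (m : ℝ) : LinearMap.det (shear c s m) = 1 := by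
  rw [shear, LinearMap.det_toLin, Matrix.det_fin_two_of]
  linear_combination h

/-- A strip is the preimage of a rectangle under a translation followed by a rotation and a shear,
which preserve area. -/
theorem volume_strip {c s : ℝ} (h : c ^ 2 + s ^ 2 = 1) (N l i k : ℕ) (η ε : ℝ) (v : ℝ × ℝ) :
    volume {p : ℝ × ℝ | Strip N l i k η ε c s (p + v)} =
      ENNReal.ofReal (2 * η) * ENNReal.ofReal (2 * ε) := by
  have e : {p : ℝ × ℝ | Strip N l i k η ε c s (p + v)} = (fun p => p + v) ⁻¹'
      (shear c s (k / 2 ^ N) ⁻¹' (Set.Icc (i / 2 ^ l - l - η) (i / 2 ^ l - l + η) ×ˢ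
        Set.Icc (gridIntercept N k - ε) (gridIntercept N k + ε))) := by
    ext p
    simp only [Set.mem_ofPred_eq, Set.mem_preimage, shear_apply, Set.mem_prod, Set.mem_Icc, Strip,
      abs_sub_le_iff, sub_le_iff_le_add]
    constructor <;> rintro ⟨⟨h1, h2⟩, h3, h4⟩ <;> refine ⟨⟨?_, ?_⟩, ?_, ?_⟩ <;> linarith
  rw [e, measure_preimage_add_right, Measure.addHaar_preimage_linearMap _
    (by rw [det_shear h]; exact one_ne_zero), det_shear h, Measure.volume_eq_prod,
    Measure.prod_prod, Real.volume_Icc, Real.volume_Icc]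
  rw [inv_one, abs_one, ENNReal.ofReal_one, one_mul]
  congr 2 <;> ring

/-- The square with the lower left corner `(U, V) / W` and sides of length `1 / W`. -/
def cell (W U V : ℕ) : Set (ℝ × ℝ) :=
  Set.Ico ((U : ℝ) / W) ((U + 1) / W) ×ˢ Set.Ico ((V : ℝ) / W) ((V + 1) / W)

theorem volume_cell {W : ℕ} (hW : 0 < W) (U V : ℕ) :
    volume (cell W U V) = ENNReal.ofReal (1 / W ^ 2) := by
  have hW' : (0 : ℝ) < W := Nat.cast_pos.2 hW
  rw [cell, Measure.volume_eq_prod, Measure.prod_prod, Real.volume_Ico, Real.volume_Ico,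
    ← ENNReal.ofReal_mul (by rw [← sub_div]; simp)]
  congr 1
  field_simp
  ring

theorem floor_of_mem_Ico {W U : ℕ} (hW : 0 < W) {x : ℝ}
    (hx : x ∈ Set.Ico ((U : ℝ) / W) ((U + 1) / W)) : ⌊x * W⌋₊ = U := by
  have hW' : (0 : ℝ) < W := Nat.cast_pos.2 hW
  rw [Set.mem_Ico, div_le_iff₀ hW', lt_div_iff₀ hW'] at hx
  exact (Nat.floor_eq_iff ((Nat.cast_nonneg U).trans hx.1)).2 hx

/-- The cells are disjoint and have area `1 / W ^ 2` each. -/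
theorem card_div_le {W : ℕ} (hW : 0 < W) (S : Finset (ℕ × ℕ)) {A : Set (ℝ × ℝ)} {a : ℝ}
    (hS : ∀ p ∈ S, cell W p.1 p.2 ⊆ A) (hA : volume A ≤ ENNReal.ofReal a) (ha : 0 ≤ a) :
    (S.card : ℝ) / W ^ 2 ≤ a := by
  have hdisj : Set.PairwiseDisjoint (S : Set (ℕ × ℕ)) fun p => cell W p.1 p.2 := by
    intro p _ q _ hpq
    refine Set.disjoint_left.2 fun z hp hq => hpq (Prod.ext ?_ ?_)
    · rw [← floor_of_mem_Ico hW hp.1, ← floor_of_mem_Ico hW hq.1]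
    · rw [← floor_of_mem_Ico hW hp.2, ← floor_of_mem_Ico hW hq.2]
  have h := measure_biUnion_finset hdisj (μ := volume)
    fun p _ => measurableSet_Ico.prod measurableSet_Ico
  simp only [volume_cell hW, Finset.sum_const, ← ENNReal.ofReal_nsmul] at h
  have h₁ := (h.symm.le.trans (measure_mono (Set.iUnion₂_subset hS))).trans hA
  rw [ENNReal.ofReal_le_ofReal_iff ha, nsmul_eq_mul] at h₁
  rwa [div_eq_mul_one_div]

theorem volume_biUnion_le {ι : Type} (S : Finset ι) (f : ι → Set (ℝ × ℝ)) {b : ℝ}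
    (h : ∀ i ∈ S, volume (f i) ≤ ENNReal.ofReal b) :
    volume (⋃ i ∈ S, f i) ≤ ENNReal.ofReal (S.card * b) := by
  refine (measure_biUnion_finset_le S f).trans ((Finset.sum_le_card_nsmul _ _ _ h).trans ?_)
  rw [← ENNReal.ofReal_nsmul, nsmul_eq_mul]

theorem direction_sq_add_sq (q : Fin 4) :
    (direction (√2 / 2) q).1 ^ 2 + (direction (√2 / 2) q).2 ^ 2 = 1 := by
  have hs : √2 ^ 2 = 2 := Real.sq_sqrt (by norm_num)
  fin_cases q <;> simp [direction, div_pow, hs] <;> norm_num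

/-- The union of the strips of the `n`-th cover. -/
def stripUnion (n : ℕ) : Set (ℝ × ℝ) :=
  ⋃ i ∈ Finset.range (2 ^ level n * (2 * level n + 1)),
    ⋃ k ∈ Finset.range (2 ^ (blockStart (level n) + i) + 1),
    ⋃ i' ∈ Finset.range (4 * level n + 9), ⋃ j' ∈ Finset.range (4 * level n + 9),
    ⋃ q ∈ (Finset.univ : Finset (Fin 4)),
      {p | Strip (blockStart (level n) + i) (level n) i k (3 / 2 ^ level n)
        (4 / (2 ^ level n * 2 ^ (blockStart (level n) + i)))
        (direction (√2 / 2) q).1 (direction (√2 / 2) q).2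
        (p + ((i' : ℝ) - (2 * level n + 4 : ℕ), (j' : ℝ) - (2 * level n + 4 : ℕ)))}

/-- One strip has area `(2 * 3 / 2 ^ l) (2 * 4 / (2 ^ l 2 ^ N)) = 48 / (4 ^ l 2 ^ N)`. The number of
slopes, at most `2 * 2 ^ N`, cancels `2 ^ N`, so every position `i` contributes equally; the other
factors count translates and directions. -/
theorem volume_stripUnion_le (n : ℕ) :
    volume (stripUnion n) ≤ ENNReal.ofReal ((2 ^ level n * (2 * level n + 1) : ℕ) *
      (2 * ((4 * level n + 9) ^ 2 * (4 * (48 / 4 ^ level n))))) := by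
  rw [← Finset.card_range (2 ^ level n * (2 * level n + 1)), stripUnion]
  set l := level n
  refine volume_biUnion_le _ _ fun i _ => ?_
  set N := blockStart l + i
  have hN : (0 : ℝ) < 2 ^ N := by positivity
  have hN1 : (1 : ℝ) ≤ 2 ^ N := one_le_pow₀ (by norm_num)
  refine (volume_biUnion_le (b := (Finset.range (4 * l + 9)).card *
    ((Finset.range (4 * l + 9)).card * ((Finset.univ : Finset (Fin 4)).card *
      (48 / (4 ^ l * 2 ^ N))))) _ _ fun k _ => ?_).trans ?_
  · refine volume_biUnion_le _ _ fun i' _ => volume_biUnion_le _ _ fun j' _ =>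
      volume_biUnion_le _ _ fun q _ => ?_
    rw [volume_strip (direction_sq_add_sq q), ← ENNReal.ofReal_mul (by positivity)]
    refine ENNReal.ofReal_le_ofReal (le_of_eq ?_)
    rw [show (4 : ℝ) ^ l = 2 ^ l * 2 ^ l by rw [← mul_pow]; norm_num]
    field_simp
    norm_num
  · refine ENNReal.ofReal_le_ofReal ?_
    simp only [Finset.card_range, Finset.card_univ, Fintype.card_fin]
    push_cast
    calc ((2 : ℝ) ^ N + 1) * ((4 * l + 9) * ((4 * l + 9) * (4 * (48 / (4 ^ l * 2 ^ N)))))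
        ≤ (2 * 2 ^ N) * ((4 * l + 9) * ((4 * l + 9) * (4 * (48 / (4 ^ l * 2 ^ N))))) := by
          gcongr
          linarith
      _ = _ := by field_simp

/-- Undoing the rounding costs another unit: the tolerances grow from 2 and 3 to 3 and 4, and the
strips get their exact directions back. -/
theorem cell_subset_stripUnion {n U V : ℕ} (hU : U < 2 ^ depth n) (hV : V < 2 ^ depth n)
    (h : Near n U V) : cell (2 ^ depth n) U V ⊆ stripUnion n := by
  obtain ⟨i, hi, k, hk, i', hi', j', hj', c, -, h⟩ := h
  rw [nearAt_iff] at h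
  obtain ⟨⟨hc1, hc2⟩, q, h⟩ := h
  intro p hp
  simp only [stripUnion, Set.mem_iUnion, Finset.mem_range]
  refine ⟨i, hi, k, hk, i', hi', j', hj', q, Finset.mem_univ q, ?_⟩
  have herr := two_mul_error_le hi
  set l := level n with hl
  set W : ℕ := 2 ^ depth n with hW
  set N := blockStart l + i
  have hWpos : 0 < W := Nat.two_pow_pos _
  have hWR : (0 : ℝ) < W := Nat.cast_pos.2 hWpos
  have hκ := abs_direction_sub_le (abs_div_sub_sqrt_le hc1 hc2 hWpos) q
  obtain ⟨hd1, hd2⟩ := abs_direction_le q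
  have hcorner : ∀ {z : ℝ} {m M : ℕ}, z ∈ Set.Ico ((M : ℝ) / W) ((M + 1) / W) → M < W →
      m < 4 * l + 9 →
      |((M : ℝ) / W + m - (2 * l + 4 : ℕ)) - (z + (m - (2 * l + 4 : ℕ)))| ≤ 1 / W ∧
        |(M : ℝ) / W + m - (2 * l + 4 : ℕ)| ≤ 2 * l + 6 := by
    intro z m M hz hM hm
    have hM1 : (M : ℝ) / W ≤ 1 := by
      rw [div_le_one hWR]
      exact_mod_cast hM.le
    have hM0 : (0 : ℝ) ≤ M / W := by positivity
    have hm' : (m : ℝ) + 1 ≤ 4 * l + 9 := by exact_mod_cast hm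
    have hm0 : (0 : ℝ) ≤ m := Nat.cast_nonneg m
    rw [add_div] at hz
    rw [abs_le, abs_le]
    push_cast
    have hW0 : (0 : ℝ) ≤ 1 / W := by positivity
    refine ⟨⟨?_, ?_⟩, ?_, ?_⟩ <;> linarith [hz.1, hz.2]
  obtain ⟨x1, x2⟩ := hcorner hp.1 hU hi'
  obtain ⟨y1, y2⟩ := hcorner hp.2 hV hj'
  have hrot := abs_rotate_sub_le
    (p := p + ((i' : ℝ) - (2 * l + 4 : ℕ), (j' : ℝ) - (2 * l + 4 : ℕ)))
    (p' := ((U : ℝ) / W + i' - (2 * l + 4 : ℕ), (V : ℝ) / W + j' - (2 * l + 4 : ℕ)))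
    hκ.1 hκ.2 hd1 hd2 x1 y1 x2 y2
  have hfin := h.perturb (Nat.lt_succ_iff.1 hk) ((abs_sub_comm _ _).trans_le hrot.1)
    ((abs_sub_comm _ _).trans_le hrot.2)
  have hpos : 0 ≤ 2 * ((2 * (l : ℝ) + 6 + 1) * (1 / W)) := by positivity
  have hle1 : (1 : ℝ) / (2 ^ l * 2 ^ N) ≤ 1 / 2 ^ l := by
    gcongr
    exact le_mul_of_one_le_right (by positivity) (one_le_pow₀ (by norm_num))
  refine ⟨hfin.1.trans ?_, hfin.2.trans ?_⟩
  · rw [show (3 : ℝ) / 2 ^ l = 2 / 2 ^ l + 1 / 2 ^ l by ring]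
    linarith
  · rw [show (4 : ℝ) / (2 ^ l * 2 ^ N) = 3 / (2 ^ l * 2 ^ N) + 1 / (2 ^ l * 2 ^ N) by ring]
    linarith

theorem coverDensity_zero_le (n : ℕ) : coverDensity n 0 0 0 ≤ 2 ^ 18 * (1 / 2) ^ n := by
  classical
  set S := (Finset.range (2 ^ depth n) ×ˢ Finset.range (2 ^ depth n)).filter
    fun p => Near n p.1 p.2 with hS
  have hcount : coverDensity n 0 0 0 = (S.card : ℝ) / ((2 ^ depth n : ℕ) : ℝ) ^ 2 := by
    have e : (4 : ℝ) ^ depth n = ((2 ^ depth n : ℕ) : ℝ) ^ 2 := by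
      push_cast
      rw [← pow_mul, mul_comm, pow_mul]
      norm_num
    rw [coverDensity, average, e, hS, Finset.card_filter, Finset.sum_product]
    simp [nearInd]
  rw [hcount]
  refine (card_div_le (Nat.two_pow_pos _) S (fun p hp => ?_) (volume_stripUnion_le n)
    (by positivity)).trans ?_
  · simp only [hS, Finset.mem_filter, Finset.mem_product, Finset.mem_range] at hp
    exact cell_subset_stripUnion hp.1.1 hp.1.2 hp.2
  -- The area is `O(l ^ 3 / 2 ^ l)` and `2 ^ l = 16 (2 ^ n) ^ 4` for `l = 4 n + 4`. Three of the
  -- four factors `2 ^ n` absorb the cubic polynomial, and one is left for summability.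
  · have hn : (n : ℝ) + 1 ≤ 2 ^ n := by exact_mod_cast (Nat.lt_two_pow_self : n < 2 ^ n)
    have hn0 : (0 : ℝ) ≤ n := Nat.cast_nonneg n
    have e4 : (4 : ℝ) ^ level n = 2 ^ level n * 2 ^ level n := by rw [← mul_pow]; norm_num
    have e2 : (2 : ℝ) ^ level n = 16 * (2 ^ n) ^ 4 := by rw [level]; ring
    have el : (level n : ℝ) = 4 * n + 4 := by rw [level]; push_cast; ring
    rw [one_div_pow, e4]
    push_cast
    rw [e2, el]
    generalize (2 : ℝ) ^ n = x at hn
    have hx : 0 < x := by linarith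
    calc _ = 24 * (8 * n + 9) * (16 * n + 25) ^ 2 / (x ^ 4) := by field_simp; ring
      _ ≤ 24 * (9 * x) * (25 * x) ^ 2 / x ^ 4 := by gcongr <;> linarith
      _ = 135000 * (1 / x) := by field_simp; norm_num
      _ ≤ 2 ^ 18 * (1 / x) := by gcongr; norm_num

end EEKakeya

end

noncomputable section

namespace EEKakeya

/-! ### The success set and the computability of the martingale -/

theorem coverDensity_le (n : ℕ) {r u v : ℕ} (hu : u < 2 ^ r) (hv : v < 2 ^ r) :
    coverDensity n r u v ≤ 4 ^ r * 2 ^ 18 * (1 / 2) ^ n :=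
  (average_le (fun _ _ => Nat.cast_nonneg _) _ _ _ _ hu hv).trans (by
    rw [mul_assoc]
    exact mul_le_mul_of_nonneg_left (coverDensity_zero_le n) (by positivity))

theorem summable_coverDensity {r u v : ℕ} (hu : u < 2 ^ r) (hv : v < 2 ^ r) :
    Summable fun n => coverDensity n r u v :=
  Summable.of_nonneg_of_le (fun _ => coverDensity_nonneg _ _ _ _)
    (fun n => coverDensity_le n hu hv)
    ((summable_geometric_of_lt_one (by norm_num) (by norm_num)).mul_left _)

theorem isMartingale_totalDensity : IsMartingale totalDensity := by
  intro r u v hu hv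
  refine ⟨tsum_nonneg fun _ => coverDensity_nonneg _ _ _ _, ?_⟩
  have hs : ∀ a ∈ Finset.range 2, ∀ b ∈ Finset.range 2,
      Summable fun n => coverDensity n (r + 1) (2 * u + a) (2 * v + b) := by
    intro a ha b hb
    rw [Finset.mem_range] at ha hb
    refine summable_coverDensity ?_ ?_ <;> rw [pow_succ] <;> omega
  unfold totalDensity
  rw [Finset.sum_congr rfl fun a ha => (Summable.tsum_finsetSum (hs a ha)).symm,
    ← Summable.tsum_finsetSum fun a ha => summable_sum (hs a ha), ← tsum_mul_left]
  exact tsum_congr fun n => average_eq _ _ _ _ _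

/-- The tail is at most `4 ^ r * 2 ^ 18 * 2 * 2 ^ (-cutoff r t) = 2 ^ (-t - 1)`, which explains the
choice of `cutoff`. -/
theorem abs_totalDensity_sub_lt (t : ℕ) {r u v : ℕ} (hu : u < 2 ^ r) (hv : v < 2 ^ r) :
    |totalDensity r u v - ∑ n ∈ Finset.range (cutoff r t), coverDensity n r u v| <
      2 ^ (-(t : ℤ)) := by
  have hs := summable_coverDensity hu hv
  have hs' := (summable_nat_add_iff (cutoff r t)).2 hs
  rw [totalDensity, ← hs.sum_add_tsum_nat_add (cutoff r t), add_sub_cancel_left,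
    abs_of_nonneg (tsum_nonneg fun _ => coverDensity_nonneg _ _ _ _)]
  have hgeo : Summable fun n : ℕ => (4 : ℝ) ^ r * 2 ^ 18 * (1 / 2) ^ (n + cutoff r t) := by
    simp only [pow_add]
    exact ((summable_geometric_of_lt_one (by norm_num) (by norm_num)).mul_right _).mul_left _
  refine lt_of_le_of_lt (hs'.tsum_le_tsum (fun n => coverDensity_le _ hu hv) hgeo) ?_
  rw [tsum_mul_left]
  simp only [pow_add]
  rw [tsum_mul_right, tsum_geometric_of_lt_one (by norm_num) (by norm_num), cutoff, zpow_neg,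
    zpow_natCast, pow_add, pow_add, pow_mul, show (4 : ℝ) ^ r = ((1 / 2 : ℝ) ^ 2) ^ r * 16 ^ r by
      rw [← mul_pow]; norm_num, ← inv_pow]
  have h4 : ((1 / 2 : ℝ) ^ 2) ^ r * ((1 / 2 : ℝ) ^ 2) ^ r * 16 ^ r = 1 := by
    rw [← mul_pow, ← mul_pow]; norm_num
  have ht : (0 : ℝ) < (1 / 2) ^ t := by positivity
  calc _ = (((1 / 2 : ℝ) ^ 2) ^ r * ((1 / 2 : ℝ) ^ 2) ^ r * 16 ^ r) * ((1 / 2) ^ t) *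
        (2 ^ 18 * ((1 - 1 / 2)⁻¹ * (1 / 2) ^ 20)) := by ring
    _ < (2⁻¹) ^ t := by
      rw [h4, show (2⁻¹ : ℝ) = 1 / 2 by norm_num]
      norm_num

/-- For `r ≥ depth n` the `r`-dyadic square of `p` lies inside one square of the `n`-th cover and
has density 1 there. Any `m` covers eventually contribute `m`, so the values even converge to
infinity. -/
theorem mem_successSet {p : ℝ × ℝ} (hp : p ∈ unitSquare) (n₀ : ℕ)
    (h : ∀ n ≥ n₀, Near n ⌊2 ^ depth n * p.1⌋₊ ⌊2 ^ depth n * p.2⌋₊) :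
    p ∈ successSet totalDensity := by
  refine ⟨hp, ?_⟩
  have hlt : ∀ {x : ℝ}, x ∈ Set.Ico (0 : ℝ) 1 → ∀ r : ℕ, ⌊2 ^ r * x⌋₊ < 2 ^ r := by
    intro x hx r
    rw [Nat.floor_lt (mul_nonneg (by positivity) hx.1)]
    push_cast
    have : (0 : ℝ) < 2 ^ r := by positivity
    nlinarith [hx.2]
  have hfloor : ∀ (x : ℝ) {s r : ℕ}, s ≤ r → ⌊2 ^ r * x⌋₊ / 2 ^ (r - s) = ⌊2 ^ s * x⌋₊ := by
    intro x s r hsr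
    rw [← Nat.floor_div_natCast]
    congr 1
    push_cast
    conv_lhs => rw [← Nat.add_sub_cancel' hsr, pow_add]
    rw [Nat.add_sub_cancel_left]
    field_simp
  have hone : ∀ n ≥ n₀, ∀ r ≥ depth n, coverDensity n r ⌊2 ^ r * p.1⌋₊ ⌊2 ^ r * p.2⌋₊ = 1 := by
    intro n hn r hr
    rw [coverDensity, average_of_le _ hr, hfloor _ hr, hfloor _ hr, nearInd, if_pos (h n hn),
      Nat.cast_one]
  have htend : Filter.Tendsto (fun r => valueAt totalDensity r p) Filter.atTop Filter.atTop := by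
    refine Filter.tendsto_atTop.2 fun C => ?_
    obtain ⟨m, hm⟩ := exists_nat_ge C
    filter_upwards [Filter.eventually_ge_atTop
      ((Finset.Ico n₀ (n₀ + m)).sup depth)] with r hr
    refine hm.trans ?_
    have hsum := (summable_coverDensity (hlt hp.1 r) (hlt hp.2 r)).sum_le_tsum
      (Finset.Ico n₀ (n₀ + m)) fun _ _ => coverDensity_nonneg _ _ _ _
    refine le_trans (le_of_eq ?_) hsum
    rw [Finset.sum_congr rfl fun n hn =>
      hone n (Finset.mem_Ico.1 hn).1 r ((Finset.le_sup hn).trans hr)]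
    simp
  exact ((EReal.tendsto_coe_nhds_top_iff).2 htend).limsup_eq

/-! ### The approximation as a fraction of expressions. -/

/-- The numerator of the approximation of the martingale. -/
def numer (r u v t : ℕ) : ℕ :=
  ∑ n ∈ Finset.range (cutoff r t),
    2 ^ (depth (cutoff r t) - depth n) * 2 ^ (depth (cutoff r t) - depth n) *
    ∑ α ∈ Finset.range (2 ^ depth n), ∑ β ∈ Finset.range (2 ^ depth n),
      nearInd n ((2 ^ depth n * u + α) / 2 ^ r) ((2 ^ depth n * v + β) / 2 ^ r)

theorem depth_mono : Monotone depth := fun _ _ h =>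
  Nat.pow_le_pow_right (by omega) (by unfold level; omega)

theorem sum_coverDensity (r u v t : ℕ) :
    ∑ n ∈ Finset.range (cutoff r t), coverDensity n r u v =
      (numer r u v t : ℝ) / ((2 ^ depth (cutoff r t) * 2 ^ depth (cutoff r t) : ℕ) : ℝ) := by
  rw [numer]
  push_cast
  rw [Finset.sum_div]
  refine Finset.sum_congr rfl fun n hn => ?_
  have h := depth_mono (Finset.mem_range.1 hn).le
  obtain ⟨j, hj⟩ := Nat.exists_eq_add_of_le h
  rw [hj, Nat.add_sub_cancel_left, coverDensity, average,
    show (4 : ℝ) ^ depth n = 2 ^ depth n * 2 ^ depth n by rw [← mul_pow]; norm_num]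
  rw [pow_add]
  field_simp

theorem Gen.depth {α : Type} {X : α → ℕ → ℕ} {n M : α → ℕ} (hn : Gen X n) (hM : Gen X M)
    (h : ∀ a, 2 ^ depth (n a) ≤ M a) : Gen X fun a => depth (n a) :=
  ((Gen.const 5).mul (((Gen.const 4).mul hn).add (Gen.const 4))).two_pow hM fun a =>
    Nat.lt_two_pow_self.le.trans (h a)

theorem Gen.nearInd {α : Type} {X : α → ℕ → ℕ} {n U V M : α → ℕ} (hn : Gen X n) (hU : Gen X U)
    (hV : Gen X V) (hM : Gen X M) (h : ∀ a, 2 ^ EEKakeya.depth (n a) ≤ M a) :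
    Gen X fun a => nearInd (n a) (U a) (V a) := GenP.near hn hU hV hM h

theorem Gen.numer {α : Type} {X : α → ℕ → ℕ} {r u v t M : α → ℕ} (hr : Gen X r) (hu : Gen X u)
    (hv : Gen X v) (ht : Gen X t) (hM : Gen X M)
    (h : ∀ a, 2 ^ EEKakeya.depth (cutoff (r a) (t a)) ≤ M a) :
    Gen X fun a => numer (r a) (u a) (v a) (t a) := by
  have hMbig : ∀ (a : α) {e : ℕ}, e ≤ EEKakeya.depth (cutoff (r a) (t a)) → 2 ^ e ≤ M a :=
    fun a e he => (Nat.pow_le_pow_right (by omega) he).trans (h a)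
  have hL : Gen X fun a => cutoff (r a) (t a) :=
    (((Gen.const 2).mul hr).add ht).add (Gen.const 20)
  have hD := hL.depth hM h
  have hr2 : Gen X fun a => 2 ^ r a := hr.two_pow hM fun a => hMbig a (by
    have h1 : r a ≤ 5 * level (cutoff (r a) (t a)) := by unfold level cutoff; omega
    exact h1.trans Nat.lt_two_pow_self.le)
  -- Stated for arbitrary parameters, because it is applied with the summation index `n` adjoined as
  -- a variable.
  have hterm : ∀ {β : Type} {Y : β → ℕ → ℕ} {n r u v D m : β → ℕ}, Gen Y n →
      Gen Y (fun b => 2 ^ r b) → Gen Y u → Gen Y v → Gen Y D → Gen Y m → (∀ b, 2 ^ D b ≤ m b) →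
      (∀ b, 2 ^ EEKakeya.depth (n b) ≤ m b) → Gen Y fun b =>
      2 ^ (D b - EEKakeya.depth (n b)) * 2 ^ (D b - EEKakeya.depth (n b)) *
        ∑ α ∈ Finset.range (2 ^ EEKakeya.depth (n b)), ∑ β ∈ Finset.range (2 ^ EEKakeya.depth (n b)),
        EEKakeya.nearInd (n b) ((2 ^ EEKakeya.depth (n b) * u b + α) / 2 ^ r b)
          ((2 ^ EEKakeya.depth (n b) * v b + β) / 2 ^ r b) := by
    intro β Y n r u v D m hn hr hu hv hD hm hDm hle
    have hd := hn.depth hm hle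
    have hW := hd.two_pow hm hle
    have hdiff := (hD.sub hd).two_pow hm fun b =>
      (Nat.pow_le_pow_right (by omega) (Nat.sub_le _ _)).trans (hDm b)
    have hind : Gen (ext (ext Y fun b => 2 ^ EEKakeya.depth (n b)) fun p =>
        2 ^ EEKakeya.depth (n p.1)) fun q =>
        EEKakeya.nearInd (n q.1.1)
          ((2 ^ EEKakeya.depth (n q.1.1) * u q.1.1 + (q.1.2 : ℕ)) / 2 ^ r q.1.1)
          ((2 ^ EEKakeya.depth (n q.1.1) * v q.1.1 + (q.2 : ℕ)) / 2 ^ r q.1.1) :=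
      Gen.nearInd ((hn.weaken _).weaken _)
        (((((hW.mul hu).weaken _).add (Gen.bound _)).weaken _).div ((hr.weaken _).weaken _)
          fun _ => Nat.two_pow_pos _)
        (((((hW.mul hv).weaken _).weaken _).add (Gen.bound _)).div ((hr.weaken _).weaken _)
          fun _ => Nat.two_pow_pos _)
        ((hm.weaken _).weaken _) fun p => hle p.1.1
    have hinner : Gen (ext Y fun b => 2 ^ EEKakeya.depth (n b)) fun p =>
        ∑ β ∈ Finset.range (2 ^ EEKakeya.depth (n p.1)),
        EEKakeya.nearInd (n p.1)
          ((2 ^ EEKakeya.depth (n p.1) * u p.1 + (p.2 : ℕ)) / 2 ^ r p.1)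
          ((2 ^ EEKakeya.depth (n p.1) * v p.1 + β) / 2 ^ r p.1) :=
      Gen.sum (F := fun (p : (b : β) × Fin (2 ^ EEKakeya.depth (n b))) (β : ℕ) =>
        EEKakeya.nearInd (n p.1)
          ((2 ^ EEKakeya.depth (n p.1) * u p.1 + (p.2 : ℕ)) / 2 ^ r p.1)
          ((2 ^ EEKakeya.depth (n p.1) * v p.1 + β) / 2 ^ r p.1)) (hW.weaken _) hind
    have houter := Gen.sum (F := fun b α =>
      ∑ β ∈ Finset.range (2 ^ EEKakeya.depth (n b)),
        EEKakeya.nearInd (n b) ((2 ^ EEKakeya.depth (n b) * u b + α) / 2 ^ r b)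
          ((2 ^ EEKakeya.depth (n b) * v b + β) / 2 ^ r b)) hW hinner
    exact (hdiff.mul hdiff).mul houter
  exact hL.sum (hterm (Gen.bound _) (hr2.weaken _) (hu.weaken _) (hv.weaken _) (hD.weaken _)
    (hM.weaken _) (fun p => h p.1) fun p => hMbig p.1 (depth_mono p.2.isLt.le))

/-- The exponent on the left is `5 (4 (2 r + t + 20) + 4) = 40 r + 20 t + 420`. -/
theorem depth_cutoff_le (r t : ℕ) : depth (cutoff r t) ≤ 2 ^ (420 * (r + t) + 420) :=
  Nat.pow_le_pow_right (by omega) (by unfold level cutoff; omega)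

theorem computable_approximation : ComputableInDoubleExpTime fun r u v t =>
    (numer r u v t : ℚ) / ((2 ^ depth (cutoff r t) * 2 ^ depth (cutoff r t) : ℕ) : ℚ) := by
  let X₀ : ℕ × ℕ × ℕ × ℕ → ℕ → ℕ := fun a => inputSeq a.1 a.2.1 a.2.2.1 a.2.2.2 0
  have hA : Gen X₀ fun a => 420 * (a.1 + a.2.2.2) + 420 :=
    ((Gen.const 420).mul ((Gen.var 0).add (Gen.var 3))).add (Gen.const 420)
  let M : ℕ × ℕ × ℕ × ℕ → ℕ := fun a => 2 ^ 2 ^ (420 * (a.1 + a.2.2.2) + 420)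
  let X : ℕ × ℕ × ℕ × ℕ → ℕ → ℕ := fun a => inputSeq a.1 a.2.1 a.2.2.1 a.2.2.2 (M a)
  have hM : Gen X M := Gen.var 4
  have hr : Gen X fun a => a.1 := Gen.var 0
  have hu : Gen X fun a => a.2.1 := Gen.var 1
  have hv : Gen X fun a => a.2.2.1 := Gen.var 2
  have ht : Gen X fun a => a.2.2.2 := Gen.var 3
  have hL : Gen X fun a => cutoff a.1 a.2.2.2 :=
    (((Gen.const 2).mul hr).add ht).add (Gen.const 20)
  have hMbig : ∀ (a : ℕ × ℕ × ℕ × ℕ) {e : ℕ}, e ≤ depth (cutoff a.1 a.2.2.2) → 2 ^ e ≤ M a :=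
    fun a e he => Nat.pow_le_pow_right (by omega) (he.trans (depth_cutoff_le _ _))
  have hD := hL.depth hM fun a => hMbig a le_rfl
  have hQ : Gen X fun a => 2 ^ depth (cutoff a.1 a.2.2.2) * 2 ^ depth (cutoff a.1 a.2.2.2) :=
    (hD.two_pow hM fun a => hMbig a le_rfl).mul (hD.two_pow hM fun a => hMbig a le_rfl)
  have hP : Gen X fun a => numer a.1 a.2.1 a.2.2.1 a.2.2.2 :=
    Gen.numer hr hu hv ht hM fun a => hMbig a le_rfl
  obtain ⟨eA, hA⟩ := hA
  obtain ⟨eP, hP⟩ := hP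
  obtain ⟨eQ, hQ⟩ := hQ
  refine computableInDoubleExpTime_of_expr 420 eA eP eQ (by omega)
    (fun r u v t => hA (r, u, v, t)) fun r u v t _ _ => ?_
  have h₁ := hP (r, u, v, t)
  have h₂ := hQ (r, u, v, t)
  simp only [X, M] at h₁ h₂
  rw [h₁, h₂]
  exact ⟨Nat.mul_pos (Nat.two_pow_pos _) (Nat.two_pow_pos _), rfl⟩

theorem isDoubleExpTimeComputable_totalDensity :
    IsDoubleExpTimeComputable totalDensity := by
  refine ⟨_, fun r u v t hu hv => ?_, computable_approximation⟩
  have h := abs_totalDensity_sub_lt t hu hv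
  rw [sum_coverDensity] at h
  simpa only [Rat.cast_div, Rat.cast_natCast] using h

end EEKakeya

end

noncomputable section

namespace EEKakeya

/-! ### Lines in all directions -/

theorem union_rotation_eq :
    lineFamily ∪ rotation (Real.pi / 4) '' lineFamily ∪ rotation (Real.pi / 2) '' lineFamily ∪
      rotation (3 * Real.pi / 4) '' lineFamily =
      ⋃ q : Fin 4, rotation (q * (Real.pi / 4)) '' lineFamily := by
  have h0 : rotation 0 '' lineFamily = lineFamily := by
    rw [show rotation 0 = id from funext fun p => by simp [rotation], Set.image_id]
  ext p
  simp only [Set.mem_union, Set.mem_iUnion, Fin.exists_fin_succ, Fin.val_zero, Fin.val_succ,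
    IsEmpty.exists_iff, or_false]
  norm_num [h0]
  rw [show 2 * (Real.pi / 4) = Real.pi / 2 by ring, show 3 * (Real.pi / 4) = 3 * Real.pi / 4 by ring]
  simp only [or_assoc]

theorem direction_eq (q : Fin 4) :
    direction (√2 / 2) q = (Real.cos (q * (Real.pi / 4)), Real.sin (q * (Real.pi / 4))) := by
  have h2 : 2 * (Real.pi / 4) = Real.pi / 2 := by ring
  have h3 : 3 * (Real.pi / 4) = Real.pi / 4 + Real.pi / 2 := by ring
  fin_cases q
  · simp [direction]
  · simp [direction]
  · simp [direction, h2]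
  · simp [direction, h3, Real.cos_add_pi_div_two, Real.sin_add_pi_div_two]

theorem hash_subset_successSet :
    hash (⋃ q : Fin 4, rotation (q * (Real.pi / 4)) '' lineFamily) ⊆ successSet totalDensity := by
  rintro p ⟨hp, hE⟩
  simp only [Set.mem_iUnion, Set.mem_ofPred_eq] at hE
  obtain ⟨i, j, q, _, ⟨a, ha, x, rfl⟩, hpx⟩ := hE
  obtain ⟨n₀, hn₀⟩ := exists_nat_ge |x|
  refine mem_successSet hp n₀ fun n hn => ?_
  have hx : |x| ≤ level n := hn₀.trans (by
    exact_mod_cast hn.trans (show n ≤ level n by rw [level]; omega))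
  refine near_of_mem (q := q) (i₀ := i) (j₀ := j) hp ha hx ?_ ?_ (direction_sq_add_sq q)
  · rw [direction_eq]
    exact (congrArg Prod.fst hpx).symm
  · rw [direction_eq]
    exact (congrArg Prod.snd hpx).symm

theorem exists_angle_eq (θ : ℝ) : ∃ (q : Fin 4) (φ : ℝ) (m : ℤ), φ ∈ Set.Ico 0 (Real.pi / 4) ∧
    θ = q * (Real.pi / 4) + φ + m * Real.pi := by
  have hpi := Real.pi_pos
  set j := ⌊θ / (Real.pi / 4)⌋ with hj
  have h1 := Int.floor_le (θ / (Real.pi / 4))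
  have h2 := Int.lt_floor_add_one (θ / (Real.pi / 4))
  rw [← hj, le_div_iff₀ (by positivity)] at h1
  rw [← hj, div_lt_iff₀ (by positivity)] at h2
  have hmod := Int.emod_add_mul_ediv j 4
  have h0 := Int.emod_nonneg j (show (4 : ℤ) ≠ 0 by norm_num)
  have h4 := Int.emod_lt_of_pos j (show (0 : ℤ) < 4 by norm_num)
  refine ⟨⟨(j % 4).toNat, by omega⟩, θ - j * (Real.pi / 4), j / 4, ⟨?_, ?_⟩, ?_⟩
  · linarith
  · linarith
  · have e : (((j % 4).toNat : ℕ) : ℝ) = ((j % 4 : ℤ) : ℝ) := by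
      rw [← Int.cast_natCast, Int.toNat_of_nonneg h0]
    have e' : (j : ℝ) = ((j % 4 : ℤ) : ℝ) + 4 * ((j / 4 : ℤ) : ℝ) := by exact_mod_cast hmod.symm
    simp only [e]
    rw [e']
    ring

/-- Modulo `π` every angle is `q π / 4 + φ` with `0 ≤ φ < π / 4`, and `tan φ ∈ [0, 1]` is a slope of
`F`. The sign `(-1) ^ m` from the multiple of `π` only reverses the parametrization of the line. -/
theorem containsLineInEveryDirection_iUnion_rotation :
    ContainsLineInEveryDirection (⋃ q : Fin 4, rotation (q * (Real.pi / 4)) '' lineFamily) := by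
  intro θ
  obtain ⟨q, φ, m, ⟨h0, h1⟩, rfl⟩ := exists_angle_eq θ
  have hpi := Real.pi_pos
  have hcos : 0 < Real.cos φ := Real.cos_pos_of_mem_Ioo ⟨by linarith, by linarith⟩
  have ha : Real.tan φ ∈ Set.Icc (0 : ℝ) 1 := by
    refine ⟨Real.tan_nonneg_of_nonneg_of_le_pi_div_two h0 (by linarith), ?_⟩
    rw [← Real.tan_pi_div_four]
    exact Real.strictMonoOn_tan.monotoneOn ⟨by linarith, by linarith⟩ ⟨by linarith, by linarith⟩ h1.le
  have htan : Real.tan φ * Real.cos φ = Real.sin φ := Real.tan_mul_cos hcos.ne'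
  set ψ := (q : ℝ) * (Real.pi / 4)
  refine ⟨rotation ψ (0, intercept (Real.tan φ)), fun t => Set.mem_iUnion.2 ⟨q, ?_⟩⟩
  rw [Real.cos_add_int_mul_pi, Real.sin_add_int_mul_pi]
  set x := t * ((-1) ^ m * Real.cos φ) with hx
  refine ⟨(x, Real.tan φ * x + intercept (Real.tan φ)), ⟨_, ha, x, rfl⟩, ?_⟩
  have hy : Real.tan φ * x = t * ((-1) ^ m * Real.sin φ) := by
    rw [hx, ← htan]
    ring
  ext
  · simp only [rotation, Prod.fst_add, Prod.smul_fst, smul_eq_mul, Real.cos_add, hy]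
    rw [hx]
    ring
  · simp only [rotation, Prod.snd_add, Prod.smul_snd, smul_eq_mul, Real.sin_add, hy]
    rw [hx]
    ring

end EEKakeya

end

theorem theorem1 :
    ∃ E : Set (ℝ × ℝ),
      E = EEKakeya.lineFamily
          ∪ EEKakeya.rotation (Real.pi / 4) '' EEKakeya.lineFamily
          ∪ EEKakeya.rotation (Real.pi / 2) '' EEKakeya.lineFamily
          ∪ EEKakeya.rotation (3 * Real.pi / 4) '' EEKakeya.lineFamily ∧
      EEKakeya.HasEEMeasureZero E ∧
      EEKakeya.ContainsLineInEveryDirection E := by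
  refine ⟨_, rfl, ?_, ?_⟩
  · rw [EEKakeya.union_rotation_eq]
    exact ⟨EEKakeya.totalDensity,
      EEKakeya.isMartingale_totalDensity,
      EEKakeya.isDoubleExpTimeComputable_totalDensity,
      EEKakeya.hash_subset_successSet⟩
  · rw [EEKakeya.union_rotation_eq]
    exact EEKakeya.containsLineInEveryDirection_iUnion_rotation
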